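/- **Setting.** Let $d\ge 1$, let $\mathcal Z\subseteq\mathbb R^d$ be open, let $\mu,\sigma:\mathcal Z\to\mathbb R^n$ be smooth, and suppose that the pull-back metric $M_\theta(z)=J_\mu(z)^{\top}J_\mu(z)+J_\sigma(z)^{\top}J_\sigma(z)$ is positive definite at each $z\in\mathcal Z$. For a metric $M$ we write $\sqrt{|M|}=\sqrt{\det M}$ for its volume element, $\mathrm{vol}_M$ for its Riemannian volume, and $\|R\|_\infty\le\kappa$ if $|\langle R(u,v)w,x\rangle|\le\kappa|u||v||w||x|$ for all tangent vectors at all points. A *normal coordinate system of radius $s$ at $p$* is a diffeomorphism $\chi$ from an open set $U\subseteq\mathcal Z$ containing $p$ onto the Euclidean ball $B_s(0)$, with $\chi(p)=0$, in which the metric at $p$ is the identity matrix and the straight lines through $0$ are geodesics. A *shortest path* in $(V,M)$ is a $C^1$ curve in $V$ of constant speed that has minimal length among the $C^1$ curves in $V$ with the same end points; the *geodesic ball* $B_\rho^{M,V}(z)$ is the set of points that are joined to $z$ by a $C^1$ curve in $V$ of length less than $\rho$. **Proposition.** Let $d\ge1$, $\varepsilon>0$ and $r>0$. There is $\kappa_0>0$,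 depending only on $d,\varepsilon,r$, and for each $m_1>0$ there is $\delta_0>0$, depending only on $d,\varepsilon,r,m_1$, such that the following holds for all $n,\mathcal Z,\mu,\sigma$ as above. Suppose that 1. the curvature tensor of $M_\theta$ satisfies $\|R\|_\infty\le\kappa$ on $\mathcal Z$ for some $\kappa\le\kappa_0$; 2. $m_1\le\sqrt{|M_\theta(z)|}\le m_2$ for all $z\in\mathcal Z$, where $|m_2-m_1|\le\delta_0$. Let $p\in\mathcal Z$. Then normal coordinate systems of some radius $s\le r$ exist at $p$. For each normal coordinate system $\chi:U\to B_s(0)$ at $p$ with $s\le r$ there is $a>0$ such that the reparametrization $\tilde z=\varphi(z)=a\,\chi(z)$, a diffeomorphism from $U$ onto $\tilde U=B_{as}(0)$, has the following properties. Let $\widetilde M$ be the metric $M_\theta$ expressed in the coordinates $\tilde z$. * *Geodesics of $M_\theta$ are nearly straight in the new coordinates.* Each shortest path $c$ of $(\tilde U,\widetilde M)$ from $x$ to $y$ satisfies $\|c(t)-((1-t)x+ty)\|\le\varepsilon\|y-x\|$ for $t\in[0,1]$, and each solution $c$ of the geodesic equation of $\widetilde M$ in $\tilde U$ on an open time interval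 satisfies $\|\dot c(t)-\dot c(t_0)\|\le\varepsilon\|\dot c(t_0)\|$ for all times $t,t_0$ in the interval. * *Conformal metric.* There is a smooth $m:\tilde U\to(0,\infty)$ such that the conformal metric $M_\psi(\tilde z)=m(\tilde z)\,I_d$ has the same volume element as $M_\theta$ at corresponding points, $\sqrt{|M_\psi(\varphi(z))|}=\sqrt{|M_\theta(z)|}$ for $z\in U$, and such that (a) $|\widetilde M_{ij}(\tilde z)-m(\tilde z)\delta_{ij}|\le\varepsilon\, m(\tilde z)$ for all $\tilde z\in\tilde U$ and all $i,j$; (b) each shortest path $c$ of $(\tilde U,M_\psi)$ from $x$ to $y$ satisfies $\|c(t)-((1-t)x+ty)\|\le\varepsilon\|y-x\|$ for $t\in[0,1]$; (c) for all $z\in U$ and $\rho>0$ with $\|\chi(z)\|+2\rho\le s$, $$(1-\varepsilon)\,\mathrm{vol}_{M_\theta}\big(B^{M_\theta,\mathcal Z}_\rho(z)\big)\le \mathrm{vol}_{M_\psi}\big(B^{M_\psi,\tilde U}_\rho(\varphi(z))\big)\le(1+\varepsilon)\,\mathrm{vol}_{M_\theta}\big(B^{M_\theta,\mathcal Z}_\rho(z)\big).$$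 * *The same with equality of volume forms.* For the same $\varphi$ there is also a smooth $m:\tilde U\to(0,\infty)$ for which $M_\psi=m\,I_d$ satisfies (a), (b), (c), while the volume form of $M_\psi$ pulls back to that of $M_\theta$, i.e. $\sqrt{|M_\psi(\varphi(z))|}\;|\det D\varphi(z)|=\sqrt{|M_\theta(z)|}$ for $z\in U$, and corresponding balls have exactly equal volume: $\mathrm{vol}_{M_\psi}\big(\varphi(B^{M_\theta,\mathcal Z}_\rho(z))\big)=\mathrm{vol}_{M_\theta}\big(B^{M_\theta,\mathcal Z}_\rho(z)\big)$ for all $z\in U$, $\rho>0$ with $\|\chi(z)\|+2\rho\le s$. -/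

import Mathlib

open scoped Matrix ContDiff

/-- Euclidean space `ℝᵈ` with its Euclidean norm. -/
abbrev Euc (d : ℕ) : Type := EuclideanSpace ℝ (Fin d)

/-- The Jacobian matrix of `f` at `z`. -/
noncomputable def jacobian {d n : ℕ} (f : Euc d → Euc n) (z : Euc d) :
    Matrix (Fin n) (Fin d) ℝ :=
  Matrix.of fun i j => fderiv ℝ f z (EuclideanSpace.single j 1) i

/-- The (expected) pull-back metric `J_μᵀ J_μ + J_σᵀ J_σ` of a stochastic generator with
mean `μ` and standard deviation `σ`. -/
noncomputable def pullbackMetric {d n : ℕ} (μ σ : Euc d → Euc n) (z : Euc d) :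
    Matrix (Fin d) (Fin d) ℝ :=
  (jacobian μ z)ᵀ * jacobian μ z + (jacobian σ z)ᵀ * jacobian σ z

/-- The conformally flat metric `m(z) · I`. -/
noncomputable def conformalMetric {d : ℕ} (m : Euc d → ℝ) (z : Euc d) :
    Matrix (Fin d) (Fin d) ℝ :=
  m z • (1 : Matrix (Fin d) (Fin d) ℝ)

/-- The metric `M` expressed in new coordinates, where `f` sends the new coordinates of a point
to its old ones. -/
noncomputable def changeCoords {d : ℕ} (M : Euc d → Matrix (Fin d) (Fin d) ℝ)
    (f : Euc d → Euc d) (w : Euc d) : Matrix (Fin d) (Fin d) ℝ :=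
  (jacobian f w)ᵀ * M (f w) * jacobian f w

/-- The partial derivative `∂ₖ f` at `z`. -/
noncomputable def pderivAt {d : ℕ} (k : Fin d) (f : Euc d → ℝ) (z : Euc d) : ℝ :=
  fderiv ℝ f z (EuclideanSpace.single k 1)

/-- The Christoffel symbol `Γᵏᵢⱼ` of the Levi-Civita connection of `M`. -/
noncomputable def christoffel {d : ℕ} (M : Euc d → Matrix (Fin d) (Fin d) ℝ)
    (k i j : Fin d) (z : Euc d) : ℝ :=
  (1 / 2) * ∑ l, (M z)⁻¹ k l *
    (pderivAt i (fun w => M w j l) z + pderivAt j (fun w => M w i l) z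
      - pderivAt l (fun w => M w i j) z)

/-- The component `l` of `R(∂ᵢ, ∂ⱼ) ∂ₖ`. -/
noncomputable def riemannUp {d : ℕ} (M : Euc d → Matrix (Fin d) (Fin d) ℝ)
    (l i j k : Fin d) (z : Euc d) : ℝ :=
  pderivAt i (christoffel M l j k) z - pderivAt j (christoffel M l i k) z
    + ∑ q, (christoffel M l i q z * christoffel M q j k z
      - christoffel M l j q z * christoffel M q i k z)

/-- The inner product of two tangent vectors at `z`. -/
noncomputable def metricInner {d : ℕ} (M : Euc d → Matrix (Fin d) (Fin d) ℝ)
    (z u v : Euc d) : ℝ :=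
  ∑ i, ∑ j, u i * M z i j * v j

/-- The length of a tangent vector at `z`. -/
noncomputable def metricNorm {d : ℕ} (M : Euc d → Matrix (Fin d) (Fin d) ℝ)
    (z u : Euc d) : ℝ :=
  Real.sqrt (metricInner M z u u)

/-- The tangent vector `R(u, v) w` at `z`. -/
noncomputable def curvatureVec {d : ℕ} (M : Euc d → Matrix (Fin d) (Fin d) ℝ)
    (z u v w : Euc d) : Euc d :=
  WithLp.toLp 2 fun l => ∑ i, ∑ j, ∑ k, riemannUp M l i j k z * u i * v j * w k

/-- The curvature tensor has (coordinate independent) sup-norm at most `κ` on `Z`: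
`|⟨R(u, v) w, x⟩| ≤ κ |u| |v| |w| |x|` at each point of `Z`. -/
def CurvatureBoundedOn {d : ℕ} (M : Euc d → Matrix (Fin d) (Fin d) ℝ) (Z : Set (Euc d))
    (κ : ℝ) : Prop :=
  ∀ z ∈ Z, ∀ u v w x : Euc d,
    |metricInner M z (curvatureVec M z u v w) x| ≤
      κ * metricNorm M z u * metricNorm M z v * metricNorm M z w * metricNorm M z x

/-- The volume element (magnification factor) `√|M(z)|`. -/
noncomputable def volElt {d : ℕ} (M : Euc d → Matrix (Fin d) (Fin d) ℝ) (z : Euc d) : ℝ :=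
  Real.sqrt (M z).det

/-- The Riemannian volume of a set. -/
noncomputable def riemVolume {d : ℕ} (M : Euc d → Matrix (Fin d) (Fin d) ℝ)
    (A : Set (Euc d)) : ENNReal :=
  ∫⁻ z in A, ENNReal.ofReal (volElt M z)

/-- `c` satisfies the geodesic equation of `M` on the open time interval `(a, b)`. -/
def IsGeodesicOn {d : ℕ} (M : Euc d → Matrix (Fin d) (Fin d) ℝ) (c : ℝ → Euc d)
    (a b : ℝ) : Prop :=
  ContDiffOn ℝ 2 c (Set.Ioo a b) ∧
    ∀ t ∈ Set.Ioo a b, ∀ k, deriv (deriv c) t k =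
      -∑ i, ∑ j, christoffel M k i j (c t) * deriv c t i * deriv c t j

/-- `c` is a `C¹` curve `[0, 1] → U` from `x` to `y`. -/
structure IsCurve {d : ℕ} (U : Set (Euc d)) (x y : Euc d) (c : ℝ → Euc d) : Prop where
  contDiffOn : ContDiffOn ℝ 1 c (Set.Icc 0 1)
  mapsTo : Set.MapsTo c (Set.Icc 0 1) U
  source : c 0 = x
  target : c 1 = y

/-- The Riemannian speed of a curve `c` on `[0, 1]`. -/
noncomputable def curveSpeed {d : ℕ} (M : Euc d → Matrix (Fin d) (Fin d) ℝ) (c : ℝ → Euc d)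
    (t : ℝ) : ℝ :=
  metricNorm M (c t) (derivWithin c (Set.Icc 0 1) t)

/-- The Riemannian length of a curve `c` on `[0, 1]`. -/
noncomputable def curveLength {d : ℕ} (M : Euc d → Matrix (Fin d) (Fin d) ℝ)
    (c : ℝ → Euc d) : ℝ :=
  ∫ t in (0 : ℝ)..1, curveSpeed M c t

/-- `c` is a shortest path from `x` to `y` in `U`, parametrized with constant speed. -/
structure IsShortestPath {d : ℕ} (M : Euc d → Matrix (Fin d) (Fin d) ℝ) (U : Set (Euc d))
    (x y : Euc d) (c : ℝ → Euc d) : Prop where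
  isCurve : IsCurve U x y c
  speed_eq : ∀ t ∈ Set.Icc (0 : ℝ) 1, curveSpeed M c t = curveLength M c
  length_le : ∀ c', IsCurve U x y c' → curveLength M c ≤ curveLength M c'

/-- The geodesic ball of radius `ρ` about `z` in the Riemannian manifold `(U, M)`. -/
def geodesicBall {d : ℕ} (M : Euc d → Matrix (Fin d) (Fin d) ℝ) (U : Set (Euc d))
    (z : Euc d) (ρ : ℝ) : Set (Euc d) :=
  {w | ∃ c, IsCurve U z w c ∧ curveLength M c < ρ}

/-- A bijection between open sets that is smooth in both directions. -/
structure IsDiffeo {d : ℕ} (φ : OpenPartialHomeomorph (Euc d) (Euc d)) : Prop where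
  smooth : ContDiffOn ℝ ∞ φ φ.source
  smooth_symm : ContDiffOn ℝ ∞ φ.symm φ.target

/-- `χ` is a normal coordinate system of `(Z, M)` at `p`, with image the Euclidean ball of
radius `s` about `0`: the metric at `p` becomes the identity matrix, and the straight lines
through `0` are geodesics. -/
structure IsNormalCoords {d : ℕ} (M : Euc d → Matrix (Fin d) (Fin d) ℝ) (Z : Set (Euc d))
    (p : Euc d) (s : ℝ) (χ : OpenPartialHomeomorph (Euc d) (Euc d)) : Prop where
  pos : 0 < s
  isDiffeo : IsDiffeo χ
  source_subset : χ.source ⊆ Z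
  target_eq : χ.target = Metric.ball 0 s
  mem_source : p ∈ χ.source
  map_base : χ p = 0
  metric_base : changeCoords M χ.symm 0 = 1
  radial : ∀ v ∈ Metric.ball (0 : Euc d) s, IsGeodesicOn M (fun t => χ.symm (t • v)) (-1) 1

/-- In `(V, M)` each shortest path is `ε`-close (relative to the distance of its end points) to
the straight line between its end points. -/
def ShortestPathsNearlyStraight {d : ℕ} (M : Euc d → Matrix (Fin d) (Fin d) ℝ)
    (V : Set (Euc d)) (ε : ℝ) : Prop :=
  ∀ x y c, IsShortestPath M V x y c → ∀ t ∈ Set.Icc (0 : ℝ) 1,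
    ‖c t - AffineMap.lineMap x y t‖ ≤ ε * ‖y - x‖

/-- In `(V, M)` each solution of the geodesic equation has a velocity vector that is constant up
to a relative error `ε`. -/
def GeodesicsNearlyStraight {d : ℕ} (M : Euc d → Matrix (Fin d) (Fin d) ℝ)
    (V : Set (Euc d)) (ε : ℝ) : Prop :=
  ∀ c a b, IsGeodesicOn M c a b → Set.MapsTo c (Set.Ioo a b) V →
    ∀ t₀ ∈ Set.Ioo a b, ∀ t ∈ Set.Ioo a b, ‖deriv c t - deriv c t₀‖ ≤ ε * ‖deriv c t₀‖

/-- What the conformal metric `M_ψ = m · I` on the image of the reparametrization `φ` has to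
satisfy up to `ε`, where `χ` are the normal coordinates (of radius `s`) of `(Z, M)` behind `φ`:
it is a Riemannian metric, the metric `M` in the new coordinates is `M_ψ` up to the relative
error `ε`, its shortest paths are nearly straight, and the geodesic balls of `(Z, M)` in the
neighbourhood and the corresponding ones of `M_ψ` have the same volume up to the factor
`1 ± ε`. -/
structure IsConformalModel {d : ℕ} (M : Euc d → Matrix (Fin d) (Fin d) ℝ) (Z : Set (Euc d))
    (s : ℝ) (χ φ : OpenPartialHomeomorph (Euc d) (Euc d)) (ε : ℝ) (m : Euc d → ℝ) : Prop where
  smooth : ContDiffOn ℝ ∞ m φ.target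
  pos : ∀ w ∈ φ.target, 0 < m w
  metric_close : ∀ w ∈ φ.target, ∀ i j,
    |changeCoords M φ.symm w i j - conformalMetric m w i j| ≤ ε * m w
  straight : ShortestPathsNearlyStraight (conformalMetric m) φ.target ε
  ball_volume : ∀ z ∈ χ.source, ∀ ρ : ℝ, 0 < ρ → ‖χ z‖ + 2 * ρ ≤ s →
    ENNReal.ofReal (1 - ε) * riemVolume M (geodesicBall M Z z ρ) ≤
        riemVolume (conformalMetric m) (geodesicBall (conformalMetric m) φ.target (φ z) ρ) ∧
      riemVolume (conformalMetric m) (geodesicBall (conformalMetric m) φ.target (φ z) ρ) ≤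
        ENNReal.ofReal (1 + ε) * riemVolume M (geodesicBall M Z z ρ)

/-! Everything rests on one estimate: in normal coordinates of radius s, a metric with curvature at
most κ differs from the identity matrix by O(κs²), and the velocity of a geodesic is constant up to
a relative error O(κs²). Taking κ₀ proportional to r⁻² makes both errors as small as desired for all
s ≤ r.

For the estimate, an orthonormal frame A is transported parallel along the rays from the centre
(`exists_radially_parallel_frame`). Its coframe θ = A⁻¹ and connection form ω obey Cartan's
structure equations along rays: y(t) = tθ(tx)w and z(t) = tω(tx)(w) satisfy y' = w + z x and |z'| ≤
κ|x||y|. As y and z vanish at t = 0, it follows that |θw − w| ≤ 2κs²|w| and |ω(w)| ≤ 2κs|w|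
(`IsNormalMetric.frame_estimates`). Along a geodesic c, the vector u = θ(c') has constant length and
u' = −ω(c')u, so it turns slowly; since c can stay in the ball only for a time of order s/|u|, the
total turning is O(κs²) (`velocity_almost_constant`). Metrics given by matrices are brought into
this setting by the transformation laws of connection and curvature.

The rest is comparison with Euclidean geometry. If lengths lie between l₁ and l₂ times Euclidean
lengths, a point of a shortest path from x to y lies in two Euclidean balls about x and y that
barely overlap (`norm_sub_lineMap_le`), and geodesic balls lie between coordinate balls of radii
ρ/l₂ and ρ/l₁, which compares their volumes.

A conformal factor m is determined by its volume element m^(d/2). For equal volume forms this is the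
volume element of the metric in the new coordinates, which is automatically close to a⁻ᵈ. For equal
volume elements it is that of the original coordinates; the pinching hypothesis puts it near m₁, and
the scale a is chosen with aᵈ = 1/m₁ to match.

Normal coordinates come from a smooth exponential map, obtained by applying the implicit function
theorem to the geodesic equation as an integral equation in a space of continuous curves
(`exists_exponential_map`). -/

set_option linter.unusedSectionVars false

/-! ### Smoothness of composition operators on spaces of continuous functions -/

section Nemytskii

open Topology

universe u

variable {K : Type*} [TopologicalSpace K] [CompactSpace K]
variable {E F : Type u} [NormedAddCommGroup E] [NormedSpace ℝ E]
  [NormedAddCommGroup F] [NormedSpace ℝ F]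

/-- Pointwise application of a continuous family of operators to a continuous function. -/
noncomputable def pointwiseApply (K : Type*) [TopologicalSpace K] [CompactSpace K]
    (E F : Type u) [NormedAddCommGroup E] [NormedSpace ℝ E]
    [NormedAddCommGroup F] [NormedSpace ℝ F] :
    C(K, E →L[ℝ] F) →L[ℝ] C(K, E) →L[ℝ] C(K, F) :=
  LinearMap.mkContinuous₂
    (LinearMap.mk₂ ℝ (fun (A : C(K, E →L[ℝ] F)) (γ : C(K, E)) =>
        (⟨fun t => A t (γ t), A.continuous.clm_apply γ.continuous⟩ : C(K, F)))
      (fun A B γ => by ext; simp) (fun c A γ => by ext; simp)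
      (fun A γ γ' => by ext; simp) (fun c A γ => by ext; simp)) 1
    (fun A γ => by
      rw [one_mul]
      refine (ContinuousMap.norm_le _ (by positivity)).2 fun t => ?_
      refine ((A t).le_opNorm _).trans ?_
      exact mul_le_mul (A.norm_coe_le_norm t) (γ.norm_coe_le_norm t) (norm_nonneg (γ t))
        ((norm_nonneg (A t)).trans (A.norm_coe_le_norm t)))

@[simp] theorem pointwiseApply_apply (A : C(K, E →L[ℝ] F)) (γ : C(K, E)) (t : K) :
    pointwiseApply K E F A γ t = A t (γ t) := rfl

theorem contDiff_pointwiseApply {n : WithTop ℕ∞} : ContDiff ℝ n (pointwiseApply K E F) := by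
  fun_prop

theorem contDiff_compLeftContinuous {n : WithTop ℕ∞} (L : E →L[ℝ] F) :
    ContDiff ℝ n (fun γ : C(K, E) => L.compLeftContinuous ℝ K γ) :=
  ContinuousLinearMap.contDiff (E := C(K, E)) (F := C(K, F)) (L.compLeftContinuous ℝ K)

theorem contDiff_continuousMap_eval {n : WithTop ℕ∞} (t : K) :
    ContDiff ℝ n (fun γ : C(K, E) => γ t) :=
  ContinuousLinearMap.contDiff (E := C(K, E)) (F := E) (ContinuousMap.evalCLM ℝ t)

/-- The range of γ is compact, so f' is uniformly continuous near it; the mean value inequality on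
balls around the points γ t then bounds the remainder uniformly in t. -/
theorem hasFDerivAt_nemytskii (f : C(E, F)) (f' : C(E, E →L[ℝ] F))
    (hf : ∀ x, HasFDerivAt f (f' x) x) (γ : C(K, E)) :
    HasFDerivAt (fun γ : C(K, E) => f.comp γ) (pointwiseApply K E F (f'.comp γ)) γ := by
  rw [hasFDerivAt_iff_isLittleO, Asymptotics.isLittleO_iff]
  intro c hc
  have huc := (isCompact_range γ.continuous).uniformContinuousAt_of_continuousAt f'
    (fun a _ => f'.continuous.continuousAt) (Metric.dist_mem_uniformity hc)
  obtain ⟨δ, hδ, hδ'⟩ := Metric.mem_uniformity_dist.1 huc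
  filter_upwards [Metric.ball_mem_nhds γ hδ] with η hη
  rw [ContinuousMap.norm_le _ (by positivity)]
  intro t
  have hγη : dist (γ t) (η t) < δ := by
    rw [dist_comm]; exact lt_of_le_of_lt (ContinuousMap.dist_apply_le_dist t) hη
  have hle := Convex.norm_image_sub_le_of_norm_hasFDerivWithin_le' (f := f) (f' := f')
    (φ := f' (γ t)) (s := Metric.ball (γ t) δ) (C := c)
    (fun x _ => (hf x).hasFDerivWithinAt)
    (fun x hx => by
      have := hδ' (a := γ t) (b := x) (by rw [dist_comm]; exact hx) ⟨t, rfl⟩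
      rw [← dist_eq_norm, dist_comm]
      exact le_of_lt this)
    (convex_ball _ _) (Metric.mem_ball_self hδ) (y := η t) (by
      rw [Metric.mem_ball, dist_comm]; exact hγη)
  refine le_trans ?_ (hle.trans (mul_le_mul_of_nonneg_left
    (ContinuousMap.norm_coe_le_norm (η - γ) t) hc.le))
  simp

/-- The derivative is the composition operator of f' followed by a bounded linear map, which allows
induction on the order. The target F varies in the induction because f' takes values in `E →L[ℝ] F`;
this stays in the same universe since E and F share one. -/
theorem contDiff_nemytskii_nat (n : ℕ) : ∀ {F : Type u} [NormedAddCommGroup F] [NormedSpace ℝ F]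
    (f : C(E, F)), ContDiff ℝ n f → ContDiff ℝ n (fun γ : C(K, E) => f.comp γ) := by
  induction n with
  | zero =>
    intro F _ _ f _
    exact contDiff_zero.2 (ContinuousMap.continuous_postcomp f)
  | succ n ih =>
    intro F _ _ f hf
    have hf1 : ContDiff ℝ (n + 1 : ℕ) f := hf
    push_cast at hf ⊢
    obtain ⟨f', hf', hd⟩ := contDiff_succ_iff_hasFDerivAt.1 hf
    refine contDiff_succ_iff_hasFDerivAt.2
      ⟨fun γ => pointwiseApply K E F ((⟨f', hf'.continuous⟩ : C(E, E →L[ℝ] F)).comp γ), ?_, ?_⟩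
    · exact contDiff_pointwiseApply.comp (ih ⟨f', hf'.continuous⟩ hf')
    · exact fun γ => hasFDerivAt_nemytskii f ⟨f', hf'.continuous⟩ hd γ

/-- Composition with a fixed smooth map is a smooth operation on continuous functions. -/
theorem contDiff_nemytskii (f : C(E, F)) (hf : ContDiff ℝ ∞ f) :
    ContDiff ℝ ∞ (fun γ : C(K, E) => f.comp γ) :=
  contDiff_infty.2 fun n => contDiff_nemytskii_nat n f (contDiff_infty.1 hf n)

end Nemytskii

/-! ### Volterra operators and their invertibility -/

section Volterra

/-- The interval `[-1, 1]`. -/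
abbrev SymIcc : Type := Set.Icc (-1 : ℝ) 1

theorem neg_one_le_one_real : (-1 : ℝ) ≤ 1 := by norm_num

/-- The constant extension of a function on `[-1, 1]` to the real line. -/
noncomputable abbrev symExtend {F : Type*} (γ : SymIcc → F) : ℝ → F :=
  Set.IccExtend neg_one_le_one_real γ

variable {F : Type*} [NormedAddCommGroup F] [NormedSpace ℝ F]

theorem continuous_symExtend (γ : C(SymIcc, F)) : Continuous (symExtend γ) :=
  γ.continuous.Icc_extend'

theorem symExtend_of_mem (γ : SymIcc → F) {t : ℝ} (ht : t ∈ Set.Icc (-1 : ℝ) 1) :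
    symExtend γ t = γ ⟨t, ht⟩ :=
  Set.IccExtend_of_mem _ _ ht

theorem norm_symExtend_le (γ : C(SymIcc, F)) (t : ℝ) : ‖symExtend γ t‖ ≤ ‖γ‖ :=
  γ.norm_coe_le_norm _

theorem norm_integral_symExtend_le (γ : C(SymIcc, F)) (t : SymIcc) :
    ‖∫ s in (0 : ℝ)..t, symExtend γ s‖ ≤ 1 * ‖γ‖ := by
  have h := intervalIntegral.norm_integral_le_of_norm_le_const (a := 0) (b := (t : ℝ))
    (f := symExtend γ) (C := ‖γ‖) (fun s _ => norm_symExtend_le γ s)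
  have ht : |(t : ℝ) - 0| ≤ 1 := by rw [sub_zero]; exact abs_le.2 t.2
  calc _ ≤ ‖γ‖ * |(t : ℝ) - 0| := h
    _ ≤ ‖γ‖ * 1 := by gcongr
    _ = 1 * ‖γ‖ := by ring

/-- The Volterra operator `γ ↦ ∫₀ᵗ γ` on continuous functions on `[-1, 1]`. -/
noncomputable def volterra (F : Type*) [NormedAddCommGroup F] [NormedSpace ℝ F] :
    C(SymIcc, F) →L[ℝ] C(SymIcc, F) :=
  LinearMap.mkContinuous
    { toFun := fun γ => ⟨fun t => ∫ s in (0 : ℝ)..t, symExtend γ s,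
        (intervalIntegral.continuous_primitive
          (fun a b => (continuous_symExtend γ).intervalIntegrable a b) 0).comp
          continuous_subtype_val⟩
      map_add' := fun γ η => by
        ext t
        have := intervalIntegral.integral_add (a := 0) (b := (t : ℝ)) (μ := MeasureTheory.volume)
          ((continuous_symExtend γ).intervalIntegrable _ _)
          ((continuous_symExtend η).intervalIntegrable _ _)
        exact this
      map_smul' := fun c γ => by
        ext t
        exact intervalIntegral.integral_smul c (symExtend γ) }
    1 (fun γ => (ContinuousMap.norm_le _ (by positivity)).2 (norm_integral_symExtend_le γ))

theorem volterra_apply (γ : C(SymIcc, F)) (t : SymIcc) :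
    volterra F γ t = ∫ s in (0 : ℝ)..t, symExtend γ s := rfl

/-- Rescaling of the interval `[-1, 1]`. -/
noncomputable def symScale (c : SymIcc) : C(SymIcc, SymIcc) :=
  ⟨fun t => ⟨c * t, abs_le.1 (by
      rw [abs_mul]; exact mul_le_one₀ (abs_le.2 c.2) (abs_nonneg _) (abs_le.2 t.2))⟩, by fun_prop⟩

@[simp] theorem symScale_coe (c t : SymIcc) : (symScale c t : ℝ) = c * t := rfl

/-- Substitution in the integral. It is the source of all homogeneity statements along rays below.
-/
theorem volterra_comp_symScale (γ : C(SymIcc, F)) (c : SymIcc) :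
    (volterra F γ).comp (symScale c) = (c : ℝ) • volterra F (γ.comp (symScale c)) := by
  ext t
  simp only [ContinuousMap.comp_apply, ContinuousMap.smul_apply, volterra_apply, symScale_coe]
  have hcongr : ∫ s in (0 : ℝ)..t, symExtend (γ.comp (symScale c)) s =
      ∫ s in (0 : ℝ)..t, symExtend γ (c * s) := by
    refine intervalIntegral.integral_congr fun s hs => ?_
    have hs' : s ∈ Set.Icc (-1 : ℝ) 1 :=
      (Set.uIcc_subset_Icc (by constructor <;> norm_num) t.2) hs
    have hcs : (c : ℝ) * s ∈ Set.Icc (-1 : ℝ) 1 := (symScale c ⟨s, hs'⟩).2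
    rw [symExtend_of_mem _ hs', symExtend_of_mem _ hcs]
    rfl
  rw [hcongr]
  rcases eq_or_ne (c : ℝ) 0 with h0 | h0
  · simp [h0]
  · rw [intervalIntegral.integral_comp_mul_left _ h0, smul_smul, mul_inv_cancel₀ h0]
    simp

theorem hasDerivAt_volterra (γ : C(SymIcc, F)) {t : ℝ} [CompleteSpace F]
    (ht : t ∈ Set.Ioo (-1 : ℝ) 1) :
    HasDerivAt (symExtend (volterra F γ)) (symExtend γ t) t := by
  have h := (continuous_symExtend γ).integral_hasStrictDerivAt 0 t
  refine h.hasDerivAt.congr_of_eventuallyEq ?_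
  filter_upwards [isOpen_Ioo.mem_nhds ht] with s hs
  rw [symExtend_of_mem _ (Set.Ioo_subset_Icc_self hs)]
  rfl

/-- Factorial decay of iterated integrals. It needs T to act pointwise in t, so that the bound for
the n-th iterate at time s can be inserted under the integral. -/
theorem norm_pow_volterra_comp_le (T : C(SymIcc, F) →L[ℝ] C(SymIcc, F)) (b : ℝ) (hb : 0 ≤ b)
    (hT : ∀ γ t, ‖T γ t‖ ≤ b * ‖γ t‖) (n : ℕ) (γ : C(SymIcc, F)) (t : SymIcc) :
    ‖((volterra F ∘L T) ^ n) γ t‖ ≤ (b * |(t : ℝ)|) ^ n / n.factorial * ‖γ‖ := by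
  induction n generalizing t with
  | zero => simpa using γ.norm_coe_le_norm t
  | succ n ih =>
    rw [pow_succ', mul_apply_eq_comp, ContinuousLinearMap.comp_apply, volterra_apply]
    set η := ((volterra F ∘L T) ^ n) γ
    have hpt : ∀ s : ℝ, |s| ≤ 1 → ‖symExtend (T η) s‖ ≤
        b ^ (n + 1) / n.factorial * ‖γ‖ * |s| ^ n := by
      intro s hs
      have hs' : s ∈ Set.Icc (-1 : ℝ) 1 := abs_le.1 hs
      rw [symExtend_of_mem _ hs']
      calc _ ≤ b * ‖η ⟨s, hs'⟩‖ := hT _ _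
        _ ≤ b * ((b * |s|) ^ n / n.factorial * ‖γ‖) := by gcongr; exact ih ⟨s, hs'⟩
        _ = _ := by rw [mul_pow]; ring
    have hfac : ((n + 1).factorial : ℝ) = (n + 1) * n.factorial := by
      rw [Nat.factorial_succ]; push_cast; ring
    have hpos : (0 : ℝ) < n.factorial := by exact_mod_cast n.factorial_pos
    have hcont : Continuous fun s : ℝ => b ^ (n + 1) / n.factorial * ‖γ‖ * |s| ^ n := by fun_prop
    rcases le_total 0 (t : ℝ) with h0 | h0
    · have hle := intervalIntegral.norm_integral_le_of_norm_le (μ := MeasureTheory.volume) h0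
        (f := symExtend (T η)) (g := fun s => b ^ (n + 1) / n.factorial * ‖γ‖ * |s| ^ n)
        (Filter.Eventually.of_forall fun s hs => hpt s (abs_le.2 ⟨by linarith [hs.1], hs.2.trans t.2.2⟩))
        (hcont.intervalIntegrable _ _)
      refine hle.trans (le_of_eq ?_)
      have : ∫ s in (0 : ℝ)..t, b ^ (n + 1) / n.factorial * ‖γ‖ * |s| ^ n =
          ∫ s in (0 : ℝ)..t, b ^ (n + 1) / n.factorial * ‖γ‖ * s ^ n := by
        refine intervalIntegral.integral_congr fun s hs => ?_
        rw [Set.uIcc_of_le h0] at hs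
        simp only [abs_of_nonneg hs.1]
      rw [this, intervalIntegral.integral_const_mul, integral_pow, abs_of_nonneg h0, hfac, mul_pow]
      have : (n : ℝ) + 1 ≠ 0 := by positivity
      field_simp
      simp [mul_comm]
    · rw [intervalIntegral.integral_symm, norm_neg]
      have hle := intervalIntegral.norm_integral_le_of_norm_le (μ := MeasureTheory.volume) h0
        (f := symExtend (T η)) (g := fun s => b ^ (n + 1) / n.factorial * ‖γ‖ * |s| ^ n)
        (Filter.Eventually.of_forall fun s hs => hpt s
          (abs_le.2 ⟨by linarith [hs.1, t.2.1], by linarith [hs.2]⟩))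
        (hcont.intervalIntegrable _ _)
      refine hle.trans (le_of_eq ?_)
      have : ∫ s in (t : ℝ)..0, b ^ (n + 1) / n.factorial * ‖γ‖ * |s| ^ n =
          ∫ s in (t : ℝ)..0, (-1) ^ n * (b ^ (n + 1) / n.factorial * ‖γ‖) * s ^ n := by
        refine intervalIntegral.integral_congr fun s hs => ?_
        rw [Set.uIcc_of_le h0] at hs
        simp only [abs_of_nonpos hs.2]
        rw [neg_pow]; ring
      rw [this, intervalIntegral.integral_const_mul, integral_pow, abs_of_nonpos h0, hfac, mul_pow,
        neg_pow (t : ℝ), pow_succ (-1 : ℝ)]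
      have : (n : ℝ) + 1 ≠ 0 := by positivity
      field_simp
      simp

/-- A Volterra integral equation of the second kind with bounded coefficients is uniquely
solvable. -/
theorem isUnit_one_sub_volterra_comp (T : C(SymIcc, F) →L[ℝ] C(SymIcc, F)) (b : ℝ) (hb : 0 ≤ b)
    [CompleteSpace F] (hT : ∀ γ t, ‖T γ t‖ ≤ b * ‖γ t‖) :
    IsUnit (1 - volterra F ∘L T) := by
  set S := volterra F ∘L T
  obtain ⟨n, hn⟩ := ((FloorSemiring.tendsto_pow_div_factorial_atTop b).eventually
    (gt_mem_nhds one_half_pos)).exists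
  have hS : ‖S ^ n‖ < 1 := by
    refine lt_of_le_of_lt (ContinuousLinearMap.opNorm_le_bound _ (by positivity) fun γ => ?_)
      (hn.trans one_half_lt_one)
    rw [ContinuousMap.norm_le _ (by positivity)]
    intro t
    refine (norm_pow_volterra_comp_le T b hb hT n γ t).trans ?_
    gcongr
    exact mul_le_of_le_one_right hb (abs_le.2 t.2)
  have hu : IsUnit (1 - S ^ n) := isUnit_one_sub_of_norm_lt_one (x := S ^ n) hS
  have hcomm : Commute (∑ i ∈ Finset.range n, S ^ i) (1 - S) := by
    refine Commute.sum_left _ _ _ fun i _ => ?_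
    exact (Commute.one_right _).sub_right ((Commute.refl S).pow_left i)
  -- The invertible operator 1 - S ^ n is a product of commuting factors, one of which is 1 - S.
  rw [← geom_sum_mul_neg, hcomm.isUnit_mul_iff] at hu
  exact hu.2

end Volterra

/-! ### Frames that are parallel along rays -/

section Frame

open Topology

universe u

variable {E F : Type u} [NormedAddCommGroup E] [NormedSpace ℝ E]
  [NormedAddCommGroup F] [NormedSpace ℝ F]

/-- A smooth map on an open ball agrees on each smaller closed ball with a globally smooth map. -/
theorem exists_contDiff_eqOn_closedBall [FiniteDimensional ℝ E] {f : E → F} {c : E} {R r : ℝ}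
    (hr : 0 < r) (hrR : r < R) (hf : ContDiffOn ℝ ∞ f (Metric.ball c R)) :
    ∃ g : E → F, ContDiff ℝ ∞ g ∧ Set.EqOn g f (Metric.closedBall c r) := by
  let φ : ContDiffBump c := ⟨r, (r + R) / 2, hr, by linarith⟩
  refine ⟨fun x => φ x • f x, ?_, fun x hx => by simp [φ.one_of_mem_closedBall hx]⟩
  rw [contDiff_iff_contDiffAt]
  intro x
  by_cases hx : x ∈ Metric.ball c R
  · exact φ.contDiffAt.smul (hf.contDiffAt (Metric.isOpen_ball.mem_nhds hx))
  · have hx' : x ∉ Metric.closedBall c φ.rOut := fun h =>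
      hx (lt_of_le_of_lt h (by change (r + R) / 2 < R; linarith))
    have : (fun x => φ x • f x) =ᶠ[𝓝 x] fun _ => 0 := by
      filter_upwards [Metric.isClosed_closedBall.isOpen_compl.mem_nhds hx'] with y hy
      rw [φ.zero_of_le_dist (le_of_lt (not_le.1 hy)), zero_smul]
    exact contDiffAt_const.congr_of_eventuallyEq this

/-- The map `x ↦ (t ↦ φ(t) x)`. -/
noncomputable def smulConst (E : Type u) [NormedAddCommGroup E] [NormedSpace ℝ E]
    (φ : C(SymIcc, ℝ)) : E →L[ℝ] C(SymIcc, E) :=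
  LinearMap.mkContinuous
    { toFun := fun x => ⟨fun t => φ t • x, by fun_prop⟩
      map_add' := fun x y => by ext; simp
      map_smul' := fun c x => by ext t; exact smul_comm (φ t) c x } ‖φ‖ (fun x => by
        refine (ContinuousMap.norm_le _ (by positivity)).2 fun t => ?_
        refine (norm_smul_le _ _).trans ?_
        exact mul_le_mul_of_nonneg_right (φ.norm_coe_le_norm t) (norm_nonneg x))

@[simp] theorem smulConst_apply (φ : C(SymIcc, ℝ)) (x : E) (t : SymIcc) :
    smulConst E φ x t = φ t • x := rfl

/-- The inclusion of `[-1, 1]` into the real line. -/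
def symCoe : C(SymIcc, ℝ) := ⟨fun t => t, continuous_subtype_val⟩

@[simp] theorem symCoe_apply (t : SymIcc) : symCoe t = t := rfl

open Classical in
/-- The coefficient `t ↦ -Γ(tx) x` of the equation of parallel transport along the ray
through `x`. -/
noncomputable def rayCoeff (Γ : E → E →L[ℝ] E →L[ℝ] E) (x : E) : C(SymIcc, E →L[ℝ] E) :=
  -- The value 0 is a mere default: on the ball where Γ is smooth the condition always holds.
  if h : Continuous (fun t : SymIcc => -(Γ ((t : ℝ) • x) x)) then ⟨_, h⟩ else 0

variable {Γ : E → E →L[ℝ] E →L[ℝ] E} {s : ℝ}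

theorem smul_mem_ball_of_symIcc {x : E} (hx : x ∈ Metric.ball (0 : E) s) (t : SymIcc) :
    (t : ℝ) • x ∈ Metric.ball (0 : E) s := by
  rw [mem_ball_zero_iff] at hx ⊢
  rw [norm_smul]
  exact lt_of_le_of_lt (mul_le_of_le_one_left (norm_nonneg _) (abs_le.2 t.2)) hx

theorem rayCoeff_apply (hΓ : ContDiffOn ℝ ∞ Γ (Metric.ball 0 s)) {x : E}
    (hx : x ∈ Metric.ball (0 : E) s) (t : SymIcc) :
    rayCoeff Γ x t = -(Γ ((t : ℝ) • x) x) := by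
  have h : Continuous (fun t : SymIcc => -(Γ ((t : ℝ) • x) x)) := by
    have h1 : Continuous fun t : SymIcc => Γ ((t : ℝ) • x) :=
      hΓ.continuousOn.comp_continuous (by fun_prop) (smul_mem_ball_of_symIcc hx)
    exact (h1.clm_apply continuous_const).neg
  rw [rayCoeff, dif_pos h]
  rfl

/-- For y near x all points ty stay in a smaller closed ball, on which Γ may be replaced by a
globally smooth map; the coefficient is then a composition operator applied to the linear map y ↦ (t
↦ ty). -/
theorem contDiffOn_rayCoeff [FiniteDimensional ℝ E] (hΓ : ContDiffOn ℝ ∞ Γ (Metric.ball 0 s)) :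
    ContDiffOn ℝ ∞ (rayCoeff Γ) (Metric.ball 0 s) := by
  intro x hx
  refine ContDiffAt.contDiffWithinAt ?_
  have hx' : ‖x‖ < s := mem_ball_zero_iff.1 hx
  obtain ⟨r, hxr, hrs⟩ := exists_between hx'
  obtain ⟨g, hg, hgΓ⟩ := exists_contDiff_eqOn_closedBall ((norm_nonneg x).trans_lt hxr) hrs hΓ
  have hsm : ContDiff ℝ ∞ fun y : E => -(pointwiseApply SymIcc E (E →L[ℝ] E)
      ((⟨g, hg.continuous⟩ : C(E, E →L[ℝ] E →L[ℝ] E)).comp (smulConst E symCoe y))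
      (smulConst E 1 y)) := by
    have h0 : ContDiff ℝ ∞ (⟨g, hg.continuous⟩ : C(E, E →L[ℝ] E →L[ℝ] E)) := hg
    have h1 := (contDiff_nemytskii (K := SymIcc) _ h0).comp (smulConst E symCoe).contDiff
    have h2 := (contDiff_pointwiseApply (K := SymIcc) (E := E) (F := E →L[ℝ] E) (n := ∞)).comp h1
    exact (h2.clm_apply (smulConst E 1).contDiff).neg
  refine hsm.contDiffAt.congr_of_eventuallyEq ?_
  filter_upwards [Metric.isOpen_ball.mem_nhds (mem_ball_zero_iff.2 hxr)] with y hy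
  have hys : y ∈ Metric.ball (0 : E) s := Metric.ball_subset_ball hrs.le hy
  ext1 t
  rw [rayCoeff_apply hΓ hys]
  have := hgΓ (Metric.ball_subset_closedBall (smul_mem_ball_of_symIcc hy t))
  simp [this]

/-- The Volterra operator of the linear differential equation `γ' = B γ`. -/
noncomputable def linearODEOp (B : C(SymIcc, F →L[ℝ] F)) : C(SymIcc, F) →L[ℝ] C(SymIcc, F) :=
  1 - volterra F ∘L pointwiseApply SymIcc F F B

theorem isUnit_linearODEOp [CompleteSpace F] (B : C(SymIcc, F →L[ℝ] F)) :
    IsUnit (linearODEOp B) :=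
  isUnit_one_sub_volterra_comp _ ‖B‖ (by positivity) fun γ t => by
    refine ((B t).le_opNorm (γ t)).trans ?_
    exact mul_le_mul_of_nonneg_right (B.norm_coe_le_norm t) (norm_nonneg (γ t))

/-- The solution on `[-1, 1]` of `γ' = B γ`, `γ(0) = x`. -/
noncomputable def linearODESol (B : C(SymIcc, F →L[ℝ] F)) (x : F) : C(SymIcc, F) :=
  Ring.inverse (linearODEOp B) (ContinuousMap.const _ x)

theorem eq_linearODESol [CompleteSpace F] {B : C(SymIcc, F →L[ℝ] F)} {x : F} {γ : C(SymIcc, F)}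
    (h : linearODEOp B γ = ContinuousMap.const _ x) : γ = linearODESol B x := by
  rw [linearODESol, ← h, ← ContinuousLinearMap.comp_apply, ← ContinuousLinearMap.mul_def,
    Ring.inverse_mul_cancel _ (isUnit_linearODEOp B)]
  rfl

theorem linearODESol_eq [CompleteSpace F] (B : C(SymIcc, F →L[ℝ] F)) (x : F) :
    linearODESol B x = ContinuousMap.const _ x +
      volterra F (pointwiseApply SymIcc F F B (linearODESol B x)) := by
  rw [← sub_eq_iff_eq_add]
  change linearODEOp B (linearODESol B x) = _
  rw [linearODESol, ← ContinuousLinearMap.comp_apply, ← ContinuousLinearMap.mul_def,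
    Ring.mul_inverse_cancel _ (isUnit_linearODEOp B)]
  rfl

theorem contDiff_linearODESol [CompleteSpace F] (x : F) :
    ContDiff ℝ ∞ (fun B : C(SymIcc, F →L[ℝ] F) => linearODESol B x) := by
  have hop : ContDiff ℝ ∞ (linearODEOp (F := F)) :=
    contDiff_const.sub (contDiff_const.clm_comp contDiff_pointwiseApply)
  rw [contDiff_iff_contDiffAt]
  intro B
  obtain ⟨v, hv⟩ := isUnit_linearODEOp B
  have h2 : ContDiffAt ℝ ∞ Ring.inverse (linearODEOp B) := by
    rw [← hv]
    exact contDiffAt_ringInverse (R := C(SymIcc, F) →L[ℝ] C(SymIcc, F)) ℝ v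
  exact (h2.comp B hop.contDiffAt).clm_apply contDiffAt_const

/-- Parallel transport along the ray through `x`. -/
noncomputable def rayTransport (Γ : E → E →L[ℝ] E →L[ℝ] E) (x : E) : C(SymIcc, E →L[ℝ] E) :=
  linearODESol ((ContinuousLinearMap.compL ℝ E E E).compLeftContinuous ℝ SymIcc (rayCoeff Γ x)) 1

theorem rayTransport_eq_add [CompleteSpace E] (Γ : E → E →L[ℝ] E →L[ℝ] E) (x : E) :
    rayTransport Γ x = ContinuousMap.const _ 1 + volterra (E →L[ℝ] E)
      (pointwiseApply SymIcc _ _ ((ContinuousLinearMap.compL ℝ E E E).compLeftContinuous ℝ SymIcc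
        (rayCoeff Γ x)) (rayTransport Γ x)) :=
  linearODESol_eq _ _

/-- Both sides solve the Volterra equation of the ray through c • x, which has only one solution.
Hence transport to time 1 on that ray is transport to time c on the ray through x. -/
theorem rayTransport_comp_symScale [CompleteSpace E] (hΓ : ContDiffOn ℝ ∞ Γ (Metric.ball 0 s))
    {x : E} (hx : x ∈ Metric.ball (0 : E) s) (c : SymIcc) :
    rayTransport Γ ((c : ℝ) • x) = (rayTransport Γ x).comp (symScale c) := by
  refine (eq_linearODESol ?_).symm
  have h := congrArg (fun γ : C(SymIcc, E →L[ℝ] E) => γ.comp (symScale c))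
    (rayTransport_eq_add Γ x)
  simp only [ContinuousMap.add_comp, volterra_comp_symScale] at h
  change (rayTransport Γ x).comp (symScale c) - volterra (E →L[ℝ] E) (pointwiseApply SymIcc _ _
    ((ContinuousLinearMap.compL ℝ E E E).compLeftContinuous ℝ SymIcc (rayCoeff Γ ((c : ℝ) • x)))
      ((rayTransport Γ x).comp (symScale c))) = _
  rw [sub_eq_iff_eq_add]
  refine h.trans ?_
  rw [← map_smul]
  congr 2
  ext1 t
  change (c : ℝ) • (rayCoeff Γ x (symScale c t) ∘L rayTransport Γ x (symScale c t)) =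
    rayCoeff Γ ((c : ℝ) • x) t ∘L rayTransport Γ x (symScale c t)
  rw [rayCoeff_apply hΓ (smul_mem_ball_of_symIcc hx c), rayCoeff_apply hΓ hx]
  simp [smul_smul, mul_comm]

theorem contDiffOn_rayTransport [FiniteDimensional ℝ E]
    (hΓ : ContDiffOn ℝ ∞ Γ (Metric.ball 0 s)) :
    ContDiffOn ℝ ∞ (rayTransport Γ) (Metric.ball 0 s) := by
  have : CompleteSpace E := FiniteDimensional.complete ℝ E
  exact (contDiff_linearODESol (F := E →L[ℝ] E) 1).comp_contDiffOn
    ((contDiff_compLeftContinuous (ContinuousLinearMap.compL ℝ E E E)).comp_contDiffOn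
      (contDiffOn_rayCoeff hΓ))

/-- A connection on a ball admits a smooth frame that is parallel along the rays through the
center. -/
theorem exists_radially_parallel_frame [FiniteDimensional ℝ E] (hs : 0 < s)
    (hΓ : ContDiffOn ℝ ∞ Γ (Metric.ball 0 s)) :
    ∃ A : E → E →L[ℝ] E, ContDiffOn ℝ ∞ A (Metric.ball 0 s) ∧ A 0 = 1 ∧
      ∀ x ∈ Metric.ball (0 : E) s, fderiv ℝ A x x = -(Γ x x ∘L A x) := by
  have : CompleteSpace E := FiniteDimensional.complete ℝ E
  let one : SymIcc := ⟨1, by norm_num⟩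
  have hsm : ContDiffOn ℝ ∞ (fun x => rayTransport Γ x one) (Metric.ball 0 s) :=
    (contDiff_continuousMap_eval (E := E →L[ℝ] E) one).comp_contDiffOn
      (contDiffOn_rayTransport hΓ)
  have hray : ∀ x ∈ Metric.ball (0 : E) s, ∀ t : SymIcc,
      rayTransport Γ ((t : ℝ) • x) one = rayTransport Γ x t := by
    intro x hx t
    rw [rayTransport_comp_symScale hΓ hx]
    refine congrArg (rayTransport Γ x) (Subtype.ext ?_)
    simp [one]
  refine ⟨fun x => rayTransport Γ x one, hsm, ?_, ?_⟩
  · have h0 := hray 0 (Metric.mem_ball_self hs) ⟨0, by norm_num⟩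
    simp only [smul_zero] at h0
    refine h0.trans ((congrArg (fun γ : C(SymIcc, E →L[ℝ] E) => γ ⟨0, by norm_num⟩)
      (rayTransport_eq_add Γ 0)).trans ?_)
    rw [ContinuousMap.add_apply, volterra_apply, intervalIntegral.integral_same]
    simp
  · intro x hx
    have hx' : ‖x‖ < s := mem_ball_zero_iff.1 hx
    -- The integral equation can be differentiated only at interior times. On the ray through c • x
    -- the point x is reached at the interior time c⁻¹, instead of the end point 1.
    obtain ⟨c, hc1, hcx⟩ : ∃ c : ℝ, 1 < c ∧ c * ‖x‖ < s := by
      rcases eq_or_ne ‖x‖ 0 with h0 | h0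
      · exact ⟨2, by norm_num, by rw [h0]; simpa using hs⟩
      · have hpos : 0 < ‖x‖ := lt_of_le_of_ne (norm_nonneg x) (Ne.symm h0)
        obtain ⟨c, h1, h2⟩ := exists_between ((one_lt_div hpos).2 hx')
        exact ⟨c, h1, (lt_div_iff₀ hpos).1 h2⟩
    have hc0 : c ≠ 0 := by positivity
    have hy : c • x ∈ Metric.ball (0 : E) s := by
      rw [mem_ball_zero_iff, norm_smul, Real.norm_of_nonneg (by positivity)]; exact hcx
    have hcinv : c⁻¹ ∈ Set.Ioo (-1 : ℝ) 1 :=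
      ⟨by linarith [inv_pos.2 (zero_lt_one.trans hc1)], inv_lt_one_of_one_lt₀ hc1⟩
    have hd := hasDerivAt_volterra (pointwiseApply SymIcc _ _ ((ContinuousLinearMap.compL ℝ E E E).compLeftContinuous
      ℝ SymIcc (rayCoeff Γ (c • x))) (rayTransport Γ (c • x))) hcinv
    have hd1 : HasDerivAt (fun t : ℝ => rayTransport Γ (t • c • x) one)
        (-(Γ x (c • x) ∘L rayTransport Γ x one)) c⁻¹ := by
      have heq : (fun t : ℝ => rayTransport Γ (t • c • x) one) =ᶠ[𝓝 c⁻¹]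
          fun t => 1 + symExtend (volterra (E →L[ℝ] E) (pointwiseApply SymIcc _ _
            ((ContinuousLinearMap.compL ℝ E E E).compLeftContinuous ℝ SymIcc
              (rayCoeff Γ (c • x))) (rayTransport Γ (c • x)))) t := by
        filter_upwards [isOpen_Ioo.mem_nhds hcinv] with t ht
        have ht' := Set.Ioo_subset_Icc_self ht
        rw [symExtend_of_mem _ ht', hray (c • x) hy ⟨t, ht'⟩]
        exact congrArg (fun γ : C(SymIcc, E →L[ℝ] E) => γ ⟨t, ht'⟩) (rayTransport_eq_add Γ (c • x))
      refine ((hd.const_add 1).congr_of_eventuallyEq heq).congr_deriv ?_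
      have hm := Set.Ioo_subset_Icc_self hcinv
      rw [symExtend_of_mem _ hm]
      change rayCoeff Γ (c • x) ⟨c⁻¹, hm⟩ ∘L rayTransport Γ (c • x) ⟨c⁻¹, hm⟩ = _
      rw [rayCoeff_apply hΓ hy, ← hray (c • x) hy ⟨c⁻¹, hm⟩]
      simp only [smul_smul, inv_mul_cancel₀ hc0, one_smul]
      rw [ContinuousLinearMap.neg_comp]
    have hx2 : c⁻¹ • c • x = x := by rw [smul_smul, inv_mul_cancel₀ hc0, one_smul]
    have hA : HasFDerivAt (fun x => rayTransport Γ x one)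
        (fderiv ℝ (fun x => rayTransport Γ x one) x) (c⁻¹ • c • x) := by
      rw [hx2]
      exact ((hsm.contDiffAt (Metric.isOpen_ball.mem_nhds hx)).differentiableAt
        (by simp)).hasFDerivAt
    have hd2 := hA.comp_hasDerivAt c⁻¹ ((hasDerivAt_id c⁻¹).smul_const (c • x))
    have h3 := hd2.unique hd1
    simp only [one_smul, map_smul, ContinuousLinearMap.smul_comp] at h3
    rw [← smul_neg] at h3
    exact smul_right_injective _ hc0 h3

end Frame

/-! ### The exponential map by the implicit function theorem -/

section ExponentialMap

open Topology

universe u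

variable {E : Type u} [NormedAddCommGroup E] [NormedSpace ℝ E]

theorem volterra_comp_clm {F G : Type*} [NormedAddCommGroup F] [NormedSpace ℝ F] [CompleteSpace F]
    [NormedAddCommGroup G] [NormedSpace ℝ G] [CompleteSpace G] (L : F →L[ℝ] G) (γ : C(SymIcc, F)) :
    volterra G ((L : C(F, G)).comp γ) = (L : C(F, G)).comp (volterra F γ) := by
  ext1 t
  exact L.intervalIntegral_comp_comm ((continuous_symExtend γ).intervalIntegrable _ _)

/-- The geodesic spray of a connection. -/
noncomputable def spray (Γ : E → E →L[ℝ] E →L[ℝ] E) (q : E × E) : E × E :=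
  (q.2, -(Γ q.1 q.2 q.2))

theorem contDiff_spray {Γ : E → E →L[ℝ] E →L[ℝ] E} (hΓ : ContDiff ℝ ∞ Γ) :
    ContDiff ℝ ∞ (spray Γ) := by
  unfold spray
  have h1 : ContDiff ℝ ∞ fun q : E × E => Γ q.1 := hΓ.comp contDiff_fst
  exact contDiff_snd.prodMk ((h1.clm_apply contDiff_snd).clm_apply contDiff_snd).neg

/-- The geodesic equation with initial point `p` and initial velocity `v` as an integral
equation. -/
noncomputable def sprayEqn (f : C(E × E, E × E)) (p : E) (u : E × C(SymIcc, E × E)) :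
    C(SymIcc, E × E) :=
  u.2 - smulConst (E × E) 1 (p, u.1) - volterra (E × E) (f.comp u.2)

theorem contDiff_sprayEqn {f : C(E × E, E × E)} (hf : ContDiff ℝ ∞ f) (p : E) :
    ContDiff ℝ ∞ (sprayEqn f p) := by
  unfold sprayEqn
  have h1 : ContDiff ℝ ∞ fun u : E × C(SymIcc, E × E) => f.comp u.2 :=
    (contDiff_nemytskii f hf).comp contDiff_snd
  have h2 : ContDiff ℝ ∞ fun u : E × C(SymIcc, E × E) => smulConst (E × E) 1 (p, u.1) :=
    (smulConst (E × E) 1).contDiff.comp (contDiff_const.prodMk contDiff_fst)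
  exact (contDiff_snd.sub h2).sub ((volterra (E × E)).contDiff.comp h1)

theorem isInvertible_of_isUnit {F : Type*} [NormedAddCommGroup F] [NormedSpace ℝ F]
    {L : F →L[ℝ] F} (h : IsUnit L) : L.IsInvertible := by
  obtain ⟨v, rfl⟩ := h
  exact ⟨ContinuousLinearEquiv.ofUnit v, rfl⟩

/-- The partial derivative in the curve is the identity minus a Volterra operator with bounded
coefficients. It is invertible at every point, with no smallness condition. -/
theorem isInvertible_fderiv_sprayEqn [CompleteSpace E] {f : C(E × E, E × E)}
    (hf : ContDiff ℝ ∞ f) (p : E) (u : E × C(SymIcc, E × E)) :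
    (fderiv ℝ (sprayEqn f p) u ∘L .inr ℝ E C(SymIcc, E × E)).IsInvertible := by
  let f' : C(E × E, E × E →L[ℝ] E × E) := ⟨fderiv ℝ f, hf.continuous_fderiv (by simp)⟩
  have hf' : ∀ x, HasFDerivAt f (f' x) x := fun x =>
    ((hf.differentiable (by simp)) x).hasFDerivAt
  have hcomp : HasFDerivAt (fun η : C(SymIcc, E × E) => sprayEqn f p (u.1, η))
      (fderiv ℝ (sprayEqn f p) u ∘L .inr ℝ E C(SymIcc, E × E)) u.2 := by
    have h1 := (((contDiff_sprayEqn hf p).differentiable (by simp)) u).hasFDerivAt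
    exact HasFDerivAt.comp (g := sprayEqn f p) u.2 h1 (hasFDerivAt_prodMk_right (𝕜 := ℝ) u.1 u.2)
  have hdir : HasFDerivAt (fun η : C(SymIcc, E × E) => sprayEqn f p (u.1, η))
      (1 - volterra (E × E) ∘L pointwiseApply SymIcc (E × E) (E × E) (f'.comp u.2)) u.2 := by
    have h1 := (volterra (E × E)).hasFDerivAt.comp u.2 (hasFDerivAt_nemytskii f f' hf' u.2)
    exact ((hasFDerivAt_id u.2).sub_const (smulConst (E × E) 1 (p, u.1))).sub h1
  rw [hcomp.unique hdir]
  exact isInvertible_of_isUnit (isUnit_linearODEOp (f'.comp u.2))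

/-- Scaling of the velocity of a point in the tangent bundle. -/
noncomputable def scaleVelocity (E : Type u) [NormedAddCommGroup E] [NormedSpace ℝ E] (t : ℝ) :
    E × E →L[ℝ] E × E :=
  (ContinuousLinearMap.id ℝ E).prodMap (t • ContinuousLinearMap.id ℝ E)

@[simp] theorem scaleVelocity_apply (t : ℝ) (q : E × E) : scaleVelocity E t q = (q.1, t • q.2) :=
  rfl

theorem spray_scaleVelocity (Γ : E → E →L[ℝ] E →L[ℝ] E) (t : ℝ) (q : E × E) :
    spray Γ (scaleVelocity E t q) = t • scaleVelocity E t (spray Γ q) := by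
  simp [spray, smul_smul]

/-- The spray is quadratic in the velocity, so running a geodesic t times as fast gives the geodesic
with initial velocity t • v. -/
theorem sprayEqn_scale [CompleteSpace E] {Γ : E → E →L[ℝ] E →L[ℝ] E} {f : C(E × E, E × E)}
    (hf : ∀ q, f q = spray Γ q) {p v : E} {γ : C(SymIcc, E × E)} (h : sprayEqn f p (v, γ) = 0)
    (t : SymIcc) :
    sprayEqn f p ((t : ℝ) • v,
      (scaleVelocity E t : C(E × E, E × E)).comp (γ.comp (symScale t))) = 0 := by
  have h1 : γ = smulConst (E × E) 1 (p, v) + volterra (E × E) (f.comp γ) := by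
    rw [sprayEqn, sub_sub, sub_eq_zero] at h; exact h
  have h2 := congrArg (fun η : C(SymIcc, E × E) => η.comp (symScale t)) h1
  simp only [ContinuousMap.add_comp, volterra_comp_symScale] at h2
  have h3 : f.comp ((scaleVelocity E t : C(E × E, E × E)).comp (γ.comp (symScale t))) =
      (t : ℝ) • (scaleVelocity E t : C(E × E, E × E)).comp ((f.comp γ).comp (symScale t)) := by
    ext1 τ
    have := spray_scaleVelocity Γ t (γ (symScale t τ))
    rw [← hf, ← hf] at this
    exact this
  rw [sprayEqn, sub_sub, sub_eq_zero, h3, map_smul, volterra_comp_clm]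
  conv_lhs => rw [h2]
  ext1 τ
  change scaleVelocity E t ((1 : ℝ) • (p, v) + (t : ℝ) • volterra (E × E)
    ((f.comp γ).comp (symScale t)) τ) = (1 : ℝ) • (p, (t : ℝ) • v) + (t : ℝ) • scaleVelocity E t
    (volterra (E × E) ((f.comp γ).comp (symScale t)) τ)
  rw [map_add, map_smul, map_smul]
  rfl

/-- Existence of a smooth exponential map near the zero vector at `p`. -/
theorem exists_exponential_map [FiniteDimensional ℝ E] {Γ : E → E →L[ℝ] E →L[ℝ] E} {p : E} {R : ℝ}
    (hR : 0 < R) (hΓ : ContDiffOn ℝ ∞ Γ (Metric.ball p R)) :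
    ∃ (e : E → E) (δ : ℝ), 0 < δ ∧ (∀ v ∈ Metric.ball (0 : E) δ, ContDiffAt ℝ ∞ e v) ∧ e 0 = p ∧
      HasFDerivAt e (ContinuousLinearMap.id ℝ E) 0 ∧
      ∀ v ∈ Metric.ball (0 : E) δ, ∃ w : ℝ → E, ∀ t ∈ Set.Ioo (-1 : ℝ) 1,
        e (t • v) ∈ Metric.ball p R ∧ HasDerivAt (fun t : ℝ => e (t • v)) (w t) t ∧
        HasDerivAt w (-(Γ (e (t • v)) (w t) (w t))) t := by
  have : CompleteSpace E := FiniteDimensional.complete ℝ E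
  -- A global extension makes the composition operator available; geodesics near the constant one
  -- remain where g and Γ agree.
  obtain ⟨g, hg, hgΓ⟩ := exists_contDiff_eqOn_closedBall (half_pos hR) (half_lt_self hR) hΓ
  let f : C(E × E, E × E) := ⟨spray g, (contDiff_spray hg).continuous⟩
  have hf : ContDiff ℝ ∞ f := contDiff_spray hg
  let γ₀ : C(SymIcc, E × E) := smulConst (E × E) 1 (p, 0)
  have hfγ₀ : f.comp γ₀ = 0 := by
    ext1 t
    simp [f, γ₀, spray]
  have hH₀ : sprayEqn f p (0, γ₀) = 0 := by
    simp only [sprayEqn, hfγ₀, map_zero, sub_zero]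
    exact sub_self _
  have hH := fun u => (contDiff_sprayEqn hf p).contDiffAt (x := u)
  have hne : (∞ : WithTop ℕ∞) ≠ 0 := by simp
  have hinv := isInvertible_fderiv_sprayEqn hf p
  let ψ := (hH (0, γ₀)).implicitFunction hne (hinv (0, γ₀))
  have hψ0 : ψ 0 = γ₀ := (hH (0, γ₀)).implicitFunction_apply_self hne (hinv (0, γ₀))
  have hψsol : ∀ᶠ v in 𝓝 (0 : E), sprayEqn f p (v, ψ v) = 0 := by
    have := (hH (0, γ₀)).eventually_apply_implicitFunction hne (hinv (0, γ₀))
    rw [hH₀] at this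
    exact this
  have hψuniq := (hH (0, γ₀)).eventually_apply_eq_iff_implicitFunction hne (hinv (0, γ₀))
  rw [hH₀] at hψuniq
  have hψ1 : ∀ᶠ v in 𝓝 (0 : E), ContDiffAt ℝ 1 ψ v :=
    (((hH (0, γ₀)).contDiffAt_implicitFunction hne (hinv (0, γ₀))).of_le
      (by exact_mod_cast le_top)).eventually (by simp)
  -- Being C^∞ at one point does not spread to a neighbourhood, unlike being C¹. The implicit
  -- function theorem is therefore applied anew at each nearby solution, and local uniqueness
  -- identifies the new implicit function with ψ.
  have hψsm : ∀ᶠ v in 𝓝 (0 : E), ContDiffAt ℝ ∞ ψ v := by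
    filter_upwards [hψsol.eventually_nhds, hψ1] with v hv hv1
    have hloc : ∀ᶠ v' in 𝓝 v,
        (hH (v, ψ v)).implicitFunction hne (hinv (v, ψ v)) v' = ψ v' := by
      have h1 := (hH (v, ψ v)).eventually_apply_eq_iff_implicitFunction hne (hinv (v, ψ v))
      have hcont : Filter.Tendsto (fun v' => (v', ψ v')) (𝓝 v) (𝓝 (v, ψ v)) :=
        (continuousAt_id.prodMk hv1.continuousAt)
      filter_upwards [hcont.eventually h1, hv] with v' h2 h3
      exact h2.1 (h3.trans hv.self_of_nhds.symm)
    exact ((hH (v, ψ v)).contDiffAt_implicitFunction hne (hinv (v, ψ v))).congr_of_eventuallyEq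
      (hloc.mono fun _ h => h.symm)
  obtain ⟨ρ, hρ, hρuniq⟩ := Metric.eventually_nhds_iff.1 hψuniq
  have hψnear : ∀ᶠ v in 𝓝 (0 : E), dist (ψ v) γ₀ < min ρ (R / 2) := by
    have hc : ContinuousAt ψ 0 := hψ1.self_of_nhds.continuousAt
    have := hc (Metric.ball_mem_nhds _ (lt_min hρ (half_pos hR)))
    rw [hψ0] at this
    exact this
  obtain ⟨δ, hδ, hδ'⟩ := Metric.eventually_nhds_iff.1
    ((hψsol.and hψsm).and (hψnear.and (Metric.ball_mem_nhds (0 : E) hρ)))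
  -- The rescaled curve solves the equation for t • v and is at least as close to the constant curve
  -- as ψ v, so local uniqueness makes it ψ (t • v). In particular the end point for t • v is the
  -- point at time t for v.
  have hfix : ∀ v ∈ Metric.ball (0 : E) δ, ∀ t : SymIcc, ψ ((t : ℝ) • v) =
      (scaleVelocity E t : C(E × E, E × E)).comp ((ψ v).comp (symScale t)) := by
    intro v hv t
    obtain ⟨⟨h1, -⟩, h2, h3⟩ := hδ' hv
    have htv := smul_mem_ball_of_symIcc h3 t
    refine (hρuniq (y := ((t : ℝ) • v, _)) ?_).1 (sprayEqn_scale (fun _ => rfl) h1 t)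
    rw [Prod.dist_eq]
    refine max_lt htv (lt_of_le_of_lt ?_ (h2.trans_le (min_le_left _ _)))
    refine (ContinuousMap.dist_le dist_nonneg).2 fun τ => ?_
    have h4 := ContinuousMap.dist_apply_le_dist (f := ψ v) (g := γ₀) (symScale t τ)
    refine le_trans ?_ h4
    change dist (scaleVelocity E t (ψ v (symScale t τ))) ((1 : ℝ) • (p, (0 : E))) ≤
      dist (ψ v (symScale t τ)) ((1 : ℝ) • (p, (0 : E)))
    rw [one_smul, scaleVelocity_apply, Prod.dist_eq, Prod.dist_eq, dist_zero_right,
      dist_zero_right, norm_smul]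
    exact max_le_max le_rfl (mul_le_of_le_one_left (norm_nonneg _) (abs_le.2 t.2))
  let one : SymIcc := ⟨1, by norm_num⟩
  have hray : ∀ v ∈ Metric.ball (0 : E) δ, ∀ t : SymIcc,
      (ψ ((t : ℝ) • v) one).1 = (ψ v t).1 := by
    intro v hv t
    rw [hfix v hv t]
    have : symScale t one = t := Subtype.ext (by simp [one])
    simp [this]
  have hsol : ∀ v ∈ Metric.ball (0 : E) δ, ∀ t ∈ Set.Ioo (-1 : ℝ) 1,
      HasDerivAt (symExtend (ψ v)) (spray g (symExtend (ψ v) t)) t := by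
    intro v hv t ht
    have h1 : ψ v = smulConst (E × E) 1 (p, v) + volterra (E × E) (f.comp (ψ v)) := by
      have := (hδ' hv).1.1
      rw [sprayEqn, sub_sub, sub_eq_zero] at this; exact this
    have h2 := (hasDerivAt_volterra (f.comp (ψ v)) ht).const_add ((p, v) : E × E)
    refine (h2.congr_of_eventuallyEq ?_).congr_deriv ?_
    · filter_upwards [isOpen_Ioo.mem_nhds ht] with s hs
      have hs' := Set.Ioo_subset_Icc_self hs
      rw [symExtend_of_mem _ hs', symExtend_of_mem _ hs']
      refine (congrArg (fun η : C(SymIcc, E × E) => η ⟨s, hs'⟩) h1).trans ?_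
      simp
    · have ht' := Set.Ioo_subset_Icc_self ht
      rw [symExtend_of_mem _ ht', symExtend_of_mem _ ht']
      rfl
  have hcurve : ∀ v ∈ Metric.ball (0 : E) δ, ∀ t ∈ Set.Ioo (-1 : ℝ) 1,
      HasDerivAt (fun t : ℝ => (ψ (t • v) one).1) (symExtend (ψ v) t).2 t := by
    intro v hv t ht
    refine ((ContinuousLinearMap.fst ℝ E E).hasFDerivAt.comp_hasDerivAt t
      (hsol v hv t ht)).congr_of_eventuallyEq ?_
    filter_upwards [isOpen_Ioo.mem_nhds ht] with s hs
    have hs' := Set.Ioo_subset_Icc_self hs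
    change _ = (symExtend (ψ v) s).1
    rw [symExtend_of_mem _ hs']
    exact hray v hv ⟨s, hs'⟩
  have hsm : ∀ v ∈ Metric.ball (0 : E) δ, ContDiffAt ℝ ∞ (fun v => (ψ v one).1) v := by
    intro v hv
    have h1 : ContDiffAt ℝ ∞ (fun v => ψ v one) v :=
      (contDiff_continuousMap_eval (E := E × E) one).contDiffAt.comp v (hδ' hv).1.2
    exact h1.fst
  refine ⟨fun v => (ψ v one).1, δ, hδ, hsm, ?_, ?_, ?_⟩
  · simp [hψ0, γ₀]
  · have h0 : (0 : E) ∈ Metric.ball (0 : E) δ := Metric.mem_ball_self hδ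
    have hd := ((hsm 0 h0).differentiableAt hne).hasFDerivAt
    refine hd.congr_fderiv ?_
    -- The directional derivative at 0 is the initial velocity of the geodesic t ↦ e (t • v), which
    -- is v; linearity then removes the restriction to small v.
    have key : ∀ v ∈ Metric.ball (0 : E) δ,
        fderiv ℝ (fun v => (ψ v one).1) 0 v = v := by
      intro v hv
      have h1 := hcurve v hv 0 (by norm_num)
      have h2 : HasDerivAt (fun t : ℝ => (ψ (t • v) one).1)
          (fderiv ℝ (fun v => (ψ v one).1) 0 ((1 : ℝ) • v)) 0 := by
        have hd' : HasFDerivAt (fun v => (ψ v one).1) (fderiv ℝ (fun v => (ψ v one).1) 0)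
            ((0 : ℝ) • v) := by rwa [zero_smul]
        exact hd'.comp_hasDerivAt 0 ((hasDerivAt_id (0 : ℝ)).smul_const v)
      have h3 : (symExtend (ψ v) 0).2 = v := by
        have h4 : ψ v = smulConst (E × E) 1 (p, v) + volterra (E × E) (f.comp (ψ v)) := by
          have := (hδ' hv).1.1
          rw [sprayEqn, sub_sub, sub_eq_zero] at this; exact this
        have hm : (0 : ℝ) ∈ Set.Icc (-1 : ℝ) 1 := by norm_num
        rw [symExtend_of_mem _ hm]
        refine (congrArg (fun η : C(SymIcc, E × E) => (η ⟨0, hm⟩).2) h4).trans ?_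
        rw [ContinuousMap.add_apply, volterra_apply, intervalIntegral.integral_same]
        simp
      have h5 := h2.unique h1
      rwa [one_smul, h3] at h5
    ext v
    obtain ⟨c, hc, hcv⟩ : ∃ c : ℝ, c ≠ 0 ∧ c • v ∈ Metric.ball (0 : E) δ := by
      have : Filter.Tendsto (fun c : ℝ => c • v) (𝓝[≠] 0) (𝓝 0) := by
        have h : ContinuousAt (fun c : ℝ => c • v) 0 := by fun_prop
        have := h.tendsto
        rw [zero_smul] at this
        exact this.mono_left nhdsWithin_le_nhds
      obtain ⟨c, hc⟩ := ((this.eventually (Metric.ball_mem_nhds _ hδ)).and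
        self_mem_nhdsWithin).exists
      exact ⟨c, hc.2, hc.1⟩
    have := key _ hcv
    rw [map_smul] at this
    exact smul_right_injective _ hc this
  · intro v hv
    refine ⟨fun t => (symExtend (ψ v) t).2, fun t ht => ?_⟩
    have ht' := Set.Ioo_subset_Icc_self ht
    have hpos : (ψ (t • v) one).1 = (symExtend (ψ v) t).1 := by
      rw [symExtend_of_mem _ ht']; exact hray v hv ⟨t, ht'⟩
    have hball : (ψ (t • v) one).1 ∈ Metric.closedBall p (R / 2) := by
      rw [hray v hv ⟨t, ht'⟩]
      have h1 := (ContinuousMap.dist_apply_le_dist (f := ψ v) (g := γ₀) ⟨t, ht'⟩).trans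
        ((hδ' hv).2.1.le.trans (min_le_right _ _))
      rw [Prod.dist_eq] at h1
      have h2 := (le_max_left _ _).trans h1
      simpa [γ₀] using h2
    refine ⟨Metric.closedBall_subset_ball (half_lt_self hR) hball, hcurve v hv t ht, ?_⟩
    have h1 := (ContinuousLinearMap.snd ℝ E E).hasFDerivAt.comp_hasDerivAt t (hsol v hv t ht)
    refine h1.congr_deriv ?_
    change -(g (symExtend (ψ v) t).1 _ _) = _
    rw [← hpos, hgΓ hball]

end ExponentialMap

/-! ### Orthonormality of the radially parallel frame in normal coordinates -/

section NormalCoordinates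

open Topology
open scoped InnerProductSpace

universe u

variable {E : Type u} [NormedAddCommGroup E] [InnerProductSpace ℝ E]

/-- The curvature tensor of a connection on an open subset of a vector space. -/
noncomputable def connCurvature {E : Type u} [NormedAddCommGroup E] [NormedSpace ℝ E]
    (Γ : E → E →L[ℝ] E →L[ℝ] E) (x u v w : E) : E :=
  fderiv ℝ Γ x u v w - fderiv ℝ Γ x v u w + Γ x u (Γ x v w) - Γ x v (Γ x u w)

/-- A Riemannian metric with its Levi-Civita connection on a ball, in normal coordinates, with
curvature bounded by `κ`. -/
structure IsNormalMetric (s κ : ℝ) (G : E → E →L[ℝ] E →L[ℝ] ℝ) (Γ : E → E →L[ℝ] E →L[ℝ] E) :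
    Prop where
  smooth_metric : ContDiffOn ℝ ∞ G (Metric.ball 0 s)
  smooth_conn : ContDiffOn ℝ ∞ Γ (Metric.ball 0 s)
  symm : ∀ x ∈ Metric.ball (0 : E) s, ∀ u v, Γ x u v = Γ x v u
  compat : ∀ x ∈ Metric.ball (0 : E) s, ∀ w u v,
    fderiv ℝ G x w u v = G x (Γ x w u) v + G x u (Γ x w v)
  base : ∀ u v, G 0 u v = ⟪u, v⟫_ℝ
  radial : ∀ x ∈ Metric.ball (0 : E) s, Γ x x x = 0
  curvature : ∀ x ∈ Metric.ball (0 : E) s, ∀ u v w z,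
    |G x (connCurvature Γ x u v w) z| ≤
      κ * √(G x u u) * √(G x v v) * √(G x w w) * √(G x z z)

/-- Growth estimate for the structure equations along a ray. -/
theorem structure_equation_estimate {F : Type*} [NormedAddCommGroup F] [NormedSpace ℝ F]
    {y : ℝ → E} {z z' : ℝ → F} {ζ : F →L[ℝ] E} {w : E} {k l : ℝ} (hk : 0 ≤ k) (hl : 0 ≤ l)
    (hkl : k * l ≤ 1 / 2)
    (hy0 : y 0 = 0) (hz0 : z 0 = 0) (hζ : ‖ζ‖ ≤ l)
    (hy : ∀ t ∈ Set.Icc (0 : ℝ) 1, HasDerivAt y (w + ζ (z t)) t)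
    (hz : ∀ t ∈ Set.Icc (0 : ℝ) 1, HasDerivAt z (z' t) t)
    (hz' : ∀ t ∈ Set.Icc (0 : ℝ) 1, ‖z' t‖ ≤ k * ‖y t‖) :
    ‖y 1 - w‖ ≤ 2 * (k * l) * ‖w‖ ∧ ‖z 1‖ ≤ 2 * k * ‖w‖ := by
  have hcont : ContinuousOn y (Set.Icc 0 1) := fun t ht => (hy t ht).continuousAt.continuousWithinAt
  obtain ⟨t₀, ht₀, hmax⟩ := isCompact_Icc.exists_isMaxOn (Set.nonempty_Icc.2 zero_le_one)
    hcont.norm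
  set M := ‖y t₀‖ with hM
  have hM0 : 0 ≤ M := norm_nonneg _
  have hmax' : ∀ t ∈ Set.Icc (0 : ℝ) 1, ‖y t‖ ≤ M := fun t ht => hmax ht
  have h01 : (0 : ℝ) ∈ Set.Icc (0 : ℝ) 1 := by norm_num
  have hzM : ∀ t ∈ Set.Icc (0 : ℝ) 1, ‖z t‖ ≤ k * M := by
    intro t ht
    have h := (convex_Icc (0 : ℝ) 1).norm_image_sub_le_of_norm_hasDerivWithin_le
      (fun t ht => (hz t ht).hasDerivWithinAt)
      (fun t ht => (hz' t ht).trans (mul_le_mul_of_nonneg_left (hmax' t ht) hk)) h01 ht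
    rw [hz0, sub_zero, sub_zero, Real.norm_of_nonneg ht.1] at h
    exact h.trans (mul_le_of_le_one_right (by positivity) ht.2)
  have hyM : ∀ t ∈ Set.Icc (0 : ℝ) 1, ‖y t - t • w‖ ≤ k * l * M := by
    intro t ht
    have h := (convex_Icc (0 : ℝ) 1).norm_image_sub_le_of_norm_hasDerivWithin_le
      (f := fun t => y t - t • w) (f' := fun t => ζ (z t)) (C := k * l * M)
      (fun t ht => by
        refine (((hy t ht).sub ((hasDerivAt_id t).smul_const w)).congr_deriv ?_).hasDerivWithinAt
        simp)
      (fun t ht => by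
        calc ‖ζ (z t)‖ ≤ ‖ζ‖ * ‖z t‖ := ζ.le_opNorm _
          _ ≤ l * (k * M) := mul_le_mul hζ (hzM t ht) (norm_nonneg _) hl
          _ = k * l * M := by ring) h01 ht
    simp only [hy0, zero_smul, sub_zero] at h
    rw [Real.norm_of_nonneg ht.1] at h
    exact h.trans (mul_le_of_le_one_right (by positivity) ht.2)
  -- At the maximum point the bound reads M ≤ ‖w‖ + klM, and kl ≤ 1/2 absorbs the last term.
  have hMw : M ≤ 2 * ‖w‖ := by
    have h1 := hyM t₀ ht₀
    have h2 : M ≤ ‖y t₀ - t₀ • w‖ + ‖t₀ • w‖ := by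
      simpa using norm_add_le (y t₀ - t₀ • w) (t₀ • w)
    have h3 : ‖t₀ • w‖ ≤ ‖w‖ := by
      rw [norm_smul, Real.norm_of_nonneg ht₀.1]
      exact mul_le_of_le_one_left (norm_nonneg _) ht₀.2
    nlinarith
  have h11 : (1 : ℝ) ∈ Set.Icc (0 : ℝ) 1 := by norm_num
  constructor
  · have := hyM 1 h11
    rw [one_smul] at this
    refine this.trans ?_
    calc k * l * M ≤ k * l * (2 * ‖w‖) := by gcongr
      _ = _ := by ring
  · calc ‖z 1‖ ≤ k * M := hzM 1 h11
      _ ≤ k * (2 * ‖w‖) := by gcongr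
      _ = _ := by ring

theorem hasDerivAt_ringInverse_clm [CompleteSpace E] {a : ℝ → E →L[ℝ] E} {a' : E →L[ℝ] E} {t : ℝ}
    (h : HasDerivAt a a' t) (hu : IsUnit (a t)) :
    HasDerivAt (fun t => Ring.inverse (a t))
      (-(Ring.inverse (a t) ∘L a' ∘L Ring.inverse (a t))) t := by
  obtain ⟨v, hv⟩ := hu
  have h1 := hasFDerivAt_ringInverse (𝕜 := ℝ) (R := E →L[ℝ] E) v
  rw [hv] at h1
  refine (h1.comp_hasDerivAt t h).congr_deriv ?_
  rw [← hv, Ring.inverse_unit]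
  ext x
  simp

namespace IsNormalMetric

variable {s κ : ℝ} {G : E → E →L[ℝ] E →L[ℝ] ℝ} {Γ : E → E →L[ℝ] E →L[ℝ] E}

theorem smul_mem_ball {x : E} (hx : x ∈ Metric.ball (0 : E) s) {t : ℝ}
    (ht : t ∈ Set.Icc (0 : ℝ) 1) : t • x ∈ Metric.ball (0 : E) s :=
  smul_mem_ball_of_symIcc hx ⟨t, by linarith [ht.1], ht.2⟩

/-- For t ≠ 0 the factor t² is cancelled in the radial condition; t = 0 follows by continuity. -/
theorem radial_smul (h : IsNormalMetric s κ G Γ) {x : E} (t : ℝ)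
    (hx : t • x ∈ Metric.ball (0 : E) s) : Γ (t • x) x x = 0 := by
  have hne : ∀ t : ℝ, t ≠ 0 → t • x ∈ Metric.ball (0 : E) s → Γ (t • x) x x = 0 := by
    intro t ht hx
    have := h.radial _ hx
    simp only [map_smul, smul_apply, smul_smul] at this
    exact (smul_eq_zero.1 this).resolve_left (mul_ne_zero ht ht)
  rcases eq_or_ne t 0 with rfl | ht
  · rw [zero_smul] at hx ⊢
    have hc : ContinuousAt (fun t : ℝ => Γ (t • x) x x) 0 := by
      have h1 : ContinuousAt Γ ((0 : ℝ) • x) := by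
        rw [zero_smul]
        exact h.smooth_conn.continuousOn.continuousAt (Metric.isOpen_ball.mem_nhds hx)
      have h2 : ContinuousAt (fun t : ℝ => Γ (t • x)) 0 :=
        ContinuousAt.comp (f := fun t : ℝ => t • x) h1 (by fun_prop)
      exact (h2.clm_apply continuousAt_const).clm_apply continuousAt_const
    have hz : ∀ᶠ t : ℝ in 𝓝[≠] 0, Γ (t • x) x x = 0 := by
      have hb : ∀ᶠ t : ℝ in 𝓝 0, t • x ∈ Metric.ball (0 : E) s := by
        have : ContinuousAt (fun t : ℝ => t • x) 0 := by fun_prop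
        refine this (Metric.isOpen_ball.mem_nhds ?_)
        simpa using hx
      filter_upwards [hb.filter_mono nhdsWithin_le_nhds, self_mem_nhdsWithin] with t h1 h2
      exact hne t h2 h1
    have := tendsto_nhds_unique (hc.tendsto.mono_left nhdsWithin_le_nhds)
      (tendsto_const_nhds.congr' (hz.mono fun _ h => h.symm))
    simpa using this
  · exact hne t ht hx

variable {A : E → E →L[ℝ] E}

theorem frame_ray_deriv (h : IsNormalMetric s κ G Γ) (hA : ContDiffOn ℝ ∞ A (Metric.ball 0 s))
    (hpar : ∀ x ∈ Metric.ball (0 : E) s, fderiv ℝ A x x = -(Γ x x ∘L A x)) {x : E} (t : ℝ)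
    (hx : t • x ∈ Metric.ball (0 : E) s) :
    fderiv ℝ A (t • x) x = -(Γ (t • x) x ∘L A (t • x)) := by
  have hne : ∀ t : ℝ, t ≠ 0 → t • x ∈ Metric.ball (0 : E) s →
      fderiv ℝ A (t • x) x = -(Γ (t • x) x ∘L A (t • x)) := by
    intro t ht hx
    have := hpar _ hx
    simp only [map_smul, ContinuousLinearMap.smul_comp] at this
    rw [← smul_neg] at this
    exact smul_right_injective _ ht this
  rcases eq_or_ne t 0 with rfl | ht
  · have hmem : Metric.ball (0 : E) s ∈ 𝓝 ((0 : ℝ) • x) := Metric.isOpen_ball.mem_nhds hx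
    have hray : ContinuousAt (fun t : ℝ => t • x) 0 := by fun_prop
    have hΓ : ContinuousAt (fun t : ℝ => Γ (t • x)) 0 :=
      ContinuousAt.comp (f := fun t : ℝ => t • x) (h.smooth_conn.continuousOn.continuousAt hmem)
        hray
    have hAc : ContinuousAt (fun t : ℝ => A (t • x)) 0 :=
      ContinuousAt.comp (f := fun t : ℝ => t • x) (hA.continuousOn.continuousAt hmem) hray
    have hA' : ContinuousAt (fun t : ℝ => fderiv ℝ A (t • x)) 0 := by
      refine ContinuousAt.comp (f := fun t : ℝ => t • x) ?_ hray
      exact (hA.continuousOn_fderiv_of_isOpen Metric.isOpen_ball (by simp)).continuousAt hmem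
    have h1 : ContinuousAt (fun t : ℝ => fderiv ℝ A (t • x) x) 0 :=
      hA'.clm_apply continuousAt_const
    have h2 : ContinuousAt (fun t : ℝ => -(Γ (t • x) x ∘L A (t • x))) 0 :=
      ((hΓ.clm_apply continuousAt_const).clm_comp hAc).neg
    have hz : ∀ᶠ t : ℝ in 𝓝[≠] 0,
        fderiv ℝ A (t • x) x = -(Γ (t • x) x ∘L A (t • x)) := by
      filter_upwards [(hray.eventually hmem).filter_mono nhdsWithin_le_nhds,
        self_mem_nhdsWithin] with t h1 h2
      exact hne t h2 h1
    exact tendsto_nhds_unique (h1.tendsto.mono_left nhdsWithin_le_nhds)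
      ((h2.tendsto.mono_left nhdsWithin_le_nhds).congr' (hz.mono fun _ h => h.symm))
  · exact hne t ht hx

theorem hasDerivAt_ray {F : Type*} [NormedAddCommGroup F] [NormedSpace ℝ F] {f : E → F}
    (hf : ContDiffOn ℝ ∞ f (Metric.ball 0 s)) {x : E} {t : ℝ}
    (hx : t • x ∈ Metric.ball (0 : E) s) :
    HasDerivAt (fun t : ℝ => f (t • x)) (fderiv ℝ f (t • x) x) t := by
  have h1 := ((hf.contDiffAt (Metric.isOpen_ball.mem_nhds hx)).differentiableAt
    (by simp)).hasFDerivAt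
  have h2 := h1.comp_hasDerivAt t ((hasDerivAt_id t).smul_const x)
  rwa [one_smul] at h2

theorem eq_of_hasDerivAt_zero {F : Type*} [NormedAddCommGroup F] [NormedSpace ℝ F] {f : ℝ → F}
    (hf : ∀ t ∈ Set.Icc (0 : ℝ) 1, HasDerivAt f 0 t) {t : ℝ} (ht : t ∈ Set.Icc (0 : ℝ) 1) :
    f t = f 0 := by
  have h := (convex_Icc (0 : ℝ) 1).norm_image_sub_le_of_norm_hasDerivWithin_le (C := 0)
    (fun t ht => (hf t ht).hasDerivWithinAt) (fun t _ => by simp)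
    (show (0 : ℝ) ∈ Set.Icc (0 : ℝ) 1 by norm_num) ht
  rw [zero_mul] at h
  exact sub_eq_zero.1 (norm_le_zero_iff.1 h)

/-- Parallel transport is isometric: metric compatibility makes the inner products constant along
rays, and they are Euclidean at the centre. -/
theorem frame_orthonormal (h : IsNormalMetric s κ G Γ) (hA : ContDiffOn ℝ ∞ A (Metric.ball 0 s))
    (hA0 : A 0 = 1)
    (hpar : ∀ x ∈ Metric.ball (0 : E) s, fderiv ℝ A x x = -(Γ x x ∘L A x)) {x : E}
    (hx : x ∈ Metric.ball (0 : E) s) (u v : E) : G x (A x u) (A x v) = ⟪u, v⟫_ℝ := by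
  have hd : ∀ t ∈ Set.Icc (0 : ℝ) 1,
      HasDerivAt (fun t : ℝ => G (t • x) (A (t • x) u) (A (t • x) v)) 0 t := by
    intro t ht
    have hxt := smul_mem_ball hx ht
    have h1 := hasDerivAt_ray h.smooth_metric hxt
    have h2 := hasDerivAt_ray hA hxt
    rw [h.frame_ray_deriv hA hpar t hxt] at h2
    have hu := h2.clm_apply (hasDerivAt_const t u)
    have hv := h2.clm_apply (hasDerivAt_const t v)
    refine ((h1.clm_apply hu).clm_apply hv).congr_deriv ?_
    simp only [add_apply, h.compat _ hxt, map_zero, add_zero,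
      neg_apply, ContinuousLinearMap.comp_apply, map_neg]
    ring
  have := eq_of_hasDerivAt_zero hd (show (1 : ℝ) ∈ Set.Icc (0 : ℝ) 1 by norm_num)
  simp only [one_smul, zero_smul, hA0] at this
  rw [this]
  exact h.base u v

theorem isUnit_frame [FiniteDimensional ℝ E] {x : E}
    (horth : ∀ u v, G x (A x u) (A x v) = ⟪u, v⟫_ℝ) : IsUnit (A x) := by
  have hinj : Function.Injective (A x : E →ₗ[ℝ] E) := by
    rw [injective_iff_map_eq_zero]
    intro u hu
    have hu' : A x u = 0 := hu
    have := horth u u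
    rw [hu', map_zero] at this
    exact inner_self_eq_zero.1 this.symm
  let e := LinearEquiv.toContinuousLinearEquiv (LinearEquiv.ofInjectiveEndo _ hinj)
  refine ⟨ContinuousLinearEquiv.toUnit e, ?_⟩
  ext u
  rfl

/-- Since Γ(tx)(x, x) = 0, the constant field x is itself parallel along its ray, hence fixed by the
transport. -/
theorem frame_radial (h : IsNormalMetric s κ G Γ) (hA : ContDiffOn ℝ ∞ A (Metric.ball 0 s))
    [CompleteSpace E] (hA0 : A 0 = 1)
    (hpar : ∀ x ∈ Metric.ball (0 : E) s, fderiv ℝ A x x = -(Γ x x ∘L A x))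
    (hunit : ∀ x ∈ Metric.ball (0 : E) s, IsUnit (A x)) {x : E}
    (hx : x ∈ Metric.ball (0 : E) s) {t : ℝ} (ht : t ∈ Set.Icc (0 : ℝ) 1) : A (t • x) x = x := by
  have hd : ∀ t ∈ Set.Icc (0 : ℝ) 1,
      HasDerivAt (fun t : ℝ => Ring.inverse (A (t • x)) x) 0 t := by
    intro t ht
    have hxt := smul_mem_ball hx ht
    have h2 := hasDerivAt_ray hA hxt
    rw [h.frame_ray_deriv hA hpar t hxt] at h2
    have h3 := (hasDerivAt_ringInverse_clm h2 (hunit _ hxt)).clm_apply (hasDerivAt_const t x)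
    refine h3.congr_deriv ?_
    have h4 : A (t • x) (Ring.inverse (A (t • x)) x) = x :=
      congrArg (fun L : E →L[ℝ] E => L x) (Ring.mul_inverse_cancel _ (hunit _ hxt))
    simp [h4, h.radial_smul t hxt]
  have h5 := eq_of_hasDerivAt_zero hd ht
  simp only [zero_smul, hA0, Ring.inverse_one, one_apply_eq_self] at h5
  have h4 : A (t • x) (Ring.inverse (A (t • x)) x) = x :=
    congrArg (fun L : E →L[ℝ] E => L x)
      (Ring.mul_inverse_cancel _ (hunit _ (smul_mem_ball hx ht)))
  rwa [h5] at h4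

end IsNormalMetric

end NormalCoordinates

/-! ### Structure equations and the estimates of coframe and connection form -/

section NormalCoordinates

open Topology
open scoped InnerProductSpace

universe u

variable {E : Type u} [NormedAddCommGroup E] [InnerProductSpace ℝ E]

/-- The covariant derivative of a frame. -/
noncomputable def covDerivFrame (Γ : E → E →L[ℝ] E →L[ℝ] E) (A : E → E →L[ℝ] E) (x w : E) :
    E →L[ℝ] E :=
  fderiv ℝ A x w + Γ x w ∘L A x

/-- The connection form of a frame. -/
noncomputable def connForm (Γ : E → E →L[ℝ] E →L[ℝ] E) (A : E → E →L[ℝ] E) (x w : E) :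
    E →L[ℝ] E :=
  Ring.inverse (A x) ∘L covDerivFrame Γ A x w

namespace IsNormalMetric

variable {s κ : ℝ} {G : E → E →L[ℝ] E →L[ℝ] ℝ} {Γ : E → E →L[ℝ] E →L[ℝ] E}
variable {A : E → E →L[ℝ] E}

theorem differentiableAt_of_mem {F : Type*} [NormedAddCommGroup F] [NormedSpace ℝ F] {f : E → F}
    (hf : ContDiffOn ℝ ∞ f (Metric.ball 0 s)) {x : E} (hx : x ∈ Metric.ball (0 : E) s) :
    HasFDerivAt f (fderiv ℝ f x) x :=
  ((hf.contDiffAt (Metric.isOpen_ball.mem_nhds hx)).differentiableAt (by simp)).hasFDerivAt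

/-- This is the equation of radial parallelism, differentiated in the direction w. -/
theorem frame_radial_deriv (h : IsNormalMetric s κ G Γ)
    (hA : ContDiffOn ℝ ∞ A (Metric.ball 0 s))
    (hpar : ∀ x ∈ Metric.ball (0 : E) s, fderiv ℝ A x x = -(Γ x x ∘L A x)) {x : E}
    (hx : x ∈ Metric.ball (0 : E) s) (w : E) :
    fderiv ℝ (fderiv ℝ A) x w x + fderiv ℝ A x w =
      -(fderiv ℝ Γ x w x ∘L A x + Γ x w ∘L A x + Γ x x ∘L fderiv ℝ A x w) := by
  have hdA := differentiableAt_of_mem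
    (hA.fderiv_of_isOpen Metric.isOpen_ball (m := ∞) (by simp)) hx
  have h1 := hdA.clm_apply (hasFDerivAt_id x)
  have h2 := (((differentiableAt_of_mem h.smooth_conn hx).clm_apply (hasFDerivAt_id x)).clm_comp
    (differentiableAt_of_mem hA hx)).neg
  have h3 : (fun y => fderiv ℝ A y (id y)) =ᶠ[𝓝 x] fun y => -(Γ y (id y) ∘L A y) := by
    filter_upwards [Metric.isOpen_ball.mem_nhds hx] with y hy
    exact hpar y hy
  have h4 := congrArg (fun L : E →L[ℝ] E →L[ℝ] E => L w)
    (h1.unique (h2.congr_of_eventuallyEq h3))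
  ext v
  have h5 := congrArg (fun L : E →L[ℝ] E => L v) h4
  simp only [id, ContinuousLinearMap.comp_apply, add_apply, neg_apply,
    ContinuousLinearMap.flip_apply,
    ContinuousLinearMap.compL_apply, ContinuousLinearMap.comp_id] at h5 ⊢
  rw [add_comm] at h5
  rw [h5]
  abel

/-- Second structure equation: the frame is parallel radially, so exchanging the radial derivative
with the one in direction w leaves only a curvature term. The factor t appears because tw is the
variation field of the rays t ↦ t(x + τw). -/
theorem hasDerivAt_covDerivFrame (h : IsNormalMetric s κ G Γ)
    (hA : ContDiffOn ℝ ∞ A (Metric.ball 0 s))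
    (hpar : ∀ x ∈ Metric.ball (0 : E) s, fderiv ℝ A x x = -(Γ x x ∘L A x)) {x w : E} {t : ℝ}
    (hx : t • x ∈ Metric.ball (0 : E) s) (v : E) :
    HasDerivAt (fun t : ℝ => (t • covDerivFrame Γ A (t • x) w) v)
      (-(Γ (t • x) x ((t • covDerivFrame Γ A (t • x) w) v)) +
        t • connCurvature Γ (t • x) x w (A (t • x) v)) t := by
  have hdA := hasDerivAt_ray (hA.fderiv_of_isOpen Metric.isOpen_ball (m := ∞) (by simp)) hx
  have hdΓ := hasDerivAt_ray h.smooth_conn hx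
  have hdA1 := hasDerivAt_ray hA hx
  have hpos := h.frame_ray_deriv hA hpar t hx
  have hdd := (hdA.clm_apply (hasDerivAt_const t w)).add
    ((hdΓ.clm_apply (hasDerivAt_const t w)).clm_comp hdA1)
  have hmain := ((hasDerivAt_id t).smul hdd).clm_apply (hasDerivAt_const t v)
  refine hmain.congr_deriv ?_
  have hstar := congrArg (fun L : E →L[ℝ] E => L v) (h.frame_radial_deriv hA hpar hx w)
  have hsymm : fderiv ℝ (fderiv ℝ A) (t • x) x w = fderiv ℝ (fderiv ℝ A) (t • x) w x := by
    have := (hA.contDiffAt (Metric.isOpen_ball.mem_nhds hx)).isSymmSndFDerivAt (n := ∞)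
      (by rw [minSmoothness_of_isRCLikeNormedField]; exact ENat.LEInfty.out)
    exact this x w
  have hposv := congrArg (fun L : E →L[ℝ] E => L v) hpos
  simp only [id, covDerivFrame, connCurvature, map_smul, smul_apply, add_apply, neg_apply,
    ContinuousLinearMap.comp_apply, map_zero, add_zero, one_smul, hsymm, map_add,
    Pi.add_apply, ContinuousLinearMap.smul_comp, map_neg, hpos, neg_add_rev, smul_add, smul_sub,
    smul_neg] at hstar ⊢
  have e1 : t • (fderiv ℝ (fderiv ℝ A) (t • x) w x v) =
    -(fderiv ℝ A (t • x) w v) + (-(Γ (t • x) w (A (t • x) v)) -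
      t • fderiv ℝ Γ (t • x) w x (A (t • x) v) - t • Γ (t • x) x (fderiv ℝ A (t • x) w v)) := by
    rw [← add_right_cancel_iff (a := fderiv ℝ A (t • x) w v), hstar]
    abel
  rw [e1]
  abel

/-- The estimates for the coframe and the connection form of the radially parallel frame. -/
theorem frame_estimates (h : IsNormalMetric s κ G Γ) [FiniteDimensional ℝ E]
    (hκ : 0 ≤ κ) (hκs : κ * s ^ 2 ≤ 1 / 2)
    (hA : ContDiffOn ℝ ∞ A (Metric.ball 0 s)) (hA0 : A 0 = 1)
    (hpar : ∀ x ∈ Metric.ball (0 : E) s, fderiv ℝ A x x = -(Γ x x ∘L A x)) {x : E}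
    (hx : x ∈ Metric.ball (0 : E) s) (w : E) :
    ‖Ring.inverse (A x) w - w‖ ≤ 2 * κ * s ^ 2 * ‖w‖ ∧ ‖connForm Γ A x w‖ ≤ 2 * κ * s * ‖w‖ := by
  have : CompleteSpace E := FiniteDimensional.complete ℝ E
  have horth := fun y hy => h.frame_orthonormal hA hA0 hpar (x := y) hy
  have hunit : ∀ y ∈ Metric.ball (0 : E) s, IsUnit (A y) := fun y hy => isUnit_frame (horth y hy)
  have hright : ∀ y ∈ Metric.ball (0 : E) s, ∀ v, A y (Ring.inverse (A y) v) = v :=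
    fun y hy v => congrArg (fun L : E →L[ℝ] E => L v) (Ring.mul_inverse_cancel _ (hunit y hy))
  have hleft : ∀ y ∈ Metric.ball (0 : E) s, ∀ v, Ring.inverse (A y) (A y v) = v :=
    fun y hy v => congrArg (fun L : E →L[ℝ] E => L v) (Ring.inverse_mul_cancel _ (hunit y hy))
  have hnorm : ∀ y ∈ Metric.ball (0 : E) s, ∀ v, √(G y v v) = ‖Ring.inverse (A y) v‖ := by
    intro y hy v
    have := horth y hy (Ring.inverse (A y) v) (Ring.inverse (A y) v)
    rw [hright y hy, real_inner_self_eq_norm_sq] at this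
    rw [this, Real.sqrt_sq (norm_nonneg _)]
  have hrad := fun t ht => h.frame_radial hA hA0 hpar hunit hx (t := t) ht
  have hxs : ‖x‖ ≤ s := (mem_ball_zero_iff.1 hx).le
  have hs0 : 0 ≤ s := (norm_nonneg x).trans hxs
  have hxx : κ * ‖x‖ * ‖x‖ ≤ κ * s ^ 2 := by
    rw [mul_assoc, ← sq]
    gcongr
  let y : ℝ → E := fun t => t • Ring.inverse (A (t • x)) w
  let z : ℝ → E →L[ℝ] E := fun t => Ring.inverse (A (t • x)) ∘L (t • covDerivFrame Γ A (t • x) w)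
  let z' : ℝ → E →L[ℝ] E := fun t => deriv z t
  have hframe : ∀ t ∈ Set.Icc (0 : ℝ) 1, HasDerivAt (fun t : ℝ => Ring.inverse (A (t • x)))
      (Ring.inverse (A (t • x)) ∘L Γ (t • x) x) t := by
    intro t ht
    have hxt := smul_mem_ball hx ht
    have h2 := hasDerivAt_ray hA hxt
    rw [h.frame_ray_deriv hA hpar t hxt] at h2
    refine (hasDerivAt_ringInverse_clm h2 (hunit _ hxt)).congr_deriv ?_
    ext v
    simp [hright _ hxt]
  have hzdiff : ∀ t ∈ Set.Icc (0 : ℝ) 1, HasDerivAt z (z' t) t := by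
    intro t ht
    have hxt := smul_mem_ball hx ht
    have hdA := hasDerivAt_ray (hA.fderiv_of_isOpen Metric.isOpen_ball (m := ∞) (by simp)) hxt
    have hdd := (hdA.clm_apply (hasDerivAt_const t w)).add
      (((hasDerivAt_ray h.smooth_conn hxt).clm_apply (hasDerivAt_const t w)).clm_comp
        (hasDerivAt_ray hA hxt))
    have := (hframe t ht).clm_comp ((hasDerivAt_id t).smul hdd)
    exact this.differentiableAt.hasDerivAt
  have hzv : ∀ t ∈ Set.Icc (0 : ℝ) 1, ∀ v,
      z' t v = t • Ring.inverse (A (t • x)) (connCurvature Γ (t • x) x w (A (t • x) v)) := by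
    intro t ht v
    have hxt := smul_mem_ball hx ht
    have h1 := (hframe t ht).clm_apply (h.hasDerivAt_covDerivFrame hA hpar (w := w) hxt v)
    have h2 := (hzdiff t ht).clm_apply (hasDerivAt_const t v)
    have h3 := h2.unique h1
    simp only [map_zero, add_zero, ContinuousLinearMap.comp_apply, map_add, map_neg] at h3
    rw [h3, map_smul]
    abel
  have hest := structure_equation_estimate (y := y) (z := z) (z' := z')
    (ζ := ContinuousLinearMap.apply ℝ E x) (w := w) (k := κ * ‖x‖) (l := ‖x‖)
    (by positivity) (norm_nonneg _) (hxx.trans hκs) (by simp [y]) (by simp [z])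
    (ContinuousLinearMap.opNorm_le_bound _ (norm_nonneg _) fun L => by
      rw [mul_comm]; exact L.le_opNorm x) ?_ hzdiff ?_
  · obtain ⟨e1, e2⟩ := hest
    constructor
    · have e1' : ‖Ring.inverse (A x) w - w‖ ≤ 2 * (κ * ‖x‖ * ‖x‖) * ‖w‖ := by
        simpa [y] using e1
      refine e1'.trans ?_
      calc _ ≤ 2 * (κ * s ^ 2) * ‖w‖ := by gcongr
        _ = _ := by ring
    · have e2' : ‖connForm Γ A x w‖ ≤ 2 * (κ * ‖x‖) * ‖w‖ := by
        simpa [z, connForm] using e2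
      refine e2'.trans ?_
      calc _ ≤ 2 * (κ * s) * ‖w‖ := by gcongr
        _ = _ := by ring
  · intro t ht
    have hxt := smul_mem_ball hx ht
    refine ((hasDerivAt_id t).smul ((hframe t ht).clm_apply (hasDerivAt_const t w))).congr_deriv ?_
    -- First structure equation: differentiating A(y) y = y in the direction w gives t (∂_w A) x = w
    -- - A w at the point tx.
    have hev : ∀ᶠ y in 𝓝 (t • x), A y (id y) = id y := by
      filter_upwards [Metric.isOpen_ball.mem_nhds hxt] with y hy
      have := h.frame_radial hA hA0 hpar hunit hy (t := 1) (by norm_num)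
      rwa [one_smul] at this
    have hd := ((differentiableAt_of_mem hA hxt).clm_apply (hasFDerivAt_id (t • x)))
    have hd' : A (t • x) w + fderiv ℝ A (t • x) w (t • x) = w :=
      congrArg (fun L : E →L[ℝ] E => L w)
        (hd.unique ((hasFDerivAt_id (t • x)).congr_of_eventuallyEq hev))
    rw [map_smul] at hd'
    have hd2 : t • (fderiv ℝ A (t • x) w x) = w - A (t • x) w := by
      rw [eq_sub_iff_add_eq, add_comm]; exact hd'
    simp only [id, z, map_zero, add_zero, one_smul, ContinuousLinearMap.comp_apply,
      ContinuousLinearMap.apply_apply, covDerivFrame, smul_apply, add_apply, hrad t ht,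
      smul_add, hd2, map_add, map_sub, hleft _ hxt, h.symm _ hxt w x, map_smul]
    abel
  · intro t ht
    have hxt := smul_mem_ball hx ht
    refine ContinuousLinearMap.opNorm_le_bound _ (by positivity) fun v => ?_
    rw [hzv t ht v, norm_smul, Real.norm_of_nonneg ht.1]
    -- Testing the curvature vector against itself turns the bound on the 4-tensor into a bound on
    -- its norm. The radial argument contributes exactly ‖x‖, as the coframe fixes x.
    have hc := h.curvature _ hxt x w (A (t • x) v) (connCurvature Γ (t • x) x w (A (t • x) v))
    set C := connCurvature Γ (t • x) x w (A (t • x) v)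
    have hGC : G (t • x) C C = ‖Ring.inverse (A (t • x)) C‖ ^ 2 := by
      rw [← real_inner_self_eq_norm_sq, ← horth _ hxt, hright _ hxt]
    have hθx : Ring.inverse (A (t • x)) x = x := by
      have := hleft _ hxt x
      rwa [hrad t ht] at this
    rw [hnorm _ hxt, hnorm _ hxt, hnorm _ hxt, hnorm _ hxt, hGC, hleft _ hxt, hθx,
      abs_of_nonneg (by positivity)] at hc
    have hCle : ‖Ring.inverse (A (t • x)) C‖ ≤ κ * ‖x‖ * ‖Ring.inverse (A (t • x)) w‖ * ‖v‖ := by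
      rcases eq_or_lt_of_le (norm_nonneg (Ring.inverse (A (t • x)) C)) with h0 | h0
      · rw [← h0]; positivity
      · rw [sq] at hc
        exact le_of_mul_le_mul_right hc h0
    calc t * ‖Ring.inverse (A (t • x)) C‖
        ≤ t * (κ * ‖x‖ * ‖Ring.inverse (A (t • x)) w‖ * ‖v‖) := by
          gcongr
          exact ht.1
      _ = κ * ‖x‖ * ‖y t‖ * ‖v‖ := by
          simp only [y, norm_smul, Real.norm_of_nonneg ht.1]; ring

end IsNormalMetric

end NormalCoordinates

/-! ### Almost constant velocity of geodesics -/

section NormalCoordinates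

open Topology
open scoped InnerProductSpace

universe u

variable {E : Type u} [NormedAddCommGroup E] [InnerProductSpace ℝ E]

/-- A curve in a ball whose velocity is almost equal to a vector `u` of constant length that
varies slowly has almost constant velocity. -/
theorem velocity_almost_constant {s k η U a b : ℝ} {c v u u' : ℝ → E} (hs : 0 < s)
    (hk : 0 ≤ k) (hη : η = 2 * k * s ^ 2) (hη1 : η ≤ 1 / 24)
    (hc : ∀ t ∈ Set.Ioo a b, HasDerivAt c (v t) t)
    (hcs : ∀ t ∈ Set.Ioo a b, ‖c t‖ < s)
    (hu : ∀ t ∈ Set.Ioo a b, HasDerivAt u (u' t) t)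
    (hu' : ∀ t ∈ Set.Ioo a b, ‖u' t‖ ≤ 2 * k * s * ‖v t‖ * ‖u t‖)
    (huU : ∀ t ∈ Set.Ioo a b, ‖u t‖ = U)
    (huv : ∀ t ∈ Set.Ioo a b, ‖u t - v t‖ ≤ η * ‖v t‖)
    {t₀ t : ℝ} (ht₀ : t₀ ∈ Set.Ioo a b) (ht : t ∈ Set.Ioo a b) :
    ‖v t - v t₀‖ ≤ 25 * η * ‖v t₀‖ := by
  have hη0 : 0 ≤ η := by rw [hη]; positivity
  have hU0 : 0 ≤ U := by rw [← huU t₀ ht₀]; exact norm_nonneg _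
  have hvU : ∀ t ∈ Set.Ioo a b, ‖v t‖ ≤ 2 * U := by
    intro t ht
    have h1 := huv t ht
    have h2 : ‖v t‖ ≤ ‖u t - v t‖ + ‖u t‖ := by
      have := norm_sub_le (u t) (u t - v t)
      rw [sub_sub_cancel] at this
      linarith
    rw [huU t ht] at h2
    nlinarith [norm_nonneg (v t)]
  have hUv : U ≤ 2 * ‖v t₀‖ := by
    have h1 := huv t₀ ht₀
    have h2 : ‖u t₀‖ ≤ ‖u t₀ - v t₀‖ + ‖v t₀‖ := by
      simpa using norm_add_le (u t₀ - v t₀) (v t₀)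
    rw [huU t₀ ht₀] at h2
    nlinarith [norm_nonneg (v t₀)]
  rcases eq_or_lt_of_le hU0 with hU | hU
  · have hz : ∀ t ∈ Set.Ioo a b, v t = 0 := fun t ht => by
      have := hvU t ht
      rw [← hU, mul_zero] at this
      exact norm_le_zero_iff.1 this
    rw [hz t ht, hz t₀ ht₀]
    simp
  -- A time after which a motion of speed at least U / 2 has covered 5s / 2, more than the diameter
  -- 2s of the ball.
  set L := 5 * s / U with hL
  have hLpos : 0 < L := by positivity
  have hLU : L * U = 5 * s := by rw [hL]; field_simp
  have hsub : ∀ τ ∈ Set.Ioo a b, Set.uIcc t₀ τ ⊆ Set.Ioo a b := fun τ hτ =>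
    Set.ordConnected_Ioo.uIcc_subset ht₀ hτ
  have hu_near : ∀ τ ∈ Set.Ioo a b, |τ - t₀| ≤ L → ‖u τ - u t₀‖ ≤ 10 * η * U := by
    intro τ hτ hle
    have h := (convex_uIcc t₀ τ).norm_image_sub_le_of_norm_hasDerivWithin_le
      (C := 4 * k * s * U ^ 2)
      (fun x hx => (hu x (hsub τ hτ hx)).hasDerivWithinAt)
      (fun x hx => by
        have hx' := hsub τ hτ hx
        refine (hu' x hx').trans ?_
        rw [huU x hx']
        calc 2 * k * s * ‖v x‖ * U ≤ 2 * k * s * (2 * U) * U := by gcongr; exact hvU x hx'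
          _ = _ := by ring)
      Set.left_mem_uIcc Set.right_mem_uIcc
    refine h.trans ?_
    rw [Real.norm_eq_abs]
    calc 4 * k * s * U ^ 2 * |τ - t₀| ≤ 4 * k * s * U ^ 2 * L := by gcongr
      _ = 4 * k * s * U * (L * U) := by ring
      _ = 10 * η * U := by rw [hLU, hη]; ring
  have hv_near : ∀ τ ∈ Set.Ioo a b, |τ - t₀| ≤ L → ‖v τ - u t₀‖ ≤ 12 * η * U := by
    intro τ hτ hle
    have h1 := hu_near τ hτ hle
    have h2 := huv τ hτ
    have h3 := hvU τ hτ
    have h4 : ‖v τ - u t₀‖ ≤ ‖u τ - u t₀‖ + ‖u τ - v τ‖ := by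
      have := norm_sub_le (u τ - u t₀) (u τ - v τ)
      rwa [show u τ - u t₀ - (u τ - v τ) = v τ - u t₀ by abel] at this
    nlinarith
  -- Otherwise look at a time t₁ at distance exactly L. Up to then v stays within 12ηU ≤ U / 2 of u
  -- t₀, so c has moved by at least LU / 2 = 5s / 2, which is impossible inside the ball.
  have hclose : |t - t₀| ≤ L := by
    by_contra hlt
    rw [not_le] at hlt
    obtain ⟨t₁, ht₁, hd⟩ : ∃ t₁ ∈ Set.uIcc t₀ t, |t₁ - t₀| = L := by
      rcases le_total t₀ t with h0 | h0
      · rw [abs_of_nonneg (by linarith)] at hlt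
        exact ⟨t₀ + L, by rw [Set.uIcc_of_le h0]; constructor <;> linarith,
          by rw [add_sub_cancel_left, abs_of_pos hLpos]⟩
      · rw [abs_of_nonpos (by linarith)] at hlt
        refine ⟨t₀ - L, by rw [Set.uIcc_of_ge h0]; constructor <;> linarith, ?_⟩
        rw [show t₀ - L - t₀ = -L by ring, abs_neg, abs_of_pos hLpos]
    have ht₁' := hsub t ht ht₁
    have h := (convex_uIcc t₀ t₁).norm_image_sub_le_of_norm_hasDerivWithin_le
      (f := fun τ => c τ - τ • u t₀) (f' := fun τ => v τ - u t₀) (C := U / 2)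
      (fun x hx => by
        refine (((hc x (hsub t₁ ht₁' hx)).sub
          ((hasDerivAt_id x).smul_const (u t₀))).congr_deriv ?_).hasDerivWithinAt
        simp)
      (fun x hx => by
        have hx' := hsub t₁ ht₁' hx
        have h1 := hv_near x hx' (by
          rw [← hd]; exact Set.abs_sub_left_of_mem_uIcc hx)
        nlinarith)
      Set.left_mem_uIcc Set.right_mem_uIcc
    rw [Real.norm_eq_abs, hd] at h
    have h2 : c t₁ - t₁ • u t₀ - (c t₀ - t₀ • u t₀) = (c t₁ - c t₀) - (t₁ - t₀) • u t₀ := by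
      rw [sub_smul]; abel
    simp only [h2] at h
    have h3 : ‖(t₁ - t₀) • u t₀‖ = L * U := by
      rw [norm_smul, Real.norm_eq_abs, hd, huU t₀ ht₀]
    have h4 : ‖(t₁ - t₀) • u t₀‖ ≤ ‖c t₁ - c t₀‖ + ‖(c t₁ - c t₀) - (t₁ - t₀) • u t₀‖ := by
      have := norm_sub_le (c t₁ - c t₀) ((c t₁ - c t₀) - (t₁ - t₀) • u t₀)
      rwa [sub_sub_cancel] at this
    have h5 := norm_sub_le (c t₁) (c t₀)
    have h6 := hcs t₁ ht₁'
    have h7 := hcs t₀ ht₀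
    nlinarith
  -- With U ≤ 2‖v t₀‖ the two errors 12ηU and η‖v t₀‖ add up to 25η‖v t₀‖.
  have h1 := hv_near t ht hclose
  have h2 := huv t₀ ht₀
  have h3 : ‖v t - v t₀‖ ≤ ‖v t - u t₀‖ + ‖u t₀ - v t₀‖ := by
    simpa using norm_add_le (v t - u t₀) (u t₀ - v t₀)
  nlinarith

/-- A metric in normal coordinates with small curvature is close to the Euclidean metric, and the
velocity vectors of its geodesics are almost constant. -/
theorem IsNormalMetric.exists_coframe {s κ : ℝ} {G : E → E →L[ℝ] E →L[ℝ] ℝ}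
    {Γ : E → E →L[ℝ] E →L[ℝ] E} (h : IsNormalMetric s κ G Γ) [FiniteDimensional ℝ E]
    (hs : 0 < s) (hκ : 0 ≤ κ) (hκs : 2 * κ * s ^ 2 ≤ 1 / 24) :
    (∀ x ∈ Metric.ball (0 : E) s, ∃ θ : E →L[ℝ] E, (∀ u v, G x u v = ⟪θ u, θ v⟫_ℝ) ∧
      ∀ w, ‖θ w - w‖ ≤ 2 * κ * s ^ 2 * ‖w‖) ∧
    ∀ (c v : ℝ → E) (a b : ℝ), (∀ t ∈ Set.Ioo a b, c t ∈ Metric.ball (0 : E) s) →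
      (∀ t ∈ Set.Ioo a b, HasDerivAt c (v t) t) →
      (∀ t ∈ Set.Ioo a b, HasDerivAt v (-(Γ (c t) (v t) (v t))) t) →
      ∀ t₀ ∈ Set.Ioo a b, ∀ t ∈ Set.Ioo a b,
        ‖v t - v t₀‖ ≤ 25 * (2 * κ * s ^ 2) * ‖v t₀‖ := by
  have : CompleteSpace E := FiniteDimensional.complete ℝ E
  obtain ⟨A, hA, hA0, hpar⟩ := exists_radially_parallel_frame hs h.smooth_conn
  have hκs' : κ * s ^ 2 ≤ 1 / 2 := by linarith
  have horth := fun y hy => h.frame_orthonormal hA hA0 hpar (x := y) hy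
  have hunit : ∀ y ∈ Metric.ball (0 : E) s, IsUnit (A y) := fun y hy => isUnit_frame (horth y hy)
  have hright : ∀ y ∈ Metric.ball (0 : E) s, ∀ v, A y (Ring.inverse (A y) v) = v :=
    fun y hy v => congrArg (fun L : E →L[ℝ] E => L v) (Ring.mul_inverse_cancel _ (hunit y hy))
  have hest := fun x hx w => h.frame_estimates hκ hκs' hA hA0 hpar (x := x) hx w
  have hG : ∀ x ∈ Metric.ball (0 : E) s, ∀ u v,
      G x u v = ⟪Ring.inverse (A x) u, Ring.inverse (A x) v⟫_ℝ := by
    intro x hx u v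
    rw [← horth x hx, hright x hx, hright x hx]
  refine ⟨fun x hx => ⟨Ring.inverse (A x), hG x hx, fun w => (hest x hx w).1⟩, ?_⟩
  intro c v a b hcs hc hv t₀ ht₀ t ht
  have hcd : ∀ {F : Type u} [NormedAddCommGroup F] [NormedSpace ℝ F] {f : E → F},
      ContDiffOn ℝ ∞ f (Metric.ball 0 s) → ∀ t ∈ Set.Ioo a b,
      HasDerivAt (fun t => f (c t)) (fderiv ℝ f (c t) (v t)) t := by
    intro F _ _ f hf t ht
    exact (differentiableAt_of_mem hf (hcs t ht)).comp_hasDerivAt t (hc t ht)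
  have hspeed : ∀ t ∈ Set.Ioo a b, HasDerivAt (fun t => G (c t) (v t) (v t)) 0 t := by
    intro t ht
    refine (((hcd h.smooth_metric t ht).clm_apply (hv t ht)).clm_apply (hv t ht)).congr_deriv ?_
    rw [add_apply, h.compat _ (hcs t ht), map_neg, map_neg, neg_apply]
    ring
  have hconst : ∀ τ ∈ Set.Ioo a b, G (c τ) (v τ) (v τ) = G (c t₀) (v t₀) (v t₀) := by
    intro τ hτ
    have h1 := (convex_Ioo a b).norm_image_sub_le_of_norm_hasDerivWithin_le (C := 0)
      (fun t ht => (hspeed t ht).hasDerivWithinAt) (fun t _ => by simp) ht₀ hτ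
    rw [zero_mul] at h1
    exact sub_eq_zero.1 (norm_le_zero_iff.1 h1)
  refine velocity_almost_constant (k := κ) (U := √(G (c t₀) (v t₀) (v t₀)))
    (u := fun t => Ring.inverse (A (c t)) (v t))
    (u' := fun t => -(connForm Γ A (c t) (v t) (Ring.inverse (A (c t)) (v t))))
    hs hκ rfl hκs hc (fun t ht => mem_ball_zero_iff.1 (hcs t ht)) ?_ ?_ ?_ ?_ ht₀ ht
  · intro t ht
    have hct := hcs t ht
    refine ((hasDerivAt_ringInverse_clm (hcd hA t ht) (hunit _ hct)).clm_apply
      (hv t ht)).congr_deriv ?_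
    simp only [neg_apply, ContinuousLinearMap.comp_apply, connForm, covDerivFrame, add_apply,
      hright _ hct, map_add, map_neg, neg_add]
  · intro t ht
    rw [norm_neg]
    refine (ContinuousLinearMap.le_opNorm _ _).trans ?_
    exact mul_le_mul_of_nonneg_right (hest _ (hcs t ht) _).2 (norm_nonneg _)
  · intro t ht
    rw [← hconst t ht, hG _ (hcs t ht), real_inner_self_eq_norm_sq, Real.sqrt_sq (norm_nonneg _)]
  · intro t ht
    exact (hest _ (hcs t ht) _).1

end NormalCoordinates

/-! ### The Levi-Civita connection of a matrix-valued metric -/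

section MatrixMetrics

open Topology
open scoped InnerProductSpace

variable {d : ℕ}

/-- The `i`-th coordinate function. -/
noncomputable abbrev eucProj (i : Fin d) : Euc d →L[ℝ] ℝ := EuclideanSpace.proj i

@[simp] theorem eucProj_apply (i : Fin d) (u : Euc d) : eucProj i u = u i := rfl

/-- The `i`-th standard basis vector. -/
noncomputable abbrev eucBasis (i : Fin d) : Euc d := EuclideanSpace.single i 1

/-- Reduces identities between multilinear maps to basis vectors, one argument at a time. -/
theorem euc_induction {P : Euc d → Prop} (hadd : ∀ x y, P x → P y → P (x + y))
    (hsmul : ∀ (c : ℝ) x, P x → P (c • x)) (h0 : P 0) (hbasis : ∀ i, P (eucBasis i)) (x : Euc d) :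
    P x := by
  rw [← (EuclideanSpace.basisFun (Fin d) ℝ).sum_repr x]
  refine Finset.sum_induction _ P hadd h0 fun i _ => hsmul _ _ ?_
  rw [EuclideanSpace.basisFun_apply]
  exact hbasis i

/-- A smooth Riemannian metric on a subset of Euclidean space. -/
structure IsMetricOn (M : Euc d → Matrix (Fin d) (Fin d) ℝ) (Z : Set (Euc d)) : Prop where
  smooth : ∀ i j, ContDiffOn ℝ ∞ (fun z => M z i j) Z
  posDef : ∀ z ∈ Z, (M z).PosDef

/-- The metric as a bilinear form. -/
noncomputable def metricForm (M : Euc d → Matrix (Fin d) (Fin d) ℝ) (z : Euc d) :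
    Euc d →L[ℝ] Euc d →L[ℝ] ℝ :=
  ∑ i, ∑ j, M z i j • (eucProj i).smulRight (eucProj j)

/-- The Christoffel symbols as a bilinear map. -/
noncomputable def christoffelForm (M : Euc d → Matrix (Fin d) (Fin d) ℝ) (z : Euc d) :
    Euc d →L[ℝ] Euc d →L[ℝ] Euc d :=
  ∑ k, ∑ i, ∑ j, christoffel M k i j z •
    (eucProj i).smulRight ((eucProj j).smulRight (eucBasis k))

variable {M : Euc d → Matrix (Fin d) (Fin d) ℝ} {Z : Set (Euc d)}

theorem metricForm_apply (z u v : Euc d) : metricForm M z u v = metricInner M z u v := by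
  simp only [metricForm, metricInner, sum_apply, smul_apply,
    ContinuousLinearMap.smulRight_apply, eucProj_apply, smul_eq_mul]
  exact Finset.sum_congr rfl fun i _ => Finset.sum_congr rfl fun j _ => by ring

theorem metricForm_basis (z : Euc d) (i j : Fin d) :
    metricForm M z (eucBasis i) (eucBasis j) = M z i j := by
  simp [metricForm]

theorem christoffelForm_apply (z u v : Euc d) (k : Fin d) :
    christoffelForm M z u v k = ∑ i, ∑ j, christoffel M k i j z * u i * v j := by
  simp only [christoffelForm, sum_apply, smul_apply,
    ContinuousLinearMap.smulRight_apply, eucProj_apply, smul_eq_mul, WithLp.ofLp_sum,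
    Finset.sum_apply, PiLp.smul_apply, PiLp.single_apply]
  rw [Finset.sum_eq_single k]
  · exact Finset.sum_congr rfl fun i _ => Finset.sum_congr rfl fun j _ => by simp; ring
  · intro l _ hl
    simp [hl.symm]
  · simp

theorem christoffelForm_basis (z : Euc d) (i j k : Fin d) :
    christoffelForm M z (eucBasis i) (eucBasis j) k = christoffel M k i j z := by
  simp [christoffelForm_apply]

theorem smul_const_contDiffOn {X F : Type*} [NormedAddCommGroup X] [NormedSpace ℝ X]
    [NormedAddCommGroup F] [NormedSpace ℝ F] {S : Set X} {f : X → ℝ} {n : WithTop ℕ∞}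
    (hf : ContDiffOn ℝ n f S) (v : F) : ContDiffOn ℝ n (fun x => f x • v) S :=
  hf.smul contDiffOn_const

theorem contDiffOn_det {X : Type*} [NormedAddCommGroup X] [NormedSpace ℝ X] {S : Set X}
    {A : X → Matrix (Fin d) (Fin d) ℝ} (hA : ∀ i j, ContDiffOn ℝ ∞ (fun z => A z i j) S) :
    ContDiffOn ℝ ∞ (fun z => (A z).det) S := by
  simp only [Matrix.det_apply']
  exact ContDiffOn.sum fun σ _ => contDiffOn_const.mul (contDiffOn_prod fun i _ => hA _ _)

namespace IsMetricOn

theorem symm_entries (h : IsMetricOn M Z) {z : Euc d} (hz : z ∈ Z) (i j : Fin d) :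
    M z i j = M z j i := by
  have := (h.posDef z hz).1.apply i j
  simpa using this.symm

theorem contDiffOn_inv (h : IsMetricOn M Z) (i j : Fin d) :
    ContDiffOn ℝ ∞ (fun z => (M z)⁻¹ i j) Z := by
  have h1 : ∀ z, (M z)⁻¹ i j = ((M z).det)⁻¹ * (M z).adjugate i j := fun z => by
    rw [Matrix.inv_def, Matrix.smul_apply, Ring.inverse_eq_inv', smul_eq_mul]
  simp only [h1]
  refine ((contDiffOn_det h.smooth).inv fun z hz => (h.posDef z hz).det_pos.ne').mul ?_
  simp only [Matrix.adjugate_apply]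
  refine contDiffOn_det fun a b => ?_
  simp only [Matrix.updateRow_apply]
  by_cases hab : a = j
  · simp only [hab, if_true]; exact contDiffOn_const
  · simp only [hab, if_false]; exact h.smooth a b

theorem contDiffOn_metricForm (h : IsMetricOn M Z) : ContDiffOn ℝ ∞ (metricForm M) Z := by
  unfold metricForm
  exact ContDiffOn.sum fun i _ => ContDiffOn.sum fun j _ => 
    smul_const_contDiffOn (h.smooth i j) _

theorem contDiffOn_pderivAt (hZ : IsOpen Z) {f : Euc d → ℝ} (hf : ContDiffOn ℝ ∞ f Z)
    (k : Fin d) : ContDiffOn ℝ ∞ (pderivAt k f) Z :=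
  (hf.fderiv_of_isOpen hZ (m := ∞) (by simp)).clm_apply contDiffOn_const

theorem contDiffOn_christoffel (h : IsMetricOn M Z) (hZ : IsOpen Z) (k i j : Fin d) :
    ContDiffOn ℝ ∞ (christoffel M k i j) Z := by
  unfold christoffel
  refine contDiffOn_const.mul (ContDiffOn.sum fun l _ => (h.contDiffOn_inv k l).mul ?_)
  exact ((contDiffOn_pderivAt hZ (h.smooth _ _) _).add
    (contDiffOn_pderivAt hZ (h.smooth _ _) _)).sub (contDiffOn_pderivAt hZ (h.smooth _ _) _)

theorem contDiffOn_christoffelForm (h : IsMetricOn M Z) (hZ : IsOpen Z) :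
    ContDiffOn ℝ ∞ (christoffelForm M) Z := by
  unfold christoffelForm
  exact ContDiffOn.sum fun k _ => ContDiffOn.sum fun i _ => ContDiffOn.sum fun j _ =>
    smul_const_contDiffOn (h.contDiffOn_christoffel hZ k i j) _

theorem metricForm_comm (h : IsMetricOn M Z) {z : Euc d} (hz : z ∈ Z) (u v : Euc d) :
    metricForm M z u v = metricForm M z v u := by
  rw [metricForm_apply, metricForm_apply, metricInner, metricInner, Finset.sum_comm]
  refine Finset.sum_congr rfl fun i _ => Finset.sum_congr rfl fun j _ => ?_
  rw [h.symm_entries hz]; ring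

theorem metricForm_pos (h : IsMetricOn M Z) {z : Euc d} (hz : z ∈ Z) {u : Euc d} (hu : u ≠ 0) :
    0 < metricForm M z u u := by
  have h1 := (h.posDef z hz).dotProduct_mulVec_pos (x := u.ofLp) (by
    intro h0; apply hu; ext i; exact congrFun h0 i)
  rw [metricForm_apply, metricInner]
  simpa [dotProduct, Matrix.mulVec, Finset.mul_sum, mul_assoc] using h1

theorem christoffelForm_symm (h : IsMetricOn M Z) (hZ : IsOpen Z) {z : Euc d} (hz : z ∈ Z)
    (u v : Euc d) : christoffelForm M z u v = christoffelForm M z v u := by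
  ext k
  rw [christoffelForm_apply, christoffelForm_apply, Finset.sum_comm]
  refine Finset.sum_congr rfl fun i _ => Finset.sum_congr rfl fun j _ => ?_
  have : christoffel M k j i z = christoffel M k i j z := by
    unfold christoffel
    congr 1
    refine Finset.sum_congr rfl fun l _ => ?_
    have : pderivAt l (fun w => M w j i) z = pderivAt l (fun w => M w i j) z := by
      unfold pderivAt
      rw [Filter.EventuallyEq.fderiv_eq]
      filter_upwards [hZ.mem_nhds hz] with w hw
      exact h.symm_entries hw j i
    rw [this]; ring
  rw [this]; ring

theorem fderiv_metricForm_basis (h : IsMetricOn M Z) (hZ : IsOpen Z) {z : Euc d} (hz : z ∈ Z)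
    (i j l : Fin d) : fderiv ℝ (metricForm M) z (eucBasis i) (eucBasis j) (eucBasis l) =
      pderivAt i (fun w => M w j l) z := by
  have h1 := ((h.contDiffOn_metricForm.contDiffAt (hZ.mem_nhds hz)).differentiableAt
    (by simp)).hasFDerivAt
  have h2 := (h1.clm_apply (hasFDerivAt_const (eucBasis j) z)).clm_apply
    (hasFDerivAt_const (eucBasis l) z)
  simp only [metricForm_basis] at h2
  rw [pderivAt, h2.fderiv]
  simp

/-- Contraction with M cancels M⁻¹ and leaves the Christoffel symbols of the first kind. -/
theorem metricForm_christoffelForm_basis (h : IsMetricOn M Z) {z : Euc d}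
    (hz : z ∈ Z) (i j l : Fin d) :
    metricForm M z (christoffelForm M z (eucBasis i) (eucBasis j)) (eucBasis l) =
      (1 / 2) * (pderivAt i (fun w => M w j l) z + pderivAt j (fun w => M w i l) z
        - pderivAt l (fun w => M w i j) z) := by
  have h1 : metricForm M z (christoffelForm M z (eucBasis i) (eucBasis j)) (eucBasis l) =
      ∑ k, christoffel M k i j z * M z k l := by
    rw [metricForm_apply, metricInner]
    simp [christoffelForm_basis]
  rw [h1]
  simp only [christoffel, mul_assoc, ← Finset.mul_sum]
  congr 1
  simp only [Finset.sum_mul]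
  rw [Finset.sum_comm]
  have h2 : ∀ m, ∑ k, (M z)⁻¹ k m * M z k l = if l = m then 1 else 0 := by
    intro m
    have hdet : IsUnit (M z).det := (h.posDef z hz).det_pos.ne'.isUnit
    have := congrFun (congrFun (Matrix.mul_nonsing_inv (M z) hdet) l) m
    rw [Matrix.mul_apply, Matrix.one_apply] at this
    rw [← this]
    exact Finset.sum_congr rfl fun k _ => by rw [h.symm_entries hz k l, mul_comm]
  have h3 : ∀ m, ∑ k, (M z)⁻¹ k m * (pderivAt i (fun w => M w j m) z +
      pderivAt j (fun w => M w i m) z - pderivAt m (fun w => M w i j) z) * M z k l =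
      (if l = m then 1 else 0) * (pderivAt i (fun w => M w j m) z +
      pderivAt j (fun w => M w i m) z - pderivAt m (fun w => M w i j) z) := by
    intro m
    rw [← h2 m, Finset.sum_mul]
    exact Finset.sum_congr rfl fun k _ => by ring
  simp only [h3]
  simp

/-- The Levi-Civita connection is compatible with the metric. -/
theorem fderiv_metricForm (h : IsMetricOn M Z) (hZ : IsOpen Z) {z : Euc d} (hz : z ∈ Z)
    (w u v : Euc d) : fderiv ℝ (metricForm M) z w u v =
      metricForm M z (christoffelForm M z w u) v + metricForm M z u (christoffelForm M z w v) := by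
  revert u v
  refine euc_induction (P := fun w => ∀ u v, fderiv ℝ (metricForm M) z w u v =
      metricForm M z (christoffelForm M z w u) v + metricForm M z u (christoffelForm M z w v))
    (fun x y hx hy u v => by simp only [map_add, add_apply, hx, hy]; ring)
    (fun c x hx u v => by simp only [map_smul, smul_apply, hx, smul_add])
    (fun u v => by simp) (fun i u v => ?_) w
  revert v
  refine euc_induction (P := fun u => ∀ v, fderiv ℝ (metricForm M) z (eucBasis i) u v =
      metricForm M z (christoffelForm M z (eucBasis i) u) v +
        metricForm M z u (christoffelForm M z (eucBasis i) v))
    (fun x y hx hy v => by simp only [map_add, add_apply, hx, hy]; ring)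
    (fun c x hx v => by simp only [map_smul, smul_apply, hx, smul_add])
    (fun v => by simp) (fun j v => ?_) u
  refine euc_induction (P := fun v => fderiv ℝ (metricForm M) z (eucBasis i) (eucBasis j) v =
      metricForm M z (christoffelForm M z (eucBasis i) (eucBasis j)) v +
        metricForm M z (eucBasis j) (christoffelForm M z (eucBasis i) v))
    (fun x y hx hy => by simp only [map_add, hx, hy]; ring)
    (fun c x hx => by simp only [map_smul, hx, smul_add])
    (by simp) (fun l => ?_) v
  rw [h.metricForm_comm hz (eucBasis j), h.metricForm_christoffelForm_basis hz,
    h.metricForm_christoffelForm_basis hz, h.fderiv_metricForm_basis hZ hz]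
  have hsy : pderivAt i (fun w => M w l j) z = pderivAt i (fun w => M w j l) z := by
    unfold pderivAt
    rw [Filter.EventuallyEq.fderiv_eq]
    filter_upwards [hZ.mem_nhds hz] with w hw
    exact h.symm_entries hw l j
  rw [hsy]
  ring

/-- The Levi-Civita connection is the only symmetric connection compatible with the metric. -/
theorem eq_christoffelForm (h : IsMetricOn M Z) (hZ : IsOpen Z) {z : Euc d} (hz : z ∈ Z)
    {B : Euc d →L[ℝ] Euc d →L[ℝ] Euc d} (hB : ∀ u v, B u v = B v u)
    (hc : ∀ w u v, fderiv ℝ (metricForm M) z w u v =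
      metricForm M z (B w u) v + metricForm M z u (B w v)) (u v : Euc d) :
    B u v = christoffelForm M z u v := by
  -- Lowered with the metric, D is a trilinear form symmetric in its first two arguments and skew in
  -- its last two; permuting the arguments cyclically shows that it vanishes.
  set D := B - christoffelForm M z with hD
  have hDs : ∀ u v, D u v = D v u := fun u v => by
    simp [hD, hB u v, h.christoffelForm_symm hZ hz u v]
  have ha : ∀ w u v, metricForm M z (D w u) v = -metricForm M z (D w v) u := by
    intro w u v
    have h1 := hc w u v
    rw [h.fderiv_metricForm hZ hz] at h1
    rw [h.metricForm_comm hz (D w v) u]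
    simp only [hD, sub_apply, map_sub]
    linarith
  have h0 : ∀ w u v, metricForm M z (D w u) v = 0 := by
    intro w u v
    have e1 := ha w u v
    have e2 := ha v w u
    have e3 := ha u v w
    rw [hDs v w] at e2
    rw [hDs u v, hDs u w] at e3
    linarith
  by_contra hne
  have hDne : D u v ≠ 0 := by
    rw [hD]; simpa [sub_eq_zero] using hne
  exact (h.metricForm_pos hz hDne).ne' (h0 u v (D u v))

end IsMetricOn

end MatrixMetrics

/-! ### Transformation laws of connection and curvature -/

section ChangeOfCoordinates

open Topology
open scoped InnerProductSpace

variable {d : ℕ} {M : Euc d → Matrix (Fin d) (Fin d) ℝ} {Z V : Set (Euc d)} {f : Euc d → Euc d}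

theorem fderiv_apply_eq_jacobian (x u : Euc d) (i : Fin d) :
    fderiv ℝ f x u i = ∑ j, jacobian f x i j * u j := by
  have h : u = ∑ j, u j • eucBasis j := by
    have := (EuclideanSpace.basisFun (Fin d) ℝ).sum_repr u
    simpa [EuclideanSpace.basisFun_apply] using this.symm
  conv_lhs => rw [h, map_sum]
  simp only [map_smul, WithLp.ofLp_sum, Finset.sum_apply, PiLp.smul_apply, smul_eq_mul, jacobian,
    Matrix.of_apply]
  exact Finset.sum_congr rfl fun j _ => mul_comm _ _

theorem changeCoords_apply (x : Euc d) (i j : Fin d) : changeCoords M f x i j =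
    metricForm M (f x) (fderiv ℝ f x (eucBasis i)) (fderiv ℝ f x (eucBasis j)) := by
  rw [metricForm_apply, metricInner, changeCoords, Matrix.mul_apply]
  simp only [Matrix.mul_apply, Matrix.transpose_apply, jacobian, Matrix.of_apply, Finset.sum_mul]
  rw [Finset.sum_comm]

theorem metricForm_changeCoords (x u v : Euc d) : metricForm (changeCoords M f) x u v =
    metricForm M (f x) (fderiv ℝ f x u) (fderiv ℝ f x v) := by
  revert v
  refine euc_induction (P := fun u => ∀ v, metricForm (changeCoords M f) x u v =
    metricForm M (f x) (fderiv ℝ f x u) (fderiv ℝ f x v))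
    (fun x y hx hy v => by simp only [map_add, add_apply, hx, hy])
    (fun c x hx v => by simp only [map_smul, smul_apply, hx]) (fun v => by simp)
    (fun i v => ?_) u
  refine euc_induction (P := fun v => metricForm (changeCoords M f) x (eucBasis i) v =
    metricForm M (f x) (fderiv ℝ f x (eucBasis i)) (fderiv ℝ f x v))
    (fun x y hx hy => by simp only [map_add, hx, hy])
    (fun c x hx => by simp only [map_smul, hx]) (by simp) (fun j => ?_) v
  rw [metricForm_basis, changeCoords_apply]

theorem hasFDerivAt_of_contDiffOn {F : Type*} [NormedAddCommGroup F] [NormedSpace ℝ F]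
    {g : Euc d → F} (hV : IsOpen V) (hg : ContDiffOn ℝ ∞ g V) {x : Euc d} (hx : x ∈ V) :
    HasFDerivAt g (fderiv ℝ g x) x :=
  ((hg.contDiffAt (hV.mem_nhds hx)).differentiableAt (by simp)).hasFDerivAt

theorem symm_snd_fderiv (hV : IsOpen V) (hf : ContDiffOn ℝ ∞ f V) {x : Euc d} (hx : x ∈ V)
    (u v : Euc d) : fderiv ℝ (fderiv ℝ f) x u v = fderiv ℝ (fderiv ℝ f) x v u :=
  (hf.contDiffAt (hV.mem_nhds hx)).isSymmSndFDerivAt (n := ∞)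
    (by rw [minSmoothness_of_isRCLikeNormedField]; exact ENat.LEInfty.out) u v

/-- A smooth change of coordinates with invertible derivative. -/
structure IsCoordChange (f : Euc d → Euc d) (V Z : Set (Euc d)) : Prop where
  isOpen_source : IsOpen V
  isOpen_target : IsOpen Z
  smooth : ContDiffOn ℝ ∞ f V
  mapsTo : Set.MapsTo f V Z
  isUnit : ∀ x ∈ V, IsUnit (fderiv ℝ f x)

namespace IsCoordChange

theorem inverse_apply (hf : IsCoordChange f V Z) {x : Euc d} (hx : x ∈ V) (u : Euc d) :
    Ring.inverse (fderiv ℝ f x) (fderiv ℝ f x u) = u :=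
  congrArg (fun L : Euc d →L[ℝ] Euc d => L u) (Ring.inverse_mul_cancel _ (hf.isUnit x hx))

theorem apply_inverse (hf : IsCoordChange f V Z) {x : Euc d} (hx : x ∈ V) (u : Euc d) :
    fderiv ℝ f x (Ring.inverse (fderiv ℝ f x) u) = u :=
  congrArg (fun L : Euc d →L[ℝ] Euc d => L u) (Ring.mul_inverse_cancel _ (hf.isUnit x hx))

theorem injective (hf : IsCoordChange f V Z) {x : Euc d} (hx : x ∈ V) :
    Function.Injective (fderiv ℝ f x) :=
  Function.LeftInverse.injective (hf.inverse_apply hx)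

theorem hasFDerivAt (hf : IsCoordChange f V Z) {x : Euc d} (hx : x ∈ V) :
    HasFDerivAt f (fderiv ℝ f x) x :=
  hasFDerivAt_of_contDiffOn hf.isOpen_source hf.smooth hx

theorem smooth_fderiv (hf : IsCoordChange f V Z) : ContDiffOn ℝ ∞ (fderiv ℝ f) V :=
  hf.smooth.fderiv_of_isOpen hf.isOpen_source (by simp)

theorem hasFDerivAt_fderiv (hf : IsCoordChange f V Z) {x : Euc d} (hx : x ∈ V) :
    HasFDerivAt (fderiv ℝ f) (fderiv ℝ (fderiv ℝ f) x) x :=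
  hasFDerivAt_of_contDiffOn hf.isOpen_source hf.smooth_fderiv hx

theorem isMetricOn (hf : IsCoordChange f V Z) (h : IsMetricOn M Z) :
    IsMetricOn (changeCoords M f) V := by
  refine ⟨fun i j => ?_, fun x hx => ?_⟩
  · simp only [changeCoords_apply]
    exact ((h.contDiffOn_metricForm.comp hf.smooth hf.mapsTo).clm_apply
      (hf.smooth_fderiv.clm_apply contDiffOn_const)).clm_apply
      (hf.smooth_fderiv.clm_apply contDiffOn_const)
  · have h1 := (h.posDef _ (hf.mapsTo hx)).conjTranspose_mul_mul_same (B := jacobian f x) ?_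
    · simpa [changeCoords, Matrix.conjTranspose_eq_transpose_of_trivial] using h1
    · intro u v huv
      have h2 : fderiv ℝ f x (WithLp.toLp 2 u) = fderiv ℝ f x (WithLp.toLp 2 v) := by
        ext i
        rw [fderiv_apply_eq_jacobian, fderiv_apply_eq_jacobian]
        exact congrFun huv i
      exact (WithLp.toLp_injective 2) (hf.injective hx h2)

/-- Transformation law of the Levi-Civita connection. -/
theorem christoffelForm_changeCoords (hf : IsCoordChange f V Z) (h : IsMetricOn M Z) {x : Euc d}
    (hx : x ∈ V) (u v : Euc d) :
    fderiv ℝ f x (christoffelForm (changeCoords M f) x u v) =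
      christoffelForm M (f x) (fderiv ℝ f x u) (fderiv ℝ f x v) +
        fderiv ℝ (fderiv ℝ f) x u v := by
  have hfx := hf.mapsTo hx
  have h' := hf.isMetricOn h
  -- The pulled-back connection. It is symmetric and compatible with the pulled-back metric, so
  -- uniqueness gives the transformation law without index computations.
  let B : Euc d →L[ℝ] Euc d →L[ℝ] Euc d :=
    (ContinuousLinearMap.compL ℝ (Euc d) (Euc d) (Euc d) (Ring.inverse (fderiv ℝ f x))) ∘L
      ((christoffelForm M (f x)).bilinearComp (fderiv ℝ f x) (fderiv ℝ f x) +
        fderiv ℝ (fderiv ℝ f) x)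
  have hB : ∀ u v, fderiv ℝ f x (B u v) =
      christoffelForm M (f x) (fderiv ℝ f x u) (fderiv ℝ f x v) +
        fderiv ℝ (fderiv ℝ f) x u v := fun u v => by
    simp only [B, ContinuousLinearMap.comp_apply, ContinuousLinearMap.compL_apply, add_apply,
      ContinuousLinearMap.bilinearComp_apply, hf.apply_inverse hx]
  rw [← hB u v, ← h'.eq_christoffelForm hf.isOpen_source hx (B := B)]
  · intro u v
    apply hf.injective hx
    rw [hB, hB, h.christoffelForm_symm hf.isOpen_target hfx,
      symm_snd_fderiv hf.isOpen_source hf.smooth hx]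
  · intro w u v
    have h1 := (hasFDerivAt_of_contDiffOn hf.isOpen_target h.contDiffOn_metricForm hfx).comp x
      (hf.hasFDerivAt hx)
    have h2 := fun u => (hf.hasFDerivAt_fderiv hx).clm_apply (hasFDerivAt_const u x)
    have h3 := (h1.clm_apply (h2 u)).clm_apply (h2 v)
    have h4 := ((hasFDerivAt_of_contDiffOn hf.isOpen_source h'.contDiffOn_metricForm hx).clm_apply
      (hasFDerivAt_const u x)).clm_apply (hasFDerivAt_const v x)
    have h5 : (fun x => metricForm (changeCoords M f) x u v) = fun x =>
        (metricForm M ∘ f) x (fderiv ℝ f x u) (fderiv ℝ f x v) :=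
      funext fun x => metricForm_changeCoords x u v
    rw [h5] at h4
    have h6 := congrArg (fun L : Euc d →L[ℝ] ℝ => L w) (h4.unique h3)
    simp only [add_apply, ContinuousLinearMap.comp_apply, ContinuousLinearMap.flip_apply,
      zero_apply, map_zero, zero_add, Function.comp,
      h.fderiv_metricForm hf.isOpen_target hfx] at h6
    rw [h6, metricForm_changeCoords, metricForm_changeCoords, hB, hB]
    simp only [map_add, add_apply]
    ring

/-- Transformation law of the curvature tensor. -/
theorem connCurvature_changeCoords (hf : IsCoordChange f V Z) (h : IsMetricOn M Z) {x : Euc d}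
    (hx : x ∈ V) (u v w : Euc d) :
    fderiv ℝ f x (connCurvature (christoffelForm (changeCoords M f)) x u v w) =
      connCurvature (christoffelForm M) (f x) (fderiv ℝ f x u) (fderiv ℝ f x v)
        (fderiv ℝ f x w) := by
  have hfx := hf.mapsTo hx
  have h' := hf.isMetricOn h
  have hV := hf.isOpen_source
  have hΓ' := hasFDerivAt_of_contDiffOn hV (h'.contDiffOn_christoffelForm hV) hx
  have hΓ := (hasFDerivAt_of_contDiffOn hf.isOpen_target
    (h.contDiffOn_christoffelForm hf.isOpen_target) hfx).comp x (hf.hasFDerivAt hx)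
  have hJ := hf.hasFDerivAt_fderiv hx
  have hJ2 := hasFDerivAt_of_contDiffOn hV
    (hf.smooth_fderiv.fderiv_of_isOpen hV (m := ∞) (by simp)) hx
  have hsymm := fun a b => symm_snd_fderiv hV hf.smooth hx a b
  have hsymm3 : ∀ a b c, fderiv ℝ (fderiv ℝ (fderiv ℝ f)) x a b c =
      fderiv ℝ (fderiv ℝ (fderiv ℝ f)) x b a c := fun a b c =>
    congrArg (fun L : Euc d →L[ℝ] Euc d => L c)
      ((hf.smooth_fderiv.contDiffAt (hV.mem_nhds hx)).isSymmSndFDerivAt (n := ∞)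
        (by rw [minSmoothness_of_isRCLikeNormedField]; exact ENat.LEInfty.out) a b)
  -- The derivative of the transformation law. After antisymmetrising in u and v, the symmetry of
  -- the second and third derivatives of f cancels every term that is not tensorial.
  have key : ∀ u v w, fderiv ℝ f x (fderiv ℝ (christoffelForm (changeCoords M f)) x u v w) =
      fderiv ℝ (christoffelForm M) (f x) (fderiv ℝ f x u) (fderiv ℝ f x v) (fderiv ℝ f x w) +
      christoffelForm M (f x) (fderiv ℝ (fderiv ℝ f) x u v) (fderiv ℝ f x w) +
      christoffelForm M (f x) (fderiv ℝ f x v) (fderiv ℝ (fderiv ℝ f) x u w) +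
      fderiv ℝ (fderiv ℝ (fderiv ℝ f)) x u v w -
      fderiv ℝ (fderiv ℝ f) x u (christoffelForm (changeCoords M f) x v w) := by
    intro u v w
    have h1 := hJ.clm_apply ((hΓ'.clm_apply (hasFDerivAt_const v x)).clm_apply
      (hasFDerivAt_const w x))
    have h2 := ((hΓ.clm_apply (hJ.clm_apply (hasFDerivAt_const v x))).clm_apply
      (hJ.clm_apply (hasFDerivAt_const w x))).add
      ((hJ2.clm_apply (hasFDerivAt_const v x)).clm_apply (hasFDerivAt_const w x))
    have h3 := h1.congr_of_eventuallyEq (f₁ := (fun y => (christoffelForm M ∘ f) y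
      (fderiv ℝ f y v) (fderiv ℝ f y w)) + fun y => fderiv ℝ (fderiv ℝ f) y v w) (by
        filter_upwards [hV.mem_nhds hx] with y hy
        exact (hf.christoffelForm_changeCoords h hy v w).symm)
    have h4 := congrArg (fun L : Euc d →L[ℝ] Euc d => L u) (h3.unique h2)
    simp only [add_apply, ContinuousLinearMap.comp_apply, ContinuousLinearMap.flip_apply,
      zero_apply, map_zero, zero_add, Function.comp] at h4
    rw [eq_sub_iff_add_eq, h4]
    abel
  have key2 : ∀ u v w, fderiv ℝ f x (christoffelForm (changeCoords M f) x u
      (christoffelForm (changeCoords M f) x v w)) =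
      christoffelForm M (f x) (fderiv ℝ f x u)
        (christoffelForm M (f x) (fderiv ℝ f x v) (fderiv ℝ f x w)) +
      christoffelForm M (f x) (fderiv ℝ f x u) (fderiv ℝ (fderiv ℝ f) x v w) +
      fderiv ℝ (fderiv ℝ f) x u (christoffelForm (changeCoords M f) x v w) := by
    intro u v w
    rw [hf.christoffelForm_changeCoords h hx, hf.christoffelForm_changeCoords h hx, map_add]
  simp only [connCurvature, map_add, map_sub, key, key2]
  rw [hsymm v u, hsymm3 v u]
  abel

theorem riemannUp_eq (h : IsMetricOn M Z) (hZ : IsOpen Z) {z : Euc d} (hz : z ∈ Z)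
    (l i j k : Fin d) : connCurvature (christoffelForm M) z (eucBasis i) (eucBasis j)
      (eucBasis k) l = riemannUp M l i j k z := by
  have hΓ := hasFDerivAt_of_contDiffOn hZ (h.contDiffOn_christoffelForm hZ) hz
  have hd : ∀ i j k, fderiv ℝ (christoffelForm M) z (eucBasis i) (eucBasis j) (eucBasis k) l =
      pderivAt i (christoffel M l j k) z := by
    intro i j k
    have h1 := (eucProj l).hasFDerivAt.comp z ((hΓ.clm_apply
      (hasFDerivAt_const (eucBasis j) z)).clm_apply (hasFDerivAt_const (eucBasis k) z))
    have h2 : (fun w => christoffel M l j k w) =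
        (eucProj l) ∘ fun y => christoffelForm M y (eucBasis j) (eucBasis k) :=
      funext fun w => (christoffelForm_basis w j k l).symm
    rw [pderivAt, show christoffel M l j k = fun w => christoffel M l j k w from rfl, h2,
      h1.fderiv]
    simp
  have hq : ∀ i j k, christoffelForm M z (eucBasis i)
      (christoffelForm M z (eucBasis j) (eucBasis k)) l =
      ∑ q, christoffel M l i q z * christoffel M q j k z := by
    intro i j k
    rw [christoffelForm_apply]
    simp [christoffelForm_basis]
  simp only [connCurvature, PiLp.sub_apply, PiLp.add_apply, hd, hq, riemannUp,
    Finset.sum_sub_distrib]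
  ring

theorem curvatureVec_eq (h : IsMetricOn M Z) (hZ : IsOpen Z) {z : Euc d} (hz : z ∈ Z)
    (u v w : Euc d) : curvatureVec M z u v w = connCurvature (christoffelForm M) z u v w := by
  ext l
  have hb := riemannUp_eq h hZ hz l
  have hu : ∀ x : Euc d, x = ∑ j, x j • eucBasis j := fun x => by
    have := (EuclideanSpace.basisFun (Fin d) ℝ).sum_repr x
    simpa [EuclideanSpace.basisFun_apply] using this.symm
  let R : Euc d →ₗ[ℝ] Euc d →ₗ[ℝ] Euc d →ₗ[ℝ] ℝ :=
    LinearMap.mk₂ ℝ (fun u v =>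
      { toFun := fun w => connCurvature (christoffelForm M) z u v w l
        map_add' := fun w w' => by simp [connCurvature]; ring
        map_smul' := fun c w => by simp [connCurvature]; ring })
      (fun u u' v => by ext w; simp [connCurvature]; ring)
      (fun c u v => by ext w; simp [connCurvature]; ring)
      (fun u v v' => by ext w; simp [connCurvature]; ring)
      (fun c u v => by ext w; simp [connCurvature]; ring)
  have hR : connCurvature (christoffelForm M) z u v w l = R u v w := rfl
  have e1 : ∀ v w, R u v w = ∑ i, u i * R (eucBasis i) v w := fun v w => by
    conv_lhs => rw [hu u]
    simp [map_sum]
  have e2 : ∀ a w, R a v w = ∑ j, v j * R a (eucBasis j) w := fun a w => by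
    conv_lhs => rw [hu v]
    simp [map_sum]
  have e3 : ∀ a b, R a b w = ∑ k, w k * R a b (eucBasis k) := fun a b => by
    conv_lhs => rw [hu w]
    simp [map_sum]
  rw [hR, e1]
  simp only [curvatureVec]
  refine Finset.sum_congr rfl fun i _ => ?_
  rw [e2, Finset.mul_sum]
  refine Finset.sum_congr rfl fun j _ => ?_
  rw [e3, Finset.mul_sum, Finset.mul_sum]
  refine Finset.sum_congr rfl fun k _ => ?_
  rw [← hb]
  change R (eucBasis i) (eucBasis j) (eucBasis k) * _ * _ * _ = _
  ring

end IsCoordChange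

end ChangeOfCoordinates

/-! ### Estimates in normal coordinates and in their rescalings -/

section NormalCoordsEstimates

open Topology
open scoped InnerProductSpace

variable {d : ℕ} {M : Euc d → Matrix (Fin d) (Fin d) ℝ} {Z V : Set (Euc d)}

theorem OpenPartialHomeomorph.isUnit_fderiv_symm {χ : OpenPartialHomeomorph (Euc d) (Euc d)}
    (hχ : IsDiffeo χ) {x : Euc d} (hx : x ∈ χ.target) : IsUnit (fderiv ℝ χ.symm x) := by
  have hy : χ.symm x ∈ χ.source := χ.map_target hx
  have h1 := hasFDerivAt_of_contDiffOn χ.open_target hχ.smooth_symm hx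
  have h2 := hasFDerivAt_of_contDiffOn χ.open_source hχ.smooth hy
  have e1 : fderiv ℝ χ (χ.symm x) ∘L fderiv ℝ χ.symm x = 1 := by
    refine ((h2.comp x h1).congr_of_eventuallyEq (f₁ := id) ?_).unique (hasFDerivAt_id x)
    filter_upwards [χ.open_target.mem_nhds hx] with y hy
    exact (χ.right_inv hy).symm
  have h1' : HasFDerivAt χ.symm (fderiv ℝ χ.symm x) (χ (χ.symm x)) := by rwa [χ.right_inv hx]
  have e2 : fderiv ℝ χ.symm x ∘L fderiv ℝ χ (χ.symm x) = 1 := by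
    refine ((h1'.comp (χ.symm x) h2).congr_of_eventuallyEq (f₁ := id) ?_).unique
      (hasFDerivAt_id _)
    filter_upwards [χ.open_source.mem_nhds hy] with y hy
    exact (χ.left_inv hy).symm
  exact ⟨⟨_, _, e2, e1⟩, rfl⟩

theorem IsDiffeo.isCoordChange {χ : OpenPartialHomeomorph (Euc d) (Euc d)} (hχ : IsDiffeo χ)
    (hZ : IsOpen Z) (hs : χ.source ⊆ Z) : IsCoordChange χ.symm χ.target Z where
  isOpen_source := χ.open_target
  isOpen_target := hZ
  smooth := hχ.smooth_symm
  mapsTo := fun _ hx => hs (χ.map_target hx)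
  isUnit := fun _ hx => χ.isUnit_fderiv_symm hχ hx

theorem metricNorm_eq (z u : Euc d) : metricNorm M z u = √(metricForm M z u u) := by
  rw [metricNorm, metricForm_apply]

theorem IsGeodesicOn.hasDerivAt {c : ℝ → Euc d} {a b : ℝ} (h : IsGeodesicOn M c a b) {t : ℝ}
    (ht : t ∈ Set.Ioo a b) : HasDerivAt c (deriv c t) t ∧
      HasDerivAt (deriv c) (-(christoffelForm M (c t) (deriv c t) (deriv c t))) t := by
  have h1 : ContDiffAt ℝ 2 c t := h.1.contDiffAt (isOpen_Ioo.mem_nhds ht)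
  have h2 : ContDiffOn ℝ 1 (deriv c) (Set.Ioo a b) :=
    ((contDiffOn_succ_iff_deriv_of_isOpen (n := 1) isOpen_Ioo).1
      (by simpa [one_add_one_eq_two] using h.1)).2.2
  refine ⟨(h1.differentiableAt (by simp)).hasDerivAt, ?_⟩
  have h3 := (((h2.contDiffAt (isOpen_Ioo.mem_nhds ht))).differentiableAt (by simp)).hasDerivAt
  refine h3.congr_deriv ?_
  ext k
  rw [h.2 t ht k, PiLp.neg_apply, christoffelForm_apply]

theorem exists_one_lt_mul_norm_lt {E : Type*} [NormedAddCommGroup E] [NormedSpace ℝ E] {x : E}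
    {s : ℝ} (hx : x ∈ Metric.ball (0 : E) s) :
    ∃ c : ℝ, 1 < c ∧ c • x ∈ Metric.ball (0 : E) s := by
  rw [mem_ball_zero_iff] at hx
  rcases eq_or_ne ‖x‖ 0 with h0 | h0
  · refine ⟨2, by norm_num, ?_⟩
    rw [mem_ball_zero_iff, norm_smul, h0, mul_zero]
    rwa [h0] at hx
  · have hpos : 0 < ‖x‖ := lt_of_le_of_ne (norm_nonneg x) (Ne.symm h0)
    obtain ⟨c, h1, h2⟩ := exists_between ((one_lt_div hpos).2 hx)
    refine ⟨c, h1, ?_⟩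
    rw [mem_ball_zero_iff, norm_smul, Real.norm_of_nonneg (by positivity)]
    exact (lt_div_iff₀ hpos).1 h2

/-- The ray is a straight line in the chart, so its second derivative in Z comes only from the
chart. Comparison of the geodesic equation with the transformation law then leaves Γ(x, x) = 0. As
before, x is placed at an interior time of the ray through c • x. -/
theorem IsNormalCoords.radial_christoffelForm {p : Euc d} {s : ℝ}
    {χ : OpenPartialHomeomorph (Euc d) (Euc d)} (hχ : IsNormalCoords M Z p s χ) (hZ : IsOpen Z)
    (h : IsMetricOn M Z) {x : Euc d} (hx : x ∈ Metric.ball (0 : Euc d) s) :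
    christoffelForm (changeCoords M χ.symm) x x x = 0 := by
  have hf := hχ.isDiffeo.isCoordChange hZ hχ.source_subset
  rw [hχ.target_eq] at hf
  obtain ⟨c, hc1, hcx⟩ := exists_one_lt_mul_norm_lt hx
  have hc0 : c ≠ 0 := by positivity
  have ht : c⁻¹ ∈ Set.Ioo (-1 : ℝ) 1 :=
    ⟨by linarith [inv_pos.2 (zero_lt_one.trans hc1)], inv_lt_one_of_one_lt₀ hc1⟩
  have hxeq : c⁻¹ • c • x = x := by rw [smul_smul, inv_mul_cancel₀ hc0, one_smul]
  have hgeo := hχ.radial _ hcx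
  have hmem : ∀ t ∈ Set.Ioo (-1 : ℝ) 1, t • c • x ∈ Metric.ball (0 : Euc d) s := fun t ht =>
    smul_mem_ball_of_symIcc hcx ⟨t, Set.Ioo_subset_Icc_self ht⟩
  have hd : ∀ t ∈ Set.Ioo (-1 : ℝ) 1, HasDerivAt (fun t : ℝ => χ.symm (t • c • x))
      (fderiv ℝ χ.symm (t • c • x) (c • x)) t := fun t ht =>
    IsNormalMetric.hasDerivAt_ray hf.smooth (hmem t ht)
  have hdd := (IsNormalMetric.hasDerivAt_ray hf.smooth_fderiv (hmem _ ht)).clm_apply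
    (hasDerivAt_const c⁻¹ (c • x))
  have hdd' : HasDerivAt (deriv fun t : ℝ => χ.symm (t • c • x)) _ c⁻¹ :=
    hdd.congr_of_eventuallyEq (by
      filter_upwards [isOpen_Ioo.mem_nhds ht] with t ht
      exact (hd t ht).deriv)
  have h1 := hdd'.unique (hgeo.hasDerivAt ht).2
  rw [(hd _ ht).deriv, hxeq, map_zero, add_zero] at h1
  have h2 := hf.christoffelForm_changeCoords h hx (c • x) (c • x)
  rw [h1, add_neg_cancel] at h2
  have h3 : christoffelForm (changeCoords M χ.symm) x (c • x) (c • x) = 0 :=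
    hf.injective hx (h2.trans (map_zero _).symm)
  simp only [map_smul, smul_apply, smul_smul] at h3
  exact (smul_eq_zero.1 h3).resolve_left (mul_ne_zero hc0 hc0)

/-- Passage from the matrix setting to the abstract one. The curvature bound carries over because
both of its sides are tensorial. -/
theorem IsNormalCoords.isNormalMetric {p : Euc d} {s κ : ℝ}
    {χ : OpenPartialHomeomorph (Euc d) (Euc d)} (hχ : IsNormalCoords M Z p s χ) (hZ : IsOpen Z)
    (h : IsMetricOn M Z) (hR : CurvatureBoundedOn M Z κ) :
    IsNormalMetric s κ (metricForm (changeCoords M χ.symm))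
      (christoffelForm (changeCoords M χ.symm)) := by
  have hf := hχ.isDiffeo.isCoordChange hZ hχ.source_subset
  rw [hχ.target_eq] at hf
  have h' := hf.isMetricOn h
  refine ⟨h'.contDiffOn_metricForm, h'.contDiffOn_christoffelForm Metric.isOpen_ball,
    fun x hx => h'.christoffelForm_symm Metric.isOpen_ball hx,
    fun x hx => h'.fderiv_metricForm Metric.isOpen_ball hx, fun u v => ?_,
    fun x hx => hχ.radial_christoffelForm hZ h hx, fun x hx u v w z => ?_⟩
  · rw [metricForm_apply, metricInner, hχ.metric_base, PiLp.inner_apply]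
    refine Finset.sum_congr rfl fun i _ => ?_
    rw [Finset.sum_eq_single i]
    · simp [mul_comm]
    · intro j _ hj
      simp [hj.symm]
    · simp
  · simp only [metricForm_changeCoords, ← metricNorm_eq]
    rw [hf.connCurvature_changeCoords h hx,
      ← IsCoordChange.curvatureVec_eq h hZ (hf.mapsTo hx), metricForm_apply]
    exact hR _ (hf.mapsTo hx) _ _ _ _

theorem christoffelForm_congr {M' : Euc d → Matrix (Fin d) (Fin d) ℝ} {z : Euc d}
    (h : M =ᶠ[𝓝 z] M') : christoffelForm M z = christoffelForm M' z := by
  have hp : ∀ l i j, pderivAt l (fun w => M w i j) z = pderivAt l (fun w => M' w i j) z := by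
    intro l i j
    unfold pderivAt
    rw [Filter.EventuallyEq.fderiv_eq]
    filter_upwards [h] with w hw
    rw [hw]
  simp only [christoffelForm, christoffel, hp, h.self_of_nhds]

theorem fderiv_const_smul_id (a : ℝ) (w : Euc d) :
    fderiv ℝ (fun w : Euc d => a • w) w = a • ContinuousLinearMap.id ℝ (Euc d) :=
  ((hasFDerivAt_id w).const_smul a).fderiv

theorem isCoordChange_smul {a s : ℝ} (ha : 0 < a) :
    IsCoordChange (fun w : Euc d => a⁻¹ • w) (Metric.ball 0 (a * s)) (Metric.ball 0 s) where
  isOpen_source := Metric.isOpen_ball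
  isOpen_target := Metric.isOpen_ball
  smooth := (contDiff_const_smul _).contDiffOn
  mapsTo := fun w hw => by
    rw [mem_ball_zero_iff] at hw ⊢
    rw [norm_smul, Real.norm_of_nonneg (by positivity), inv_mul_lt_iff₀ ha]
    exact hw
  isUnit := fun w _ => by
    rw [fderiv_const_smul_id]
    refine ⟨⟨a⁻¹ • ContinuousLinearMap.id ℝ _, a • ContinuousLinearMap.id ℝ _, ?_, ?_⟩, rfl⟩ <;>
      · ext v
        simp [smul_smul, ha.ne']

theorem christoffelForm_smul {a s : ℝ} (ha : 0 < a) (h : IsMetricOn M (Metric.ball 0 s))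
    {w : Euc d} (hw : w ∈ Metric.ball 0 (a * s)) (u v : Euc d) :
    a⁻¹ • christoffelForm (changeCoords M fun w => a⁻¹ • w) w u v =
      christoffelForm M (a⁻¹ • w) (a⁻¹ • u) (a⁻¹ • v) := by
  have h1 := (isCoordChange_smul (d := d) (s := s) ha).christoffelForm_changeCoords h hw u v
  have h2 : fderiv ℝ (fun w : Euc d => a⁻¹ • w) = fun _ => a⁻¹ • ContinuousLinearMap.id ℝ (Euc d) :=
    funext fun w => fderiv_const_smul_id _ w
  rw [h2] at h1
  simpa using h1

theorem changeCoords_comp {f g : Euc d → Euc d} {w : Euc d} (hf : DifferentiableAt ℝ f (g w))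
    (hg : DifferentiableAt ℝ g w) :
    changeCoords M (f ∘ g) w = changeCoords (changeCoords M f) g w := by
  ext i j
  rw [changeCoords_apply, changeCoords_apply, metricForm_changeCoords, fderiv_comp w hf hg]
  rfl

/-- Normal coordinates that are rescaled by the factor `a`. -/
noncomputable def scaledCoords (χ : OpenPartialHomeomorph (Euc d) (Euc d)) (a : ℝ) (ha : 0 < a) :
    OpenPartialHomeomorph (Euc d) (Euc d) :=
  χ.trans (Homeomorph.smulOfNeZero a ha.ne').toOpenPartialHomeomorph

variable {χ : OpenPartialHomeomorph (Euc d) (Euc d)} {a s : ℝ} (ha : 0 < a)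

theorem scaledCoords_source : (scaledCoords χ a ha).source = χ.source := by
  simp [scaledCoords]

theorem scaledCoords_apply (z : Euc d) : scaledCoords χ a ha z = a • χ z := rfl

theorem scaledCoords_symm : (scaledCoords χ a ha).symm = χ.symm ∘ fun w => a⁻¹ • w := rfl

theorem scaledCoords_target (hs : χ.target = Metric.ball 0 s) :
    (scaledCoords χ a ha).target = Metric.ball 0 (a * s) := by
  ext w
  simp only [scaledCoords, OpenPartialHomeomorph.trans_target, hs, Set.mem_inter_iff,
    Homeomorph.toOpenPartialHomeomorph_target, Set.mem_univ, true_and, Set.mem_preimage]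
  change a⁻¹ • w ∈ Metric.ball 0 s ↔ _
  rw [mem_ball_zero_iff, mem_ball_zero_iff, norm_smul, Real.norm_of_nonneg (by positivity),
    inv_mul_lt_iff₀ ha]

theorem isDiffeo_scaledCoords (hχ : IsDiffeo χ) (hs : χ.target = Metric.ball 0 s) :
    IsDiffeo (scaledCoords χ a ha) := by
  constructor
  · rw [scaledCoords_source]
    exact hχ.smooth.const_smul a
  · rw [scaledCoords_target ha hs, scaledCoords_symm]
    exact hχ.smooth_symm.comp (isCoordChange_smul ha).smooth
      (hs ▸ (isCoordChange_smul ha).mapsTo)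

theorem changeCoords_scaledCoords (hχ : IsDiffeo χ) (hs : χ.target = Metric.ball 0 s)
    {w : Euc d} (hw : w ∈ Metric.ball 0 (a * s)) :
    changeCoords M (scaledCoords χ a ha).symm w =
      changeCoords (changeCoords M χ.symm) (fun w => a⁻¹ • w) w := by
  rw [scaledCoords_symm]
  refine changeCoords_comp ?_ ((isCoordChange_smul ha).hasFDerivAt hw).differentiableAt
  have := hasFDerivAt_of_contDiffOn χ.open_target hχ.smooth_symm
    (hs ▸ (isCoordChange_smul ha).mapsTo hw : a⁻¹ • w ∈ χ.target)
  exact this.differentiableAt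

theorem metricForm_scaledCoords (hχ : IsDiffeo χ) (hs : χ.target = Metric.ball 0 s)
    {w : Euc d} (hw : w ∈ Metric.ball 0 (a * s)) (u v : Euc d) :
    metricForm (changeCoords M (scaledCoords χ a ha).symm) w u v =
      (a⁻¹) ^ 2 * metricForm (changeCoords M χ.symm) (a⁻¹ • w) u v := by
  have h1 : metricForm (changeCoords M (scaledCoords χ a ha).symm) w =
      metricForm (changeCoords (changeCoords M χ.symm) (fun w => a⁻¹ • w)) w := by
    simp only [metricForm, changeCoords_scaledCoords ha hχ hs hw]
  rw [h1, metricForm_changeCoords, fderiv_const_smul_id]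
  simp [sq, mul_assoc]

/-- Geodesics in rescaled normal coordinates are nearly straight if the curvature is small. -/
theorem IsNormalCoords.geodesicsNearlyStraight {p : Euc d} {κ ε : ℝ}
    (hχ : IsNormalCoords M Z p s χ) (hZ : IsOpen Z) (h : IsMetricOn M Z)
    (hR : CurvatureBoundedOn M Z κ) (hκ : 0 ≤ κ) (hκs : 2 * κ * s ^ 2 ≤ 1 / 24)
    (hε : 25 * (2 * κ * s ^ 2) ≤ ε) :
    GeodesicsNearlyStraight (changeCoords M (scaledCoords χ a ha).symm)
      (scaledCoords χ a ha).target ε := by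
  rw [scaledCoords_target ha hχ.target_eq]
  intro c t₁ t₂ hc hmaps t₀ ht₀ t ht
  have hf := hχ.isDiffeo.isCoordChange hZ hχ.source_subset
  rw [hχ.target_eq] at hf
  have h' := hf.isMetricOn h
  have hgeo := ((hχ.isNormalMetric hZ h hR).exists_coframe hχ.pos hκ hκs).2
    (fun t => a⁻¹ • c t) (fun t => a⁻¹ • deriv c t) t₁ t₂
    (fun t ht => (isCoordChange_smul ha).mapsTo (hmaps ht))
    (fun t ht => (hc.hasDerivAt ht).1.const_smul a⁻¹) ?_ t₀ ht₀ t ht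
  · rw [← smul_sub, norm_smul, norm_smul, Real.norm_of_nonneg (by positivity : 0 ≤ a⁻¹)] at hgeo
    have h1 : ‖deriv c t - deriv c t₀‖ ≤ 25 * (2 * κ * s ^ 2) * ‖deriv c t₀‖ := by
      have : 0 < a⁻¹ := by positivity
      refine le_of_mul_le_mul_left (hgeo.trans (le_of_eq ?_)) this
      ring
    exact h1.trans (mul_le_mul_of_nonneg_right hε (norm_nonneg _))
  · intro t ht
    have h1 := ((hc.hasDerivAt ht).2.const_smul a⁻¹)
    refine h1.congr_deriv ?_
    have h2 : christoffelForm (changeCoords M (scaledCoords χ a ha).symm) (c t) =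
        christoffelForm (changeCoords (changeCoords M χ.symm) (fun w => a⁻¹ • w)) (c t) := by
      refine christoffelForm_congr ?_
      filter_upwards [Metric.isOpen_ball.mem_nhds (hmaps ht)] with w hw
      exact changeCoords_scaledCoords ha hχ.isDiffeo hχ.target_eq hw
    rw [h2, smul_neg, christoffelForm_smul ha h' (hmaps ht)]

end NormalCoordsEstimates

/-! ### Lengths, shortest paths and geodesic balls of almost Euclidean metrics -/

section Curves

open Topology
open scoped InnerProductSpace

variable {d : ℕ} {M : Euc d → Matrix (Fin d) (Fin d) ℝ} {Z V : Set (Euc d)}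

/-- The metric `M` is continuous on `V`. -/
abbrev ContinuousMetricOn (M : Euc d → Matrix (Fin d) (Fin d) ℝ) (V : Set (Euc d)) : Prop :=
  ContinuousOn (metricForm M) V

theorem ContinuousMetricOn.metricNorm {X : Type*} [TopologicalSpace X] {S : Set X} {c v : X → Euc d}
    (h : ContinuousMetricOn M V) (hc : ContinuousOn c S) (hv : ContinuousOn v S)
    (hcV : Set.MapsTo c S V) : ContinuousOn (fun t => metricNorm M (c t) (v t)) S := by
  simp only [metricNorm_eq]
  exact (((h.comp hc hcV).clm_apply hv).clm_apply hv).sqrt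

theorem metricNorm_nonneg (z u : Euc d) : 0 ≤ metricNorm M z u := Real.sqrt_nonneg _

namespace IsCurve

variable {x y : Euc d} {c : ℝ → Euc d}

theorem hasDerivWithinAt (hc : IsCurve V x y c) {t : ℝ} (ht : t ∈ Set.Icc (0 : ℝ) 1) :
    HasDerivWithinAt c (derivWithin c (Set.Icc 0 1) t) (Set.Icc 0 1) t :=
  ((hc.contDiffOn.differentiableOn (by simp)) t ht).hasDerivWithinAt

theorem hasDerivAt (hc : IsCurve V x y c) {t : ℝ} (ht : t ∈ Set.Ioo (0 : ℝ) 1) :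
    HasDerivAt c (derivWithin c (Set.Icc 0 1) t) t :=
  (hc.hasDerivWithinAt (Set.Ioo_subset_Icc_self ht)).hasDerivAt (Icc_mem_nhds ht.1 ht.2)

theorem continuousOn_speed (hc : IsCurve V x y c) (hM : ContinuousMetricOn M V) :
    ContinuousOn (curveSpeed M c) (Set.Icc 0 1) :=
  hM.metricNorm hc.contDiffOn.continuousOn
    (hc.contDiffOn.continuousOn_derivWithin (uniqueDiffOn_Icc zero_lt_one) le_rfl) hc.mapsTo

end IsCurve

/-- A curve whose speed is at most `C σ` moves at most by `C ∫ σ`. -/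
theorem norm_sub_le_mul_integral {g g' : ℝ → Euc d} {σ : ℝ → ℝ} {C t : ℝ}
    (ht : t ∈ Set.Icc (0 : ℝ) 1) (hC : 0 ≤ C) (hg : ContinuousOn g (Set.Icc 0 t))
    (hg' : ∀ τ ∈ Set.Ioo 0 t, HasDerivAt g (g' τ) τ) (hσ : ContinuousOn σ (Set.Icc 0 1))
    (hσ0 : ∀ τ, 0 ≤ σ τ) (hle : ∀ τ ∈ Set.Ioo 0 t, ‖g' τ‖ ≤ C * σ τ) :
    ‖g t - g 0‖ ≤ C * ∫ τ in (0 : ℝ)..1, σ τ := by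
  set D := g t - g 0 with hD
  have hint : IntervalIntegrable σ MeasureTheory.volume 0 1 :=
    hσ.intervalIntegrable_of_Icc zero_le_one
  have hσt : ContinuousOn (fun τ => C * σ τ * ‖D‖) (Set.Icc 0 t) :=
    ((continuousOn_const.mul hσ).mul continuousOn_const).mono (Set.Icc_subset_Icc_right ht.2)
  -- Projection onto the displacement D makes the estimate a scalar one; a factor ‖D‖ is divided out
  -- at the end.
  have h1 := intervalIntegral.sub_le_integral_of_hasDeriv_right_of_le (g := fun τ => ⟪g τ, D⟫_ℝ)
    (g' := fun τ => ⟪g' τ, D⟫_ℝ) (φ := fun τ => C * σ τ * ‖D‖) ht.1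
    (hg.inner continuousOn_const)
    (fun τ hτ => by
      have := (hg' τ hτ).inner (𝕜 := ℝ) (hasDerivAt_const τ D)
      simpa using this.hasDerivWithinAt)
    (hσt.integrableOn_compact isCompact_Icc)
    (fun τ hτ => (real_inner_le_norm _ _).trans
      (mul_le_mul_of_nonneg_right (hle τ hτ) (norm_nonneg _)))
  rw [← inner_sub_left, ← hD, real_inner_self_eq_norm_sq, intervalIntegral.integral_mul_const,
    intervalIntegral.integral_const_mul] at h1
  have h2 : ∫ τ in (0 : ℝ)..t, σ τ ≤ ∫ τ in (0 : ℝ)..1, σ τ :=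
    intervalIntegral.integral_mono_interval le_rfl ht.1 ht.2
      (Filter.Eventually.of_forall hσ0) hint
  have h3 : 0 ≤ ∫ τ in (0 : ℝ)..1, σ τ :=
    intervalIntegral.integral_nonneg zero_le_one fun τ _ => hσ0 τ
  have h4 : ‖D‖ * ‖D‖ ≤ (C * ∫ τ in (0 : ℝ)..1, σ τ) * ‖D‖ := by
    rw [← sq]
    exact h1.trans (mul_le_mul_of_nonneg_right (mul_le_mul_of_nonneg_left h2 hC) (norm_nonneg _))
  rcases eq_or_lt_of_le (norm_nonneg D) with h0 | h0
  · rw [← h0]; positivity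
  · exact le_of_mul_le_mul_right h4 h0

/-- The metric `M` is comparable with the Euclidean metric. -/
structure NormBoundsOn (M : Euc d → Matrix (Fin d) (Fin d) ℝ) (V : Set (Euc d)) (l₁ l₂ : ℝ) :
    Prop where
  pos : 0 < l₁
  lower : ∀ w ∈ V, ∀ v, l₁ * ‖v‖ ≤ metricNorm M w v
  upper : ∀ w ∈ V, ∀ v, metricNorm M w v ≤ l₂ * ‖v‖

variable {l₁ l₂ : ℝ}

theorem isCurve_lineMap {x y : Euc d} (hV : Convex ℝ V) (hx : x ∈ V) (hy : y ∈ V) :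
    IsCurve V x y (fun t => AffineMap.lineMap x y t) where
  contDiffOn := by
    have : ContDiff ℝ 1 (fun t : ℝ => AffineMap.lineMap x y t) := by
      simp only [AffineMap.lineMap_apply_module]
      fun_prop
    exact this.contDiffOn
  mapsTo := fun t ht => hV.lineMap_mem hx hy ht
  source := by simp
  target := by simp

theorem derivWithin_lineMap {x y : Euc d} {t : ℝ} (ht : t ∈ Set.Icc (0 : ℝ) 1) :
    derivWithin (fun t : ℝ => AffineMap.lineMap x y t) (Set.Icc 0 1) t = y - x :=
  (AffineMap.hasDerivAt_lineMap (a := x) (b := y) (x := t)).hasDerivWithinAt.derivWithin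
    (uniqueDiffOn_Icc zero_lt_one t ht)

theorem NormBoundsOn.curveLength_lineMap_le (hN : NormBoundsOn M V l₁ l₂)
    (hM : ContinuousMetricOn M V) {x y : Euc d} (hV : Convex ℝ V) (hx : x ∈ V) (hy : y ∈ V) :
    curveLength M (fun t => AffineMap.lineMap x y t) ≤ l₂ * ‖y - x‖ := by
  have hc := isCurve_lineMap hV hx hy
  have h1 : curveLength M (fun t => AffineMap.lineMap x y t) ≤
      ∫ _ in (0 : ℝ)..1, l₂ * ‖y - x‖ := by
    refine intervalIntegral.integral_mono_on zero_le_one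
      ((hc.continuousOn_speed hM).intervalIntegrable_of_Icc zero_le_one) (by simp) fun t ht => ?_
    rw [curveSpeed, derivWithin_lineMap ht]
    exact hN.upper _ (hc.mapsTo ht) _
  simpa using h1

/-- With a = z - x and b = y - z, the identity |(1-t)a - tb|² = (1-t)|a|² + t|b|² - t(1-t)|a+b|²
bounds the squared deviation by t(1-t)(q² - 1)‖y - x‖², and t(1-t) ≤ 1/4. -/
theorem norm_sub_lineMap_le {x y z : Euc d} {t q ε : ℝ} (ht : t ∈ Set.Icc (0 : ℝ) 1)
    (hq : q ^ 2 - 1 ≤ 4 * ε ^ 2) (hε : 0 ≤ ε)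
    (h1 : ‖z - x‖ ≤ q * t * ‖y - x‖) (h2 : ‖y - z‖ ≤ q * (1 - t) * ‖y - x‖) :
    ‖z - AffineMap.lineMap x y t‖ ≤ ε * ‖y - x‖ := by
  have hD : y - x = (z - x) + (y - z) := by abel
  have h3 : z - AffineMap.lineMap x y t = (1 - t) • (z - x) - t • (y - z) := by
    rw [AffineMap.lineMap_apply_module]
    module
  set a := z - x
  set b := y - z
  have e1 : ‖y - x‖ ^ 2 = ‖a‖ ^ 2 + 2 * ⟪a, b⟫_ℝ + ‖b‖ ^ 2 := by rw [hD, norm_add_sq_real]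
  have e2 : ‖z - AffineMap.lineMap x y t‖ ^ 2 =
      (1 - t) * ‖a‖ ^ 2 + t * ‖b‖ ^ 2 - t * (1 - t) * ‖y - x‖ ^ 2 := by
    rw [h3, norm_sub_sq_real, e1, norm_smul, norm_smul, inner_smul_left, inner_smul_right,
      mul_pow, mul_pow, Real.norm_eq_abs, Real.norm_eq_abs, sq_abs, sq_abs]
    simp only [conj_trivial]
    ring
  have s1 : ‖a‖ ^ 2 ≤ (q * t * ‖y - x‖) ^ 2 := by gcongr
  have s2 : ‖b‖ ^ 2 ≤ (q * (1 - t) * ‖y - x‖) ^ 2 := by gcongr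
  have ht1 : 0 ≤ 1 - t := by linarith [ht.2]
  have e3 : ‖z - AffineMap.lineMap x y t‖ ^ 2 ≤ (ε * ‖y - x‖) ^ 2 := by
    rw [e2]
    calc (1 - t) * ‖a‖ ^ 2 + t * ‖b‖ ^ 2 - t * (1 - t) * ‖y - x‖ ^ 2
        ≤ (1 - t) * (q * t * ‖y - x‖) ^ 2 + t * (q * (1 - t) * ‖y - x‖) ^ 2 -
          t * (1 - t) * ‖y - x‖ ^ 2 := by
          have := mul_le_mul_of_nonneg_left s1 ht1
          have := mul_le_mul_of_nonneg_left s2 ht.1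
          linarith
      _ = (t * (1 - t)) * (q ^ 2 - 1) * ‖y - x‖ ^ 2 := by ring
      _ ≤ (t * (1 - t)) * (4 * ε ^ 2) * ‖y - x‖ ^ 2 := by
          have := mul_nonneg ht.1 ht1
          gcongr
      _ ≤ (1 / 4) * (4 * ε ^ 2) * ‖y - x‖ ^ 2 := by
          have : t * (1 - t) ≤ 1 / 4 := by nlinarith [sq_nonneg (t - 1 / 2)]
          gcongr
      _ = (ε * ‖y - x‖) ^ 2 := by ring
  exact le_of_sq_le_sq e3 (by positivity)

/-- Shortest paths of a metric that is almost Euclidean up to a factor are nearly straight. -/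
theorem NormBoundsOn.shortestPathsNearlyStraight (hN : NormBoundsOn M V l₁ l₂)
    (hM : ContinuousMetricOn M V) (hV : Convex ℝ V) {ε : ℝ} (hε : 0 ≤ ε)
    (hl : (l₂ / l₁) ^ 2 - 1 ≤ 4 * ε ^ 2) : ShortestPathsNearlyStraight M V ε := by
  intro x y c hc t ht
  have h01 : (0 : ℝ) ∈ Set.Icc (0 : ℝ) 1 := by norm_num
  have h11 : (1 : ℝ) ∈ Set.Icc (0 : ℝ) 1 := by norm_num
  have hx : x ∈ V := hc.isCurve.source ▸ hc.isCurve.mapsTo h01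
  have hy : y ∈ V := hc.isCurve.target ▸ hc.isCurve.mapsTo h11
  have hL : curveLength M c ≤ l₂ * ‖y - x‖ :=
    (hc.length_le _ (isCurve_lineMap hV hx hy)).trans (hN.curveLength_lineMap_le hM hV hx hy)
  have hspeed : ∀ τ ∈ Set.Icc (0 : ℝ) 1,
      ‖derivWithin c (Set.Icc 0 1) τ‖ ≤ l₂ / l₁ * ‖y - x‖ := by
    intro τ hτ
    have h1 := hN.lower _ (hc.isCurve.mapsTo hτ) (derivWithin c (Set.Icc 0 1) τ)
    have h2 := hc.speed_eq τ hτ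
    rw [curveSpeed] at h2
    rw [h2] at h1
    rw [div_mul_eq_mul_div, le_div_iff₀ hN.pos, mul_comm]
    exact h1.trans hL
  have hmv : ∀ τ₁ ∈ Set.Icc (0 : ℝ) 1, ∀ τ₂ ∈ Set.Icc (0 : ℝ) 1,
      ‖c τ₂ - c τ₁‖ ≤ l₂ / l₁ * ‖y - x‖ * ‖τ₂ - τ₁‖ := fun τ₁ h₁ τ₂ h₂ =>
    (convex_Icc (0 : ℝ) 1).norm_image_sub_le_of_norm_hasDerivWithin_le
      (fun τ hτ => hc.isCurve.hasDerivWithinAt hτ) hspeed h₁ h₂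
  refine norm_sub_lineMap_le (q := l₂ / l₁) ht hl hε ?_ ?_
  · have := hmv 0 h01 t ht
    rw [hc.isCurve.source, sub_zero, Real.norm_of_nonneg ht.1] at this
    linarith
  · have := hmv t ht 1 h11
    rw [hc.isCurve.target, Real.norm_of_nonneg (by linarith [ht.2])] at this
    linarith

/-- The length of a curve is at least l₁ times the Euclidean distance of its end points. -/
theorem NormBoundsOn.geodesicBall_subset (hN : NormBoundsOn M V l₁ l₂)
    (hM : ContinuousMetricOn M V) (w : Euc d) (ρ : ℝ) :
    geodesicBall M V w ρ ⊆ Metric.ball w (ρ / l₁) ∩ V := by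
  rintro y ⟨c, hc, hlen⟩
  have h11 : (1 : ℝ) ∈ Set.Icc (0 : ℝ) 1 := by norm_num
  refine ⟨?_, hc.target ▸ hc.mapsTo h11⟩
  have h := norm_sub_le_mul_integral (C := l₁⁻¹) h11 (inv_nonneg.2 hN.pos.le)
    hc.contDiffOn.continuousOn (fun τ hτ => hc.hasDerivAt hτ) (hc.continuousOn_speed hM)
    (fun τ => metricNorm_nonneg _ _) (fun τ hτ => by
      have := hN.lower _ (hc.mapsTo (Set.Ioo_subset_Icc_self hτ)) (derivWithin c (Set.Icc 0 1) τ)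
      rw [inv_mul_eq_div, le_div_iff₀ hN.pos, mul_comm]
      exact this)
  rw [hc.source, hc.target] at h
  rw [Metric.mem_ball, dist_eq_norm]
  refine h.trans_lt ?_
  rw [inv_mul_eq_div]
  exact div_lt_div_of_pos_right hlen hN.pos

/-- The straight segment is a competitor, of length at most l₂ times the Euclidean distance. -/
theorem NormBoundsOn.subset_geodesicBall (hN : NormBoundsOn M V l₁ l₂) (hl : 0 < l₂)
    (hM : ContinuousMetricOn M V) (hV : Convex ℝ V) {w : Euc d} (hw : w ∈ V) (ρ : ℝ) :
    Metric.ball w (ρ / l₂) ∩ V ⊆ geodesicBall M V w ρ := by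
  rintro y ⟨hy, hyV⟩
  refine ⟨_, isCurve_lineMap hV hw hyV, (hN.curveLength_lineMap_le hM hV hw hyV).trans_lt ?_⟩
  rw [Metric.mem_ball, dist_eq_norm, lt_div_iff₀ hl] at hy
  linarith

theorem metricNorm_changeCoords (f : Euc d → Euc d) (x u : Euc d) :
    metricNorm (changeCoords M f) x u = metricNorm M (f x) (fderiv ℝ f x u) := by
  rw [metricNorm_eq, metricNorm_eq, metricForm_changeCoords]

/-- A change of coordinates maps curves to curves of the same speed. -/
theorem IsCoordChange.comp_curve {f : Euc d → Euc d} (hf : IsCoordChange f V Z) {x y : Euc d}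
    {c : ℝ → Euc d} (hc : IsCurve V x y c) :
    IsCurve Z (f x) (f y) (f ∘ c) ∧ curveLength M (f ∘ c) = curveLength (changeCoords M f) c := by
  refine ⟨⟨(hf.smooth.of_le (by exact_mod_cast le_top)).comp hc.contDiffOn hc.mapsTo,
    hf.mapsTo.comp hc.mapsTo, congrArg f hc.source, congrArg f hc.target⟩, ?_⟩
  refine intervalIntegral.integral_congr fun t ht => ?_
  rw [Set.uIcc_of_le zero_le_one] at ht
  have h1 := (hf.hasFDerivAt (hc.mapsTo ht)).comp_hasDerivWithinAt t (hc.hasDerivWithinAt ht)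
  rw [curveSpeed, curveSpeed, h1.derivWithin (uniqueDiffOn_Icc zero_lt_one t ht),
    metricNorm_changeCoords]
  rfl

variable {χ : OpenPartialHomeomorph (Euc d) (Euc d)} {s ρ : ℝ} {z : Euc d}

/-- A short curve that starts deep inside a coordinate neighbourhood stays in it. -/
theorem geodesicBall_subset_image (hχ : IsDiffeo χ) (hs : χ.target = Metric.ball 0 s)
    (hM : IsMetricOn M Z)
    (hN : NormBoundsOn (changeCoords M χ.symm) (Metric.ball 0 s) l₁ l₂) (hl : 1 / 2 < l₁)
    (hz : z ∈ χ.source) (hρ : 0 < ρ) (hzρ : ‖χ z‖ + 2 * ρ ≤ s) :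
    geodesicBall M Z z ρ ⊆ χ.symm '' Metric.ball (χ z) (ρ / l₁) := by
  rintro y ⟨c, hc, hlen⟩
  have hl1 := hN.pos
  -- The strict inequality puts even the closed ball inside the open coordinate ball when ‖χ z‖ + 2ρ
  -- = s.
  have hρ' : ρ / l₁ < 2 * ρ := by
    rw [div_lt_iff₀ hl1]; nlinarith
  have hball : Metric.closedBall (χ z) (ρ / l₁) ⊆ Metric.ball 0 s := by
    intro w hw
    rw [Metric.mem_closedBall, dist_eq_norm] at hw
    rw [mem_ball_zero_iff]
    have := norm_add_le (w - χ z) (χ z)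
    rw [sub_add_cancel] at this
    linarith
  have hcont := hc.contDiffOn.continuousOn
  have hest : ∀ t ∈ Set.Icc (0 : ℝ) 1, (∀ τ ∈ Set.Icc 0 t, c τ ∈ χ.source) →
      ‖χ (c t) - χ z‖ < ρ / l₁ := by
    intro t ht hsrc
    have h := norm_sub_le_mul_integral (g := fun τ => χ (c τ))
      (g' := fun τ => fderiv ℝ χ (c τ) (derivWithin c (Set.Icc 0 1) τ))
      (C := l₁⁻¹) ht (inv_nonneg.2 hN.pos.le)
      (χ.continuousOn.comp (hcont.mono (Set.Icc_subset_Icc_right ht.2)) hsrc)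
      (fun τ hτ => by
        have hτ' : τ ∈ Set.Ioo (0 : ℝ) 1 := ⟨hτ.1, hτ.2.trans_le ht.2⟩
        exact (hasFDerivAt_of_contDiffOn χ.open_source hχ.smooth
          (hsrc τ (Set.Ioo_subset_Icc_self hτ))).comp_hasDerivAt τ (hc.hasDerivAt hτ'))
      (hc.continuousOn_speed hM.contDiffOn_metricForm.continuousOn)
      (fun τ => metricNorm_nonneg _ _) (fun τ hτ => by
        have hτs := hsrc τ (Set.Ioo_subset_Icc_self hτ)
        have hτt := χ.map_source hτs
        have h1 := hN.lower (χ (c τ)) (hs ▸ hτt)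
          (fderiv ℝ χ (c τ) (derivWithin c (Set.Icc 0 1) τ))
        rw [metricNorm_changeCoords, χ.left_inv hτs] at h1
        have h2 : fderiv ℝ χ.symm (χ (c τ)) (fderiv ℝ χ (c τ) (derivWithin c (Set.Icc 0 1) τ)) =
            derivWithin c (Set.Icc 0 1) τ := by
          have e1 := hasFDerivAt_of_contDiffOn χ.open_target hχ.smooth_symm hτt
          have e2 := hasFDerivAt_of_contDiffOn χ.open_source hχ.smooth hτs
          have e3 := ((e1.comp (c τ) e2).congr_of_eventuallyEq (f₁ := id) (by
            filter_upwards [χ.open_source.mem_nhds hτs] with w hw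
            exact (χ.left_inv hw).symm)).unique (hasFDerivAt_id (c τ))
          exact congrArg (fun L : Euc d →L[ℝ] Euc d => L _) e3
        rw [h2] at h1
        rw [inv_mul_eq_div, le_div_iff₀ hN.pos, mul_comm]
        exact h1)
    rw [hc.source] at h
    refine h.trans_lt ?_
    rw [inv_mul_eq_div]
    exact div_lt_div_of_pos_right hlen hN.pos
  -- Let T be the first exit time. Before T the curve stays in the image of a closed coordinate
  -- ball; this image is compact, hence closed in the ambient space, so it contains c T as well,
  -- although c T lies outside the chart.
  have hall : ∀ t ∈ Set.Icc (0 : ℝ) 1, c t ∈ χ.source := by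
    by_contra hne
    push Not at hne
    have hclosed : IsCompact (Set.Icc (0 : ℝ) 1 ∩ c ⁻¹' χ.sourceᶜ) :=
      isCompact_Icc.of_isClosed_subset
        (hcont.preimage_isClosed_of_isClosed isClosed_Icc χ.open_source.isClosed_compl)
        Set.inter_subset_left
    obtain ⟨T, ⟨hT, hTs⟩, hmin⟩ := hclosed.exists_isLeast (by
      obtain ⟨t, ht, hts⟩ := hne
      exact ⟨t, ht, hts⟩)
    have hbefore : ∀ t ∈ Set.Ico (0 : ℝ) T, c t ∈ χ.source := by
      intro t ht
      by_contra hts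
      exact absurd (hmin ⟨⟨ht.1, ht.2.le.trans hT.2⟩, hts⟩) (not_le.2 ht.2)
    have hT0 : 0 < T := by
      rcases eq_or_lt_of_le hT.1 with h0 | h0
      · rw [← h0] at hTs
        exact absurd (by rw [hc.source]; exact hz) hTs
      · exact h0
    have hK : IsClosed (χ.symm '' Metric.closedBall (χ z) (ρ / l₁)) :=
      ((isCompact_closedBall _ _).image_of_continuousOn
        (χ.continuousOn_symm.mono (hs ▸ hball))).isClosed
    have hmem : c T ∈ χ.symm '' Metric.closedBall (χ z) (ρ / l₁) := by
      have hTc : Filter.Tendsto c (𝓝[<] T) (𝓝 (c T)) := by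
        have h1 := hcont T hT
        refine h1.mono_left ?_
        rw [← nhdsWithin_Ico_eq_nhdsLT hT0]
        exact nhdsWithin_mono _ fun t ht => ⟨ht.1, ht.2.le.trans hT.2⟩
      refine hK.mem_of_tendsto hTc ?_
      filter_upwards [Ico_mem_nhdsLT hT0] with t ht
      have hts := hbefore t ht
      refine ⟨χ (c t), ?_, χ.left_inv hts⟩
      rw [Metric.mem_closedBall, dist_eq_norm]
      exact (hest t ⟨ht.1, ht.2.le.trans hT.2⟩ fun τ hτ =>
        hbefore τ ⟨hτ.1, hτ.2.trans_lt ht.2⟩).le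
    obtain ⟨w, hw, hwT⟩ := hmem
    exact hTs (hwT ▸ χ.map_target (hs ▸ hball hw))
  have h11 : (1 : ℝ) ∈ Set.Icc (0 : ℝ) 1 := by norm_num
  have h1 := hest 1 h11 hall
  have h2 := hall 1 h11
  rw [hc.target] at h1 h2
  exact ⟨χ y, by rwa [Metric.mem_ball, dist_eq_norm], χ.left_inv h2⟩

/-- The coordinate segment is carried back to Z by χ⁻¹ with its length unchanged; l₂ ≥ 1/2 keeps the
ball inside the chart. -/
theorem image_subset_geodesicBall (hχ : IsDiffeo χ) (hs : χ.target = Metric.ball 0 s)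
    (hsource : χ.source ⊆ Z) (hZ : IsOpen Z) (hM : IsMetricOn M Z)
    (hN : NormBoundsOn (changeCoords M χ.symm) (Metric.ball 0 s) l₁ l₂) (hl : 1 / 2 ≤ l₂)
    (hz : z ∈ χ.source) (hρ : 0 < ρ) (hzρ : ‖χ z‖ + 2 * ρ ≤ s) :
    χ.symm '' Metric.ball (χ z) (ρ / l₂) ⊆ geodesicBall M Z z ρ := by
  rintro _ ⟨w, hw, rfl⟩
  have hf := hχ.isCoordChange hZ hsource
  rw [hs] at hf
  have hl0 : 0 < l₂ := by linarith
  have hχz : χ z ∈ Metric.ball (0 : Euc d) s := hs ▸ χ.map_source hz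
  have hwV : w ∈ Metric.ball (0 : Euc d) s := by
    have h1 : ρ / l₂ ≤ 2 * ρ := by rw [div_le_iff₀ hl0]; nlinarith
    rw [Metric.mem_ball, dist_eq_norm] at hw
    rw [mem_ball_zero_iff]
    have := norm_add_le (w - χ z) (χ z)
    rw [sub_add_cancel] at this
    linarith
  obtain ⟨c, hc, hlen⟩ := hN.subset_geodesicBall hl0
    (hf.isMetricOn hM).contDiffOn_metricForm.continuousOn (convex_ball _ _) hχz ρ ⟨hw, hwV⟩
  obtain ⟨h1, h2⟩ := hf.comp_curve (M := M) hc
  rw [χ.left_inv hz] at h1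
  exact ⟨_, h1, h2 ▸ hlen⟩

/-- Geodesic balls are open. -/
theorem isOpen_geodesicBall (hZ : IsOpen Z) (hM : ContinuousMetricOn M Z) (z : Euc d) (ρ : ℝ) :
    IsOpen (geodesicBall M Z z ρ) := by
  rw [Metric.isOpen_iff]
  rintro w ⟨c, hc, hlen⟩
  have hcont := hc.contDiffOn.continuousOn
  have hcont' := hc.contDiffOn.continuousOn_derivWithin (uniqueDiffOn_Icc zero_lt_one) le_rfl
  obtain ⟨δ₀, hδ₀, hsub⟩ := (isCompact_Icc.image_of_continuousOn hcont).exists_cthickening_subset_open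
    hZ (Set.image_subset_iff.2 hc.mapsTo)
  have hmem : ∀ h ∈ Metric.closedBall (0 : Euc d) δ₀, ∀ t ∈ Set.Icc (0 : ℝ) 1,
      c t + t • h ∈ Z := by
    intro h hh t ht
    refine hsub (Metric.mem_cthickening_of_dist_le _ (c t) _ _ ⟨t, ht, rfl⟩ ?_)
    rw [dist_eq_norm, add_sub_cancel_left, norm_smul, Real.norm_of_nonneg ht.1]
    exact (mul_le_of_le_one_left (norm_nonneg _) ht.2).trans (mem_closedBall_zero_iff.1 hh)
  -- The curve c(t) + th ends at w + h. Its speed F(h, t) is uniformly continuous on a compact set,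
  -- so a small h lengthens c by at most half of the slack ρ - length.
  let F : Euc d × ℝ → ℝ := fun q =>
    metricNorm M (c q.2 + q.2 • q.1) (derivWithin c (Set.Icc 0 1) q.2 + q.1)
  set S := Metric.closedBall (0 : Euc d) δ₀ ×ˢ Set.Icc (0 : ℝ) 1 with hS
  have hsnd : Set.MapsTo Prod.snd S (Set.Icc (0 : ℝ) 1) := fun q hq => hq.2
  have hF : ContinuousOn F S :=
    hM.metricNorm
      ((hcont.comp continuous_snd.continuousOn hsnd).add (by fun_prop))
      ((hcont'.comp continuous_snd.continuousOn hsnd).add continuous_fst.continuousOn)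
      fun q hq => hmem q.1 hq.1 q.2 hq.2
  have huc := ((isCompact_closedBall (0 : Euc d) δ₀).prod isCompact_Icc).uniformContinuousOn_of_continuous hF
  obtain ⟨δ, hδ, hδF⟩ := Metric.uniformContinuousOn_iff.1 huc ((ρ - curveLength M c) / 2)
    (by linarith)
  refine ⟨min δ δ₀, lt_min hδ hδ₀, fun w' hw' => ?_⟩
  have hn : ‖w' - w‖ < min δ δ₀ := by rwa [Metric.mem_ball, dist_eq_norm] at hw'
  set h := w' - w with hh
  have hhS : h ∈ Metric.closedBall (0 : Euc d) δ₀ :=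
    mem_closedBall_zero_iff.2 (hn.le.trans (min_le_right _ _))
  have hder : ∀ t ∈ Set.Icc (0 : ℝ) 1, derivWithin (fun t => c t + t • h) (Set.Icc 0 1) t =
      derivWithin c (Set.Icc 0 1) t + h := by
    intro t ht
    have h1 := (hc.hasDerivWithinAt ht).add
      ((hasDerivWithinAt_id t (Set.Icc 0 1)).smul_const h)
    rw [one_smul] at h1
    exact h1.derivWithin (uniqueDiffOn_Icc zero_lt_one t ht)
  have hc' : IsCurve Z z w' (fun t => c t + t • h) := by
    refine ⟨hc.contDiffOn.add (by fun_prop), fun t ht => hmem h hhS t ht, ?_, ?_⟩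
    · simp [hc.source]
    · simp [hc.target, hh]
  refine ⟨_, hc', ?_⟩
  have hle : curveLength M (fun t => c t + t • h) ≤
      ∫ t in (0 : ℝ)..1, (curveSpeed M c t + (ρ - curveLength M c) / 2) := by
    have hint := (hc.continuousOn_speed hM).intervalIntegrable_of_Icc
      (μ := MeasureTheory.volume) zero_le_one
    refine intervalIntegral.integral_mono_on zero_le_one
      ((hc'.continuousOn_speed hM).intervalIntegrable_of_Icc zero_le_one)
      (hint.add (by simp)) fun t ht => ?_
    have h0S : (0 : Euc d) ∈ Metric.closedBall (0 : Euc d) δ₀ :=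
      Metric.mem_closedBall_self hδ₀.le
    have h1 := hδF (h, t) ⟨hhS, ht⟩ (0, t) ⟨h0S, ht⟩ (by
      rw [Prod.dist_eq, dist_self, max_eq_left dist_nonneg, dist_zero_right]
      exact hn.trans_le (min_le_left _ _))
    have h2 := (abs_lt.1 (Real.dist_eq _ _ ▸ h1)).2
    simp only [F, smul_zero, add_zero] at h2
    rw [curveSpeed, hder t ht, curveSpeed]
    linarith
  have hint := (hc.continuousOn_speed hM).intervalIntegrable_of_Icc
      (μ := MeasureTheory.volume) zero_le_one
  rw [intervalIntegral.integral_add hint (by simp)] at hle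
  have e1 : ∫ t in (0 : ℝ)..1, curveSpeed M c t = curveLength M c := rfl
  rw [e1, intervalIntegral.integral_const] at hle
  simp only [sub_zero, one_smul] at hle
  linarith

end Curves

/-! ### Riemannian volumes and the choice of small constants -/

section Volumes

open Topology MeasureTheory
open scoped InnerProductSpace

variable {d : ℕ} {M : Euc d → Matrix (Fin d) (Fin d) ℝ} {Z V : Set (Euc d)}

theorem det_fderiv_eq (f : Euc d → Euc d) (x : Euc d) :
    (fderiv ℝ f x).det = (jacobian f x).det := by
  rw [ContinuousLinearMap.det, ← LinearMap.det_toMatrix (EuclideanSpace.basisFun (Fin d) ℝ).toBasis]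
  congr 1

theorem volElt_changeCoords (f : Euc d → Euc d) (x : Euc d) :
    volElt (changeCoords M f) x = |(jacobian f x).det| * volElt M (f x) := by
  rw [volElt, volElt, changeCoords, Matrix.det_mul, Matrix.det_mul, Matrix.det_transpose,
    ← Real.sqrt_sq_eq_abs, ← Real.sqrt_mul (sq_nonneg _)]
  congr 1
  ring

theorem IsMetricOn.volElt_pos (h : IsMetricOn M Z) {z : Euc d} (hz : z ∈ Z) : 0 < volElt M z :=
  Real.sqrt_pos.2 (h.posDef z hz).det_pos

theorem IsMetricOn.contDiffOn_volElt (h : IsMetricOn M Z) : ContDiffOn ℝ ∞ (volElt M) Z :=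
  (contDiffOn_det h.smooth).sqrt fun z hz => (h.posDef z hz).det_pos.ne'

theorem riemVolume_mono {A B : Set (Euc d)} (h : A ⊆ B) : riemVolume M A ≤ riemVolume M B :=
  lintegral_mono_set h

/-- The change of variables formula for the Riemannian volume. -/
theorem IsCoordChange.riemVolume_image {f : Euc d → Euc d} (hf : IsCoordChange f V Z)
    {B : Set (Euc d)} (hB : MeasurableSet B) (hBV : B ⊆ V) (hinj : Set.InjOn f B) :
    riemVolume M (f '' B) = riemVolume (changeCoords M f) B := by
  rw [riemVolume, lintegral_image_eq_lintegral_abs_det_fderiv_mul _ hB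
    (fun x hx => (hf.hasFDerivAt (hBV hx)).hasFDerivWithinAt) hinj, riemVolume]
  refine lintegral_congr fun x => ?_
  rw [volElt_changeCoords, ENNReal.ofReal_mul (abs_nonneg _), det_fderiv_eq]

theorem riemVolume_le_of_volElt_le {B : Set (Euc d)} (hB : MeasurableSet B) {ν : ℝ}
    (h : ∀ w ∈ B, volElt M w ≤ ν) : riemVolume M B ≤ ENNReal.ofReal ν * volume B := by
  rw [riemVolume, ← setLIntegral_const]
  exact setLIntegral_mono' hB fun w hw => ENNReal.ofReal_le_ofReal (h w hw)

theorem le_riemVolume_of_le_volElt {B : Set (Euc d)} (hB : MeasurableSet B) {ν : ℝ}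
    (h : ∀ w ∈ B, ν ≤ volElt M w) : ENNReal.ofReal ν * volume B ≤ riemVolume M B := by
  rw [riemVolume, ← setLIntegral_const]
  exact setLIntegral_mono' hB fun w hw => ENNReal.ofReal_le_ofReal (h w hw)

theorem ofReal_mul_volume_ball {ν R : ℝ} (hν : 0 ≤ ν) (hR : 0 < R) (w : Euc d) :
    ENNReal.ofReal ν * volume (Metric.ball w R) =
      ENNReal.ofReal (ν * R ^ d) * volume (Metric.ball (0 : Euc d) 1) := by
  rw [Measure.addHaar_ball_of_pos _ _ hR, finrank_euclideanSpace_fin, ← mul_assoc,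
    ENNReal.ofReal_mul hν]

theorem metricNorm_conformalMetric {m : Euc d → ℝ} {w : Euc d} (hm : 0 ≤ m w) (v : Euc d) :
    metricNorm (conformalMetric m) w v = √(m w) * ‖v‖ := by
  have h : metricInner (conformalMetric m) w v v = m w * ‖v‖ ^ 2 := by
    rw [metricInner, EuclideanSpace.norm_sq_eq, Finset.mul_sum]
    refine Finset.sum_congr rfl fun i _ => ?_
    rw [Finset.sum_eq_single i]
    · simp [conformalMetric]; ring
    · intro j _ hj
      simp [conformalMetric, Matrix.one_apply_ne hj.symm]
    · simp
  rw [metricNorm, h, Real.sqrt_mul hm, Real.sqrt_sq (norm_nonneg _)]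

theorem volElt_conformalMetric {m : Euc d → ℝ} {w : Euc d} (hm : 0 ≤ m w) :
    volElt (conformalMetric m) w = √(m w) ^ d := by
  rw [volElt, conformalMetric, Matrix.det_smul, Matrix.det_one, mul_one, Fintype.card_fin,
    Real.sqrt_eq_iff_mul_self_eq (by positivity) (by positivity), ← mul_pow,
    Real.mul_self_sqrt hm]

theorem continuousMetricOn_conformalMetric {m : Euc d → ℝ} (hm : ContinuousOn m V) :
    ContinuousMetricOn (conformalMetric m) V := by
  refine (hm.smul continuousOn_const).congr (g := metricForm (conformalMetric m))
    (f := fun w => m w • metricForm (fun _ => 1) 0) fun w _ => ?_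
  simp [metricForm, conformalMetric, Finset.smul_sum, mul_smul]

/-- The metric `M` is almost Euclidean. -/
structure AlmostEuclideanOn (M : Euc d → Matrix (Fin d) (Fin d) ℝ) (V : Set (Euc d)) (η : ℝ) :
    Prop where
  bounds : NormBoundsOn M V (1 - η) (1 + η)
  entries : ∀ w ∈ V, ∀ i j, |M w i j - (1 : Matrix (Fin d) (Fin d) ℝ) i j| ≤ 3 * η
  volElt_mem : ∀ w ∈ V, volElt M w ∈ Set.Icc (1 - η) (1 + η)

/-- If `η` is small, then metrics that are `η`-almost Euclidean have all properties that are
asked for with error `ε`. -/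
structure IsSmallDistortion (d : ℕ) (ε η : ℝ) : Prop where
  pos : 0 < η
  lt_half : η < 1 / 2
  close : 6 * η ≤ ε * (1 - η) ^ 2
  straight : ((1 + η) / (1 - η)) ^ 2 - 1 ≤ 4 * ε ^ 2
  volume_lower : (1 - ε) * ((1 + η) * (1 / (1 - η)) ^ d) ≤ (1 - η) ^ d * (1 / (1 + η)) ^ d
  volume_upper : (1 + η) ^ d * (1 / (1 - η)) ^ d ≤ (1 + ε) * ((1 - η) * (1 / (1 + η)) ^ d)

theorem exists_isSmallDistortion (d : ℕ) {ε : ℝ} (hε : 0 < ε) : ∃ η, IsSmallDistortion d ε η := by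
  -- Apart from the bounds 0 < η < 1/2, all conditions are inequalities between functions continuous
  -- at η = 0 that are strict there.
  have hev : ∀ f g : ℝ → ℝ, ContinuousAt f 0 → ContinuousAt g 0 → f 0 < g 0 →
      ∀ᶠ η in 𝓝[>] (0 : ℝ), f η ≤ g η := fun f g hf hg h =>
    ((hf.eventually_lt hg h).mono fun _ => le_of_lt).filter_mono nhdsWithin_le_nhds
  have hc1 : ContinuousAt (fun η : ℝ => 1 / (1 - η)) 0 :=
    continuousAt_const.div (by fun_prop) (by norm_num)
  have hc2 : ContinuousAt (fun η : ℝ => 1 / (1 + η)) 0 :=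
    continuousAt_const.div (by fun_prop) (by norm_num)
  have h0 : ∀ᶠ η in 𝓝[>] (0 : ℝ), 0 < η := self_mem_nhdsWithin
  have h1 : ∀ᶠ η in 𝓝[>] (0 : ℝ), η < 1 / 2 :=
    nhdsWithin_le_nhds (Iio_mem_nhds (by norm_num : (0 : ℝ) < 1 / 2))
  have h2 := hev (fun η => 6 * η) (fun η => ε * (1 - η) ^ 2) (by fun_prop) (by fun_prop)
    (by simpa using hε)
  have h3 := hev (fun η => ((1 + η) / (1 - η)) ^ 2 - 1) (fun _ => 4 * ε ^ 2)
    (((ContinuousAt.div (by fun_prop) (by fun_prop) (by norm_num)).pow 2).sub continuousAt_const)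
    (by fun_prop) (by simp; positivity)
  have h4 := hev (fun η => (1 - ε) * ((1 + η) * (1 / (1 - η)) ^ d))
    (fun η => (1 - η) ^ d * (1 / (1 + η)) ^ d)
    (continuousAt_const.mul ((by fun_prop : ContinuousAt (fun η : ℝ => 1 + η) 0).mul (hc1.pow d)))
    ((by fun_prop : ContinuousAt (fun η : ℝ => (1 - η) ^ d) 0).mul (hc2.pow d)) (by simpa using hε)
  have h5 := hev (fun η => (1 + η) ^ d * (1 / (1 - η)) ^ d)
    (fun η => (1 + ε) * ((1 - η) * (1 / (1 + η)) ^ d))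
    ((by fun_prop : ContinuousAt (fun η : ℝ => (1 + η) ^ d) 0).mul (hc1.pow d))
    (continuousAt_const.mul ((by fun_prop : ContinuousAt (fun η : ℝ => 1 - η) 0).mul (hc2.pow d)))
    (by simpa using hε)
  obtain ⟨η, a0, a1, a2, a3, a4, a5⟩ :=
    (h0.and (h1.and (h2.and (h3.and (h4.and h5))))).exists
  exact ⟨η, a0, a1, a2, a3, a4, a5⟩

/-- Continuity of √det at the identity, read through the sup distance of the entries. -/
theorem exists_entries_volElt_bound (d : ℕ) {η : ℝ} (hη : 0 < η) :
    ∃ δ > 0, ∀ A : Matrix (Fin d) (Fin d) ℝ,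
      (∀ i j, |A i j - (1 : Matrix (Fin d) (Fin d) ℝ) i j| ≤ 3 * δ) →
        √A.det ∈ Set.Icc (1 - η) (1 + η) := by
  have hcont : Continuous fun A : Matrix (Fin d) (Fin d) ℝ => √A.det :=
    (continuous_id.matrix_det).sqrt
  have hmem : ∀ᶠ A in 𝓝 (1 : Matrix (Fin d) (Fin d) ℝ), √A.det ∈ Set.Icc (1 - η) (1 + η) := by
    refine hcont.continuousAt.eventually_mem ?_
    rw [Matrix.det_one, Real.sqrt_one]
    exact Icc_mem_nhds (by linarith) (by linarith)
  have hnhds : ∀ᶠ A : Fin d → Fin d → ℝ in 𝓝 (fun i j => (1 : Matrix (Fin d) (Fin d) ℝ) i j),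
    √(Matrix.of A).det ∈ Set.Icc (1 - η) (1 + η) := hmem
  obtain ⟨δ, hδ, hsub⟩ := Metric.eventually_nhds_iff.1 hnhds
  refine ⟨δ / 6, by positivity, fun A hA => ?_⟩
  refine hsub (y := fun i j => A i j) ?_
  refine (dist_pi_lt_iff hδ).2 fun i => (dist_pi_lt_iff hδ).2 fun j => ?_
  rw [Real.dist_eq]
  linarith [hA i j]

theorem metricForm_one (z u v : Euc d) :
    metricForm (fun _ => (1 : Matrix (Fin d) (Fin d) ℝ)) z u v = ⟪u, v⟫_ℝ := by
  rw [metricForm_apply, metricInner, PiLp.inner_apply]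
  refine Finset.sum_congr rfl fun i _ => ?_
  rw [Finset.sum_eq_single i]
  · simp [mul_comm]
  · intro j _ hj
    simp [hj.symm]
  · simp

/-- A metric that has an almost orthonormal frame is almost Euclidean. -/
theorem almostEuclideanOn_of_coframe {δ η : ℝ} (hδ : 0 ≤ δ) (hδη : δ ≤ η) (hη : η < 1 / 2)
    (hdet : ∀ A : Matrix (Fin d) (Fin d) ℝ,
      (∀ i j, |A i j - (1 : Matrix (Fin d) (Fin d) ℝ) i j| ≤ 3 * δ) →
        √A.det ∈ Set.Icc (1 - η) (1 + η))
    (hθ : ∀ x ∈ V, ∃ θ : Euc d →L[ℝ] Euc d,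
      (∀ u v, metricForm M x u v = ⟪θ u, θ v⟫_ℝ) ∧ ∀ w, ‖θ w - w‖ ≤ δ * ‖w‖) :
    AlmostEuclideanOn M V η := by
  have hentries : ∀ w ∈ V, ∀ i j, |M w i j - (1 : Matrix (Fin d) (Fin d) ℝ) i j| ≤ 3 * δ := by
    intro w hw i j
    obtain ⟨θ, hG, hclose⟩ := hθ w hw
    have hnorm : ∀ i : Fin d, ‖eucBasis i‖ = 1 := fun i => by simp
    -- Expansion of ⟪θeᵢ, θeⱼ⟫ around ⟪eᵢ, eⱼ⟫; the three terms are at most δ², δ and δ.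
    have h1 : M w i j - (1 : Matrix (Fin d) (Fin d) ℝ) i j =
        ⟪θ (eucBasis i) - eucBasis i, θ (eucBasis j) - eucBasis j⟫_ℝ +
        ⟪θ (eucBasis i) - eucBasis i, eucBasis j⟫_ℝ +
        ⟪eucBasis i, θ (eucBasis j) - eucBasis j⟫_ℝ := by
      rw [← metricForm_basis (M := M), ← metricForm_basis (M := fun _ => 1) w, metricForm_one, hG]
      simp only [inner_sub_left, inner_sub_right]
      ring
    have hi := hclose (eucBasis i)
    have hj := hclose (eucBasis j)
    rw [hnorm, mul_one] at hi hj
    rw [h1]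
    refine (abs_add_three _ _ _).trans ?_
    have a1 := (abs_real_inner_le_norm (θ (eucBasis i) - eucBasis i) (θ (eucBasis j) - eucBasis j))
    have a2 := (abs_real_inner_le_norm (θ (eucBasis i) - eucBasis i) (eucBasis j))
    have a3 := (abs_real_inner_le_norm (eucBasis i) (θ (eucBasis j) - eucBasis j))
    rw [hnorm] at a2 a3
    have a4 := mul_le_mul hi hj (norm_nonneg _) hδ
    nlinarith
  refine ⟨⟨by linarith, fun w hw v => ?_, fun w hw v => ?_⟩, fun w hw i j =>
    (hentries w hw i j).trans (by linarith), fun w hw => hdet _ (hentries w hw)⟩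
  all_goals
    obtain ⟨θ, hG, hclose⟩ := hθ w hw
    rw [metricNorm_eq, hG, real_inner_self_eq_norm_sq, Real.sqrt_sq (norm_nonneg _)]
    have h1 := hclose v
    have h2 := norm_sub_norm_le v (θ v)
    have h3 := norm_sub_norm_le (θ v) v
    rw [norm_sub_rev] at h2
    have h4 := mul_le_mul_of_nonneg_right hδη (norm_nonneg v)
    linarith

theorem jacobian_const_smul (a : ℝ) (w : Euc d) :
    jacobian (fun w : Euc d => a • w) w = a • (1 : Matrix (Fin d) (Fin d) ℝ) := by
  ext i j
  simp [jacobian, fderiv_const_smul_id, Matrix.one_apply, PiLp.single_apply]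

variable {χ : OpenPartialHomeomorph (Euc d) (Euc d)} {a s ε η ρ : ℝ}

section Scaled

variable (ha : 0 < a)

theorem volElt_scaledCoords (hχ : IsDiffeo χ) (hs : χ.target = Metric.ball 0 s) {w : Euc d}
    (hw : w ∈ Metric.ball 0 (a * s)) :
    a ^ d * volElt (changeCoords M (scaledCoords χ a ha).symm) w =
      volElt (changeCoords M χ.symm) (a⁻¹ • w) := by
  have h : volElt (changeCoords M (scaledCoords χ a ha).symm) w =
      volElt (changeCoords (changeCoords M χ.symm) fun w => a⁻¹ • w) w := by
    simp only [volElt, changeCoords_scaledCoords ha hχ hs hw]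
  rw [h, volElt_changeCoords, jacobian_const_smul, Matrix.det_smul, Matrix.det_one, mul_one,
    Fintype.card_fin, abs_of_pos (by positivity), ← mul_assoc, ← mul_pow, mul_inv_cancel₀ ha.ne',
    one_pow, one_mul]

theorem NormBoundsOn.scaledCoords {l₁ l₂ : ℝ} (hχ : IsDiffeo χ) (hs : χ.target = Metric.ball 0 s)
    (hN : NormBoundsOn (changeCoords M χ.symm) (Metric.ball 0 s) l₁ l₂) :
    NormBoundsOn (changeCoords M (scaledCoords χ a ha).symm) (Metric.ball 0 (a * s))
      (a⁻¹ * l₁) (a⁻¹ * l₂) := by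
  have ha' : 0 ≤ a⁻¹ := by positivity
  have h : ∀ w ∈ Metric.ball (0 : Euc d) (a * s), ∀ v,
      metricNorm (changeCoords M (_root_.scaledCoords χ a ha).symm) w v =
        a⁻¹ * metricNorm (changeCoords M χ.symm) (a⁻¹ • w) v := fun w hw v => by
    rw [metricNorm_eq, metricForm_scaledCoords ha hχ hs hw, Real.sqrt_mul (sq_nonneg _),
      Real.sqrt_sq ha', ← metricNorm_eq]
  refine ⟨mul_pos (inv_pos.2 ha) hN.pos, fun w hw v => ?_, fun w hw v => ?_⟩
  · rw [h w hw, mul_assoc]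
    exact mul_le_mul_of_nonneg_left (hN.lower _ ((isCoordChange_smul ha).mapsTo hw) v) ha'
  · rw [h w hw, mul_assoc]
    exact mul_le_mul_of_nonneg_left (hN.upper _ ((isCoordChange_smul ha).mapsTo hw) v) ha'

end Scaled

end Volumes

/-! ### Conformally flat models and the comparison of ball volumes -/

section ConformalModel

open Topology MeasureTheory

variable {d : ℕ} {M : Euc d → Matrix (Fin d) (Fin d) ℝ} {Z V : Set (Euc d)}
  {χ : OpenPartialHomeomorph (Euc d) (Euc d)} {a s ε η ρ : ℝ} {p z : Euc d} {m : Euc d → ℝ}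

theorem ball_subset_ball_zero {w : Euc d} {R R' : ℝ} (hR : R ≤ R') (h : ‖w‖ + R' ≤ s) :
    Metric.ball w R ⊆ Metric.ball 0 s :=
  Metric.ball_subset_ball' (by rw [dist_zero_right]; linarith)

theorem IsNormalCoords.isCoordChange (hχ : IsNormalCoords M Z p s χ) (hZ : IsOpen Z) :
    IsCoordChange χ.symm (Metric.ball 0 s) Z := by
  have := hχ.isDiffeo.isCoordChange hZ hχ.source_subset
  rwa [hχ.target_eq] at this

theorem IsNormalCoords.riemVolume_image_ball (hχ : IsNormalCoords M Z p s χ) (hZ : IsOpen Z)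
    {w : Euc d} {R : ℝ} (hR : Metric.ball w R ⊆ Metric.ball 0 s) :
    riemVolume M (χ.symm '' Metric.ball w R) =
      riemVolume (changeCoords M χ.symm) (Metric.ball w R) :=
  (hχ.isCoordChange hZ).riemVolume_image Metric.isOpen_ball.measurableSet hR
    (χ.symm.injOn.mono (by rw [χ.symm_source, hχ.target_eq]; exact hR))

/-- Volume of the enclosing coordinate ball times the largest volume element; the next lemma uses
the enclosed ball and the smallest one. -/
theorem IsNormalCoords.riemVolume_geodesicBall_le (hχ : IsNormalCoords M Z p s χ) (hZ : IsOpen Z)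
    (hM : IsMetricOn M Z) (hg : AlmostEuclideanOn (changeCoords M χ.symm) (Metric.ball 0 s) η)
    (hη : 0 < η) (hη' : η < 1 / 2) (hz : z ∈ χ.source) (hρ : 0 < ρ) (hzρ : ‖χ z‖ + 2 * ρ ≤ s) :
    riemVolume M (geodesicBall M Z z ρ) ≤
      ENNReal.ofReal ((1 + η) * (ρ / (1 - η)) ^ d) * volume (Metric.ball (0 : Euc d) 1) := by
  have h0 : 0 < 1 - η := by linarith
  have hsub : Metric.ball (χ z) (ρ / (1 - η)) ⊆ Metric.ball 0 s :=
    ball_subset_ball_zero (by rw [div_le_iff₀ h0]; nlinarith) hzρ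
  rw [← ofReal_mul_volume_ball (by linarith) (by positivity) (χ z)]
  refine (riemVolume_mono (geodesicBall_subset_image hχ.isDiffeo hχ.target_eq hM hg.bounds
    (by linarith) hz hρ hzρ)).trans ?_
  rw [hχ.riemVolume_image_ball hZ hsub]
  exact riemVolume_le_of_volElt_le Metric.isOpen_ball.measurableSet
    fun w hw => (hg.volElt_mem w (hsub hw)).2

theorem IsNormalCoords.le_riemVolume_geodesicBall (hχ : IsNormalCoords M Z p s χ) (hZ : IsOpen Z)
    (hM : IsMetricOn M Z) (hg : AlmostEuclideanOn (changeCoords M χ.symm) (Metric.ball 0 s) η)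
    (hη : 0 < η) (hη' : η < 1 / 2) (hz : z ∈ χ.source) (hρ : 0 < ρ) (hzρ : ‖χ z‖ + 2 * ρ ≤ s) :
    ENNReal.ofReal ((1 - η) * (ρ / (1 + η)) ^ d) * volume (Metric.ball (0 : Euc d) 1) ≤
      riemVolume M (geodesicBall M Z z ρ) := by
  have hsub : Metric.ball (χ z) (ρ / (1 + η)) ⊆ Metric.ball 0 s :=
    ball_subset_ball_zero (by rw [div_le_iff₀ (by linarith)]; nlinarith) hzρ
  rw [← ofReal_mul_volume_ball (by linarith) (by positivity) (χ z)]
  refine le_trans ?_ (riemVolume_mono (image_subset_geodesicBall hχ.isDiffeo hχ.target_eq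
    hχ.source_subset hZ hM hg.bounds (by linarith) hz hρ hzρ))
  rw [hχ.riemVolume_image_ball hZ hsub]
  exact le_riemVolume_of_le_volElt Metric.isOpen_ball.measurableSet
    fun w hw => (hg.volElt_mem w (hsub hw)).1

theorem normBoundsOn_conformalMetric (ha : 0 < a) (hη' : η < 1)
    (hm : ∀ w ∈ V, 0 < m w ∧ a * √(m w) ∈ Set.Icc (1 - η) (1 + η)) :
    NormBoundsOn (conformalMetric m) V (a⁻¹ * (1 - η)) (a⁻¹ * (1 + η)) := by
  refine ⟨mul_pos (inv_pos.2 ha) (by linarith), fun w hw v => ?_, fun w hw v => ?_⟩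
  all_goals
    obtain ⟨h0, h1, h2⟩ := hm w hw
    rw [metricNorm_conformalMetric h0.le]
    refine mul_le_mul_of_nonneg_right ?_ (norm_nonneg v)
  · rw [inv_mul_le_iff₀ ha]; exact h1
  · rw [le_inv_mul_iff₀ ha]; exact h2

/-- No condition on the centre is needed, as intersecting with the domain only decreases the volume.
The factors a cancel, so the bound is the same for every scale. -/
theorem riemVolume_geodesicBall_conformalMetric_le (ha : 0 < a) (hη' : η < 1 / 2)
    (hm : ∀ w ∈ Metric.ball (0 : Euc d) (a * s),
      0 < m w ∧ a * √(m w) ∈ Set.Icc (1 - η) (1 + η))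
    (hcont : ContinuousOn m (Metric.ball 0 (a * s))) (hη : 0 < η) (hρ : 0 < ρ) (x : Euc d) :
    riemVolume (conformalMetric m)
        (geodesicBall (conformalMetric m) (Metric.ball 0 (a * s)) x ρ) ≤
      ENNReal.ofReal ((1 + η) ^ d * (ρ / (1 - η)) ^ d) * volume (Metric.ball (0 : Euc d) 1) := by
  have h0 : 0 < 1 - η := by linarith
  have hN := normBoundsOn_conformalMetric ha (by linarith) hm
  have e : (1 + η) ^ d * (ρ / (1 - η)) ^ d =
      (a⁻¹ * (1 + η)) ^ d * (ρ / (a⁻¹ * (1 - η))) ^ d := by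
    rw [← mul_pow, ← mul_pow]
    congr 1
    field_simp
  rw [e, ← ofReal_mul_volume_ball (by positivity) (by positivity) x]
  refine (riemVolume_mono (hN.geodesicBall_subset
    (continuousMetricOn_conformalMetric hcont) x ρ)).trans ?_
  refine (riemVolume_le_of_volElt_le (Metric.isOpen_ball.inter Metric.isOpen_ball).measurableSet
    (ν := (a⁻¹ * (1 + η)) ^ d) fun w hw => ?_).trans ?_
  · obtain ⟨h0, h1, h2⟩ := hm w hw.2
    rw [volElt_conformalMetric h0.le]
    gcongr
    rw [le_inv_mul_iff₀ ha]; exact h2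
  · gcongr
    exact Set.inter_subset_left

/-- Here the comparison ball has to lie in the domain; this is the condition on x and ρ multiplied
by a. -/
theorem le_riemVolume_geodesicBall_conformalMetric (ha : 0 < a) (hη' : η < 1 / 2)
    (hm : ∀ w ∈ Metric.ball (0 : Euc d) (a * s),
      0 < m w ∧ a * √(m w) ∈ Set.Icc (1 - η) (1 + η))
    (hcont : ContinuousOn m (Metric.ball 0 (a * s))) (hη : 0 < η) (hρ : 0 < ρ) {x : Euc d}
    (hx : ‖x‖ + 2 * ρ ≤ s) :
    ENNReal.ofReal ((1 - η) ^ d * (ρ / (1 + η)) ^ d) * volume (Metric.ball (0 : Euc d) 1) ≤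
      riemVolume (conformalMetric m)
        (geodesicBall (conformalMetric m) (Metric.ball 0 (a * s)) (a • x) ρ) := by
  have h0 : 0 < 1 - η := by linarith
  have hN := normBoundsOn_conformalMetric ha (by linarith) hm
  have e : (1 - η) ^ d * (ρ / (1 + η)) ^ d =
      (a⁻¹ * (1 - η)) ^ d * (ρ / (a⁻¹ * (1 + η))) ^ d := by
    rw [← mul_pow, ← mul_pow]
    congr 1
    field_simp
  have hax : ‖a • x‖ + a * (2 * ρ) ≤ a * s := by
    rw [norm_smul, Real.norm_of_nonneg ha.le, ← mul_add]
    exact mul_le_mul_of_nonneg_left hx ha.le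
  have hsub : Metric.ball (a • x) (ρ / (a⁻¹ * (1 + η))) ⊆ Metric.ball 0 (a * s) := by
    refine ball_subset_ball_zero ?_ hax
    rw [div_le_iff₀ (by positivity)]
    have : a * (2 * ρ) * (a⁻¹ * (1 + η)) = 2 * ρ * (1 + η) := by field_simp
    rw [this]
    nlinarith
  rw [e, ← ofReal_mul_volume_ball (by positivity) (by positivity) (a • x)]
  refine le_trans ?_ (riemVolume_mono fun y hy => hN.subset_geodesicBall (by positivity)
    (continuousMetricOn_conformalMetric hcont) (convex_ball _ _)
    (hsub (Metric.mem_ball_self (by positivity))) ρ ⟨hy, hsub hy⟩)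
  refine le_riemVolume_of_le_volElt Metric.isOpen_ball.measurableSet fun w hw => ?_
  obtain ⟨h0, h1, h2⟩ := hm w (hsub hw)
  rw [volElt_conformalMetric h0.le]
  gcongr
  rw [inv_mul_le_iff₀ ha]; exact h1

/-- If the metric is almost Euclidean in normal coordinates, then each conformally flat metric
whose factor is almost constant is a conformal model. -/
theorem IsNormalCoords.isConformalModel (ha : 0 < a) (hχ : IsNormalCoords M Z p s χ)
    (hZ : IsOpen Z) (hM : IsMetricOn M Z) (hε : 0 < ε) (hη : IsSmallDistortion d ε η)
    (hg : AlmostEuclideanOn (changeCoords M χ.symm) (Metric.ball 0 s) η)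
    (hsmooth : ContDiffOn ℝ ∞ m (Metric.ball 0 (a * s)))
    (hm : ∀ w ∈ Metric.ball (0 : Euc d) (a * s),
      0 < m w ∧ a * √(m w) ∈ Set.Icc (1 - η) (1 + η)) :
    IsConformalModel M Z s χ (scaledCoords χ a ha) ε m := by
  have htarget := scaledCoords_target ha hχ.target_eq
  have hη0 := hη.pos
  have hη1 := hη.lt_half
  have hη2 : 0 < 1 - η := by linarith
  have hN := normBoundsOn_conformalMetric ha (by linarith) hm
  refine ⟨htarget ▸ hsmooth, fun w hw => (hm w (htarget ▸ hw)).1, fun w hw i j => ?_, ?_,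
    fun z hz ρ hρ hzρ => ?_⟩
  · rw [htarget] at hw
    obtain ⟨h0, h1, h2⟩ := hm w hw
    have e1 : changeCoords M (scaledCoords χ a ha).symm w i j =
        (a⁻¹) ^ 2 * changeCoords M χ.symm (a⁻¹ • w) i j := by
      rw [← metricForm_basis (M := changeCoords M (scaledCoords χ a ha).symm),
        metricForm_scaledCoords ha hχ.isDiffeo hχ.target_eq hw, metricForm_basis]
    -- In unscaled coordinates the conformal factor is q². The entries of the metric are off the
    -- identity by 3η, and so is q², which gives 6η ≤ ε(1 - η)² ≤ εq².
    have e2 : m w = (a⁻¹) ^ 2 * (a * √(m w)) ^ 2 := by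
      rw [mul_pow, Real.sq_sqrt h0.le]
      field_simp
    set q := a * √(m w)
    have h3 := hg.entries _ ((isCoordChange_smul ha).mapsTo hw) i j
    have h4 : |changeCoords M χ.symm (a⁻¹ • w) i j -
        q ^ 2 * (1 : Matrix (Fin d) (Fin d) ℝ) i j| ≤ ε * q ^ 2 := by
      have h5 : |(1 - q ^ 2) * (1 : Matrix (Fin d) (Fin d) ℝ) i j| ≤ 3 * η := by
        have h6 : |1 - q ^ 2| ≤ 3 * η := by rw [abs_le]; constructor <;> nlinarith
        have h7 : |(1 : Matrix (Fin d) (Fin d) ℝ) i j| ≤ 1 := by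
          rw [Matrix.one_apply]; split_ifs <;> simp
        rw [abs_mul]
        exact (mul_le_mul h6 h7 (abs_nonneg _) (by positivity)).trans (by simp)
      have h8 := abs_add_le (changeCoords M χ.symm (a⁻¹ • w) i j -
        (1 : Matrix (Fin d) (Fin d) ℝ) i j) ((1 - q ^ 2) * (1 : Matrix (Fin d) (Fin d) ℝ) i j)
      have h9 : (1 - η) ^ 2 ≤ q ^ 2 := by gcongr
      have h10 := mul_le_mul_of_nonneg_left h9 hε.le
      have h11 := hη.close
      refine le_trans (le_of_eq ?_) (h8.trans (by linarith))
      congr 1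
      ring
    rw [conformalMetric, Matrix.smul_apply, smul_eq_mul, e1, e2, mul_assoc, ← mul_sub, abs_mul,
      abs_of_nonneg (sq_nonneg a⁻¹), mul_left_comm]
    exact mul_le_mul_of_nonneg_left h4 (sq_nonneg _)
  · rw [htarget]
    refine hN.shortestPathsNearlyStraight
      (continuousMetricOn_conformalMetric hsmooth.continuousOn) (convex_ball _ _) hε.le ?_
    rw [mul_div_mul_left _ _ (inv_ne_zero ha.ne')]
    exact hη.straight
  · rw [htarget, scaledCoords_apply]
    have u1 := hχ.riemVolume_geodesicBall_le hZ hM hg hη0 hη1 hz hρ hzρ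
    have u2 := hχ.le_riemVolume_geodesicBall hZ hM hg hη0 hη1 hz hρ hzρ
    have u3 := riemVolume_geodesicBall_conformalMetric_le ha hη1 hm hsmooth.continuousOn hη0 hρ
      (a • χ z)
    have u4 := le_riemVolume_geodesicBall_conformalMetric ha hη1 hm hsmooth.continuousOn hη0 hρ hzρ
    constructor
    · refine (mul_le_mul_right u1 _).trans (le_trans ?_ u4)
      rw [← mul_assoc, ← ENNReal.ofReal_mul' (by positivity)]
      refine mul_le_mul_left (ENNReal.ofReal_le_ofReal ?_) _
      calc (1 - ε) * ((1 + η) * (ρ / (1 - η)) ^ d)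
          = ((1 - ε) * ((1 + η) * (1 / (1 - η)) ^ d)) * ρ ^ d := by
            rw [div_eq_mul_one_div ρ, mul_pow]; ring
        _ ≤ ((1 - η) ^ d * (1 / (1 + η)) ^ d) * ρ ^ d :=
            mul_le_mul_of_nonneg_right hη.volume_lower (by positivity)
        _ = (1 - η) ^ d * (ρ / (1 + η)) ^ d := by
            rw [div_eq_mul_one_div ρ (1 + η), mul_pow]; ring
    · refine u3.trans (le_trans ?_ (mul_le_mul_right u2 _))
      rw [← mul_assoc, ← ENNReal.ofReal_mul' (by positivity)]
      refine mul_le_mul_left (ENNReal.ofReal_le_ofReal ?_) _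
      calc (1 + η) ^ d * (ρ / (1 - η)) ^ d
          = ((1 + η) ^ d * (1 / (1 - η)) ^ d) * ρ ^ d := by
            rw [div_eq_mul_one_div ρ, mul_pow]; ring
        _ ≤ ((1 + ε) * ((1 - η) * (1 / (1 + η)) ^ d)) * ρ ^ d :=
            mul_le_mul_of_nonneg_right hη.volume_upper (by positivity)
        _ = (1 + ε) * ((1 - η) * (ρ / (1 + η)) ^ d) := by
            rw [div_eq_mul_one_div ρ (1 + η), mul_pow]; ring

/-- A factor m has volume element m^(d/2), so m = x^(2/d) realises the volume element x. -/
theorem sqrt_rpow_two_div_pow (hd : 0 < d) {x : ℝ} (hx : 0 < x) : √(x ^ (2 / d : ℝ)) ^ d = x := by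
  have hd' : (d : ℝ) ≠ 0 := by exact_mod_cast hd.ne'
  rw [Real.sqrt_eq_rpow, ← Real.rpow_mul hx.le, ← Real.rpow_natCast, ← Real.rpow_mul hx.le]
  have : (2 / d : ℝ) * (1 / 2) * d = 1 := by field_simp
  rw [this, Real.rpow_one]

/-- The conformally flat metric with a prescribed volume element. -/
theorem IsNormalCoords.isConformalModel_of_volElt (ha : 0 < a)
    (hχ : IsNormalCoords M Z p s χ) (hZ : IsOpen Z) (hM : IsMetricOn M Z)
    (hε : 0 < ε) (hd : 0 < d) (hη : IsSmallDistortion d ε η)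
    (hg : AlmostEuclideanOn (changeCoords M χ.symm) (Metric.ball 0 s) η) {u : Euc d → ℝ}
    (hsmooth : ContDiffOn ℝ ∞ u (Metric.ball 0 (a * s)))
    (hu : ∀ w ∈ Metric.ball (0 : Euc d) (a * s),
      0 < u w ∧ a ^ d * u w ∈ Set.Icc (1 - η) (1 + η)) :
    ∃ m : Euc d → ℝ, (∀ w ∈ Metric.ball (0 : Euc d) (a * s), volElt (conformalMetric m) w = u w) ∧
      IsConformalModel M Z s χ (scaledCoords χ a ha) ε m := by
  have hη0 := hη.pos
  have hη1 := hη.lt_half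
  refine ⟨fun w => u w ^ (2 / d : ℝ), fun w hw => ?_, hχ.isConformalModel ha hZ hM hε hη hg
    (hsmooth.rpow_const_of_ne fun w hw => (hu w hw).1.ne') fun w hw => ?_⟩
  · have h0 := (hu w hw).1
    rw [volElt_conformalMetric (Real.rpow_nonneg h0.le _), sqrt_rpow_two_div_pow hd h0]
  · obtain ⟨h0, h1, h2⟩ := hu w hw
    have hpow : (a * √(u w ^ (2 / d : ℝ))) ^ d = a ^ d * u w := by
      rw [mul_pow, sqrt_rpow_two_div_pow hd h0]
    rw [← hpow] at h1 h2
    refine ⟨Real.rpow_pos_of_pos h0 _, ?_, ?_⟩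
    -- The bounds are known for the d-th power of a√m and pass to the root, since (1 - η)ᵈ ≤ 1 - η
    -- and 1 + η ≤ (1 + η)ᵈ for d ≥ 1.
    · refine le_of_pow_le_pow_left₀ hd.ne' (by positivity) (le_trans ?_ h1)
      exact pow_le_of_le_one (by linarith) (by linarith) hd.ne'
    · refine le_of_pow_le_pow_left₀ hd.ne' (by positivity) (h2.trans ?_)
      exact le_self_pow₀ (by linarith) hd.ne'

end ConformalModel

/-! ### Construction of the reparametrization -/

section Reparametrization

open Topology MeasureTheory

variable {d : ℕ} {M : Euc d → Matrix (Fin d) (Fin d) ℝ} {Z V : Set (Euc d)}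
  {φ χ : OpenPartialHomeomorph (Euc d) (Euc d)} {a s ε η κ κ' δ ρ : ℝ} {p z : Euc d}

theorem CurvatureBoundedOn.mono (h : CurvatureBoundedOn M Z κ) (hκ : κ ≤ κ') :
    CurvatureBoundedOn M Z κ' := fun z hz u v w x =>
  (h z hz u v w x).trans (by
    have := metricNorm_nonneg (M := M) z u
    have := metricNorm_nonneg (M := M) z v
    have := metricNorm_nonneg (M := M) z w
    have := metricNorm_nonneg (M := M) z x
    gcongr)

/-- A metric of small curvature is almost Euclidean in normal coordinates. -/
theorem IsNormalCoords.almostEuclideanOn (hχ : IsNormalCoords M Z p s χ) (hZ : IsOpen Z)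
    (hM : IsMetricOn M Z) (hR : CurvatureBoundedOn M Z κ) (hκ : 0 ≤ κ)
    (hκs : 2 * κ * s ^ 2 ≤ δ) (hδ : δ ≤ 1 / 24) (hδη : δ ≤ η) (hη : η < 1 / 2)
    (hdet : ∀ A : Matrix (Fin d) (Fin d) ℝ,
      (∀ i j, |A i j - (1 : Matrix (Fin d) (Fin d) ℝ) i j| ≤ 3 * δ) →
        √A.det ∈ Set.Icc (1 - η) (1 + η)) :
    AlmostEuclideanOn (changeCoords M χ.symm) (Metric.ball 0 s) η := by
  refine almostEuclideanOn_of_coframe (le_trans (by positivity) hκs) hδη hη hdet fun x hx => ?_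
  obtain ⟨θ, hG, hclose⟩ := ((hχ.isNormalMetric hZ hM hR).exists_coframe hχ.pos hκ
    (hκs.trans hδ)).1 x hx
  exact ⟨θ, hG, fun w => (hclose w).trans (mul_le_mul_of_nonneg_right hκs (norm_nonneg w))⟩

theorem abs_det_jacobian_symm_mul (hφ : IsDiffeo φ) (hz : z ∈ φ.source) :
    |(jacobian φ.symm (φ z)).det| * |(jacobian φ z).det| = 1 := by
  have h1 := hasFDerivAt_of_contDiffOn φ.open_target hφ.smooth_symm (φ.map_source hz)
  have h2 := hasFDerivAt_of_contDiffOn φ.open_source hφ.smooth hz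
  have h3 := ((h1.comp z h2).congr_of_eventuallyEq (f₁ := id) (by
    filter_upwards [φ.open_source.mem_nhds hz] with w hw
    exact (φ.left_inv hw).symm)).unique (hasFDerivAt_id z)
  have h4 := congrArg ContinuousLinearMap.det h3
  have h5 : (ContinuousLinearMap.id ℝ (Euc d)).det = 1 := LinearMap.det_id
  have h6 : (fderiv ℝ φ.symm (φ z) ∘L fderiv ℝ φ z).det =
      (fderiv ℝ φ.symm (φ z)).det * (fderiv ℝ φ z).det := LinearMap.det_comp _ _
  rw [h5, h6, det_fderiv_eq, det_fderiv_eq] at h4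
  rw [← abs_mul, h4, abs_one]

theorem riemVolume_congr {M' : Euc d → Matrix (Fin d) (Fin d) ℝ} {B : Set (Euc d)}
    (hB : MeasurableSet B) (h : ∀ w ∈ B, volElt M w = volElt M' w) :
    riemVolume M B = riemVolume M' B :=
  setLIntegral_congr_fun hB fun w hw => by rw [h w hw]

/-- A metric with the volume element of `M` in the coordinates `φ` measures volumes like `M`. -/
theorem IsDiffeo.riemVolume_image_of_volElt_eq (hφ : IsDiffeo φ) (hZ : IsOpen Z)
    (hs : φ.source ⊆ Z) {M' : Euc d → Matrix (Fin d) (Fin d) ℝ}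
    (hM' : ∀ w ∈ φ.target, volElt M' w = volElt (changeCoords M φ.symm) w) {B : Set (Euc d)}
    (hB : IsOpen B) (hBs : B ⊆ φ.source) : riemVolume M' (φ '' B) = riemVolume M B := by
  have hsub : φ '' B ⊆ φ.target := Set.image_subset_iff.2 fun z hz => φ.map_source (hBs hz)
  have hmeas := (φ.isOpen_image_of_subset_source hB hBs).measurableSet
  rw [riemVolume_congr hmeas fun w hw => hM' w (hsub hw),
    ← (hφ.isCoordChange hZ hs).riemVolume_image hmeas hsub (φ.symm.injOn.mono hsub),
    Set.image_image, Set.image_congr fun z hz => φ.left_inv (hBs hz), Set.image_id']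

/-- Let `M` be a metric of small curvature and almost constant volume element. Then normal
coordinates, suitably rescaled, make the geodesics nearly straight, and there are conformally flat
metrics close to `M` in these coordinates. -/
theorem exists_conformal_reparametrization (hd : 0 < d) (hε : 0 < ε) {r : ℝ} (hr : 0 < r) :
    ∃ κ₀ : ℝ, 0 < κ₀ ∧ ∀ m₁ : ℝ, 0 < m₁ → ∃ δ₀ : ℝ, 0 < δ₀ ∧
      ∀ (M : Euc d → Matrix (Fin d) (Fin d) ℝ) (Z : Set (Euc d)), IsOpen Z → IsMetricOn M Z →
        ∀ κ m₂ : ℝ, κ ≤ κ₀ → CurvatureBoundedOn M Z κ → |m₂ - m₁| ≤ δ₀ →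
        (∀ z ∈ Z, m₁ ≤ volElt M z ∧ volElt M z ≤ m₂) →
        ∀ p s χ, s ≤ r → IsNormalCoords M Z p s χ →
          ∃ (a : ℝ) (φ : OpenPartialHomeomorph (Euc d) (Euc d)),
            0 < a ∧ IsDiffeo φ ∧ φ.source = χ.source ∧ (∀ z ∈ χ.source, φ z = a • χ z) ∧
            ShortestPathsNearlyStraight (changeCoords M φ.symm) φ.target ε ∧
            GeodesicsNearlyStraight (changeCoords M φ.symm) φ.target ε ∧
            (∃ m : Euc d → ℝ,
              (∀ z ∈ φ.source, volElt (conformalMetric m) (φ z) = volElt M z) ∧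
              IsConformalModel M Z s χ φ ε m) ∧
            (∃ m : Euc d → ℝ,
              (∀ z ∈ φ.source,
                volElt (conformalMetric m) (φ z) * |(jacobian φ z).det| = volElt M z) ∧
              (∀ z ∈ χ.source, ∀ ρ : ℝ, 0 < ρ → ‖χ z‖ + 2 * ρ ≤ s →
                riemVolume (conformalMetric m) (φ '' geodesicBall M Z z ρ) =
                  riemVolume M (geodesicBall M Z z ρ)) ∧
              IsConformalModel M Z s χ φ ε m) := by
  obtain ⟨η, hη⟩ := exists_isSmallDistortion d hε
  have hη0 := hη.pos
  have hη1 := hη.lt_half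
  obtain ⟨δ₁, hδ₁, hdet₁⟩ := exists_entries_volElt_bound d hη0
  obtain ⟨δ, hδ, hδδ₁, hδη, hδ24, hδε⟩ : ∃ δ > 0, δ ≤ δ₁ ∧ δ ≤ η ∧ δ ≤ 1 / 24 ∧ 25 * δ ≤ ε := by
    refine ⟨min (min δ₁ η) (min (1 / 24) (ε / 25)), by positivity,
      (min_le_left _ _).trans (min_le_left _ _), (min_le_left _ _).trans (min_le_right _ _),
      (min_le_right _ _).trans (min_le_left _ _), ?_⟩
    have := (min_le_right (min δ₁ η) _).trans (min_le_right (1 / 24) (ε / 25))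
    linarith
  have hdet : ∀ A : Matrix (Fin d) (Fin d) ℝ,
      (∀ i j, |A i j - (1 : Matrix (Fin d) (Fin d) ℝ) i j| ≤ 3 * δ) →
        √A.det ∈ Set.Icc (1 - η) (1 + η) := fun A hA =>
    hdet₁ A fun i j => (hA i j).trans (by linarith)
  -- The choice of κ₀ gives 2κ₀s² ≤ δ for all s ≤ r; δ₀ = ηm₁ keeps the quotient of the volume
  -- element by m₁ in [1, 1 + η].
  refine ⟨δ / (2 * r ^ 2), by positivity, fun m₁ hm₁ => ⟨η * m₁, by positivity, ?_⟩⟩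
  intro M Z hZ hM κ m₂ hκ hR' hm₂ hvol p s χ hsr hχ
  -- The given κ need not be nonnegative, so the estimates are made with κ₀.
  have hR := hR'.mono hκ
  set κ₀ := δ / (2 * r ^ 2) with hκ₀
  have hκ₀0 : 0 ≤ κ₀ := by positivity
  have hs := hχ.pos
  have hκs : 2 * κ₀ * s ^ 2 ≤ δ := by
    have h1 : 2 * κ₀ * r ^ 2 = δ := by rw [hκ₀]; field_simp
    rw [← h1]
    gcongr
  have hg := hχ.almostEuclideanOn hZ hM hR hκ₀0 hκs hδ24 hδη hη1 hdet
  -- The scale at which the metric, whose volume element in the new coordinates is about a⁻ᵈ,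
  -- matches the value m₁ of the original volume element.
  obtain ⟨a, ha, had⟩ : ∃ a : ℝ, 0 < a ∧ a ^ d = m₁⁻¹ :=
    ⟨m₁⁻¹ ^ ((d : ℝ)⁻¹), by positivity, Real.rpow_inv_natCast_pow (by positivity) hd.ne'⟩
  have htarget := scaledCoords_target ha hχ.target_eq
  have hsource := scaledCoords_source (χ := χ) ha
  have hφ := isDiffeo_scaledCoords ha hχ.isDiffeo hχ.target_eq
  set φ := scaledCoords χ a ha with hφdef
  have hφZ : φ.source ⊆ Z := hsource ▸ hχ.source_subset
  have hco := hφ.isCoordChange hZ hφZ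
  have hMφ := hco.isMetricOn hM
  refine ⟨a, φ, ha, hφ, hsource, fun z _ => scaledCoords_apply ha z, ?_,
    hχ.geodesicsNearlyStraight ha hZ hM hR hκ₀0 (hκs.trans hδ24) (by linarith), ?_, ?_⟩
  · rw [htarget] at hMφ ⊢
    refine (hg.bounds.scaledCoords ha hχ.isDiffeo hχ.target_eq).shortestPathsNearlyStraight
      hMφ.contDiffOn_metricForm.continuousOn (convex_ball _ _) hε.le ?_
    rw [mul_div_mul_left _ _ (inv_ne_zero ha.ne')]
    exact hη.straight
  -- Equal volume elements at corresponding points: the pinching between m₁ and m₂ enters only here.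
  · have hu : ∀ w ∈ Metric.ball (0 : Euc d) (a * s), 0 < volElt M (φ.symm w) ∧
        a ^ d * volElt M (φ.symm w) ∈ Set.Icc (1 - η) (1 + η) := by
      intro w hw
      have hwZ : φ.symm w ∈ Z := hco.mapsTo (htarget ▸ hw)
      obtain ⟨h1, h2⟩ := hvol _ hwZ
      refine ⟨hM.volElt_pos hwZ, ?_⟩
      rw [had, Set.mem_Icc, le_inv_mul_iff₀ hm₁, inv_mul_le_iff₀ hm₁]
      have := (abs_le.1 hm₂).2
      constructor <;> nlinarith
    obtain ⟨m, hm, hmodel⟩ := hχ.isConformalModel_of_volElt ha hZ hM hε hd hη hg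
      (u := fun w => volElt M (φ.symm w))
      (htarget ▸ hM.contDiffOn_volElt.comp hco.smooth hco.mapsTo) hu
    refine ⟨m, fun z hz => ?_, hmodel⟩
    rw [hm _ (htarget ▸ φ.map_source hz), φ.left_inv hz]
  -- Equal volume forms: aᵈ times the volume element is that in normal coordinates, close to 1 by
  -- the curvature bound alone, whatever the scale a is.
  · have hu : ∀ w ∈ Metric.ball (0 : Euc d) (a * s), 0 < volElt (changeCoords M φ.symm) w ∧
        a ^ d * volElt (changeCoords M φ.symm) w ∈ Set.Icc (1 - η) (1 + η) := by
      intro w hw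
      refine ⟨hMφ.volElt_pos (htarget ▸ hw), ?_⟩
      rw [volElt_scaledCoords ha hχ.isDiffeo hχ.target_eq hw]
      exact hg.volElt_mem _ ((isCoordChange_smul ha).mapsTo hw)
    obtain ⟨m, hm, hmodel⟩ := hχ.isConformalModel_of_volElt ha hZ hM hε hd hη hg
      (u := volElt (changeCoords M φ.symm)) (htarget ▸ hMφ.contDiffOn_volElt) hu
    refine ⟨m, fun z hz => ?_, fun z hz ρ hρ hzρ => ?_, hmodel⟩
    · rw [hm _ (htarget ▸ φ.map_source hz), volElt_changeCoords, φ.left_inv hz, mul_right_comm,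
        abs_det_jacobian_symm_mul hφ hz, one_mul]
    · refine hφ.riemVolume_image_of_volElt_eq hZ hφZ (fun w hw => hm w (htarget ▸ hw))
        (isOpen_geodesicBall hZ hM.contDiffOn_metricForm.continuousOn z ρ) ?_
      refine (geodesicBall_subset_image hχ.isDiffeo hχ.target_eq hM hg.bounds (by linarith) hz hρ
        hzρ).trans ?_
      rw [hsource]
      refine Set.image_subset_iff.2 fun w hw => χ.map_target ?_
      rw [hχ.target_eq]
      refine ball_subset_ball_zero ?_ hzρ hw
      rw [div_le_iff₀ (by linarith)]
      nlinarith

end Reparametrization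

/-! ### Existence of normal coordinates -/

section Existence

open Topology

variable {d : ℕ} {M : Euc d → Matrix (Fin d) (Fin d) ℝ} {Z : Set (Euc d)} {p : Euc d}

open scoped MatrixOrder in
/-- A positive definite bilinear form has an orthonormal basis. -/
theorem Matrix.PosDef.exists_transpose_mul_mul_eq_one {S : Matrix (Fin d) (Fin d) ℝ}
    (hS : S.PosDef) : ∃ A : Matrix (Fin d) (Fin d) ℝ, Aᵀ * S * A = 1 ∧ IsUnit A := by
  obtain ⟨B, hB⟩ := CStarAlgebra.nonneg_iff_eq_star_mul_self.mp hS.posSemidef.nonneg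
  have hB' : S = Bᵀ * B := by
    rw [hB, Matrix.star_eq_conjTranspose, Matrix.conjTranspose_eq_transpose_of_trivial]
  have hdet : IsUnit B.det := by
    have := hS.det_pos.ne'
    rw [hB', Matrix.det_mul] at this
    exact (right_ne_zero_of_mul this).isUnit
  refine ⟨B⁻¹, ?_, (Matrix.isUnit_nonsing_inv_iff).2 ((Matrix.isUnit_iff_isUnit_det B).2 hdet)⟩
  have h1 : B * B⁻¹ = 1 := Matrix.mul_nonsing_inv B hdet
  calc (B⁻¹)ᵀ * S * B⁻¹ = (B * B⁻¹)ᵀ * (B * B⁻¹) := by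
        rw [hB', Matrix.transpose_mul]; simp only [Matrix.mul_assoc]
    _ = 1 := by rw [h1]; simp

/-- A smooth map with invertible derivative is a diffeomorphism from a small ball onto its image. -/
theorem exists_isDiffeo_ball {f : Euc d → Euc d} (hf : ∀ᶠ v in 𝓝 (0 : Euc d), ContDiffAt ℝ ∞ f v)
    (hunit : IsUnit (fderiv ℝ f 0)) {W : Set (Euc d)} (hW : W ∈ 𝓝 (0 : Euc d)) {r : ℝ}
    (hr : 0 < r) : ∃ (s : ℝ) (F : OpenPartialHomeomorph (Euc d) (Euc d)), 0 < s ∧ s ≤ r ∧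
      Metric.ball 0 s ⊆ W ∧ F.source = Metric.ball 0 s ∧ (∀ v, F v = f v) ∧ IsDiffeo F := by
  have hf0 := hf.self_of_nhds
  obtain ⟨u, hu⟩ := id hunit
  have hder : HasFDerivAt f (ContinuousLinearEquiv.ofUnit u : Euc d →L[ℝ] Euc d) 0 := by
    change HasFDerivAt f (u : Euc d →L[ℝ] Euc d) 0
    rw [hu]; exact (hf0.differentiableAt (by simp)).hasFDerivAt
  let F₀ := hf0.toOpenPartialHomeomorph f hder (by simp)
  have hF₀ : ∀ v, F₀ v = f v := fun v => rfl
  have hmem : (0 : Euc d) ∈ F₀.source := hf0.mem_toOpenPartialHomeomorph_source hder (by simp)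
  have hcont : ContinuousAt (fderiv ℝ f) 0 := (hf0.fderiv_right (m := 0) (by simp)).continuousAt
  -- Invertibility of the derivative on the whole ball makes the inverse smooth on the whole image,
  -- not just at the image of 0.
  have hunits : ∀ᶠ v in 𝓝 (0 : Euc d), IsUnit (fderiv ℝ f v) :=
    hcont.eventually (Units.isOpen.mem_nhds hunit)
  obtain ⟨s₀, hs₀, hsub⟩ := Metric.mem_nhds_iff.1
    (Filter.inter_mem (Filter.inter_mem hW (F₀.open_source.mem_nhds hmem)) (hf.and hunits))
  refine ⟨min s₀ r, F₀.restrOpen (Metric.ball 0 (min s₀ r)) Metric.isOpen_ball, lt_min hs₀ hr,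
    min_le_right _ _, ?_⟩
  have hsub' : Metric.ball (0 : Euc d) (min s₀ r) ⊆ _ :=
    (Metric.ball_subset_ball (min_le_left _ _)).trans hsub
  refine ⟨fun v hv => (hsub' hv).1.1, ?_, hF₀, ?_⟩
  · rw [OpenPartialHomeomorph.restrOpen_source]
    exact Set.inter_eq_right.2 fun v hv => (hsub' hv).1.2
  · constructor
    · intro v hv
      exact (hsub' hv.2).2.1.contDiffWithinAt
    · intro y hy
      have hv := ((F₀.restrOpen _ Metric.isOpen_ball).map_target hy).2
      obtain ⟨h1, h2⟩ := (hsub' hv).2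
      obtain ⟨u', hu'⟩ := h2
      refine (OpenPartialHomeomorph.contDiffAt_symm _ hy (f₀' := ContinuousLinearEquiv.ofUnit u')
        ?_ h1).contDiffWithinAt
      change HasFDerivAt f (u' : Euc d →L[ℝ] Euc d) _
      rw [hu']
      exact (h1.differentiableAt (by simp)).hasFDerivAt

/-- Normal coordinates exist. -/
theorem IsMetricOn.exists_isNormalCoords (h : IsMetricOn M Z) (hZ : IsOpen Z) (hp : p ∈ Z) {r : ℝ}
    (hr : 0 < r) : ∃ s χ, s ≤ r ∧ IsNormalCoords M Z p s χ := by
  obtain ⟨R, hR, hRZ⟩ := Metric.isOpen_iff.1 hZ p hp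
  obtain ⟨e, δ, hδ, he, he0, hde, hgeo⟩ := exists_exponential_map hR
    ((h.contDiffOn_christoffelForm hZ).mono hRZ)
  obtain ⟨A, hA, hAunit⟩ := (h.posDef p hp).exists_transpose_mul_mul_eq_one
  -- The inverse chart is the exponential map after a linear map to an orthonormal basis at p, so
  -- that the metric there becomes the identity.
  let L : Euc d →L[ℝ] Euc d := Matrix.toEuclideanCLM (𝕜 := ℝ) A
  have hLball : ∀ᶠ v in 𝓝 (0 : Euc d), L v ∈ Metric.ball (0 : Euc d) δ := by
    refine L.continuous.continuousAt.eventually (Metric.isOpen_ball.mem_nhds ?_)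
    rw [map_zero]
    exact Metric.mem_ball_self hδ
  have hfder : HasFDerivAt (e ∘ L) L 0 := by
    have h1 : HasFDerivAt e (ContinuousLinearMap.id ℝ (Euc d)) (L 0) := by rwa [map_zero]
    exact (h1.comp 0 L.hasFDerivAt).congr_fderiv (ContinuousLinearMap.id_comp L)
  have hfd : fderiv ℝ (e ∘ L) 0 = L := hfder.fderiv
  have hunit : IsUnit (fderiv ℝ (e ∘ L) 0) := by
    rw [hfd]; exact hAunit.map (Matrix.toEuclideanCLM (n := Fin d) (𝕜 := ℝ))
  obtain ⟨s, F, hs, hsr, hsW, hFs, hFe, hF⟩ := exists_isDiffeo_ball (f := e ∘ L)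
    (hLball.mono fun v hv => (he _ hv).comp v L.contDiff.contDiffAt) hunit hLball hr
  have hFf : (F : Euc d → Euc d) = e ∘ L := funext hFe
  have hF0 : F 0 = p := by rw [hFe, Function.comp_apply, map_zero, he0]
  have h0 : (0 : Euc d) ∈ F.source := by rw [hFs]; exact Metric.mem_ball_self hs
  have hgeo' : ∀ v ∈ Metric.ball (0 : Euc d) s, ∃ w : ℝ → Euc d, ∀ t ∈ Set.Ioo (-1 : ℝ) 1,
      F (t • v) ∈ Metric.ball p R ∧ HasDerivAt (fun t : ℝ => F (t • v)) (w t) t ∧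
        HasDerivAt w (-(christoffelForm M (F (t • v)) (w t) (w t))) t := by
    intro v hv
    simpa only [hFf, Function.comp_apply, map_smul] using hgeo (L v) (hsW hv)
  refine ⟨s, F.symm, hsr, hs, ⟨hF.smooth_symm, hF.smooth⟩, ?_, hFs, ?_, ?_, ?_, ?_⟩
  · intro z hz
    have hv : F.symm z ∈ Metric.ball (0 : Euc d) s := hFs ▸ F.map_target hz
    -- The point z lies at an interior time of a slightly longer geodesic ray, and these rays are
    -- known to stay in a ball inside Z.
    obtain ⟨c, hc, hcv⟩ := exists_one_lt_mul_norm_lt hv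
    obtain ⟨w, hw⟩ := hgeo' _ hcv
    have h1 := (hw c⁻¹ ⟨by linarith [inv_pos.2 (zero_lt_one.trans hc)],
      inv_lt_one_of_one_lt₀ hc⟩).1
    rw [smul_smul, inv_mul_cancel₀ (by positivity), one_smul, F.right_inv hz] at h1
    exact hRZ h1
  · rw [← hF0]; exact F.map_source h0
  · rw [← hF0]; exact F.left_inv h0
  · have hjac : jacobian F 0 = A := by
      ext i j
      rw [jacobian, hFf, hfd]
      simp [L]
    rw [OpenPartialHomeomorph.symm_symm, changeCoords, hjac, hF0, hA]
  · intro v hv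
    obtain ⟨w, hw⟩ := hgeo' v hv
    rw [OpenPartialHomeomorph.symm_symm]
    have hsmooth : ContDiffOn ℝ 2 (fun t : ℝ => F (t • v)) (Set.Ioo (-1) 1) :=
      (hF.smooth.of_le (by exact_mod_cast ENat.LEInfty.out)).comp (by fun_prop) fun t ht =>
        hFs ▸ smul_mem_ball_of_symIcc hv ⟨t, Set.Ioo_subset_Icc_self ht⟩
    refine ⟨hsmooth, fun t ht k => ?_⟩
    have hd : deriv (fun t : ℝ => F (t • v)) =ᶠ[𝓝 t] w := by
      filter_upwards [isOpen_Ioo.mem_nhds ht] with τ hτ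
      exact (hw τ hτ).2.1.deriv
    rw [hd.deriv_eq, hd.self_of_nhds, (hw t ht).2.2.deriv, PiLp.neg_apply, christoffelForm_apply]

end Existence

/-! ### The pull-back metric and the conclusion -/

section PullbackMetric

variable {d n : ℕ} {μ σ : Euc d → Euc n} {Z : Set (Euc d)}

theorem contDiffOn_jacobian (hZ : IsOpen Z) (hμ : ContDiffOn ℝ ∞ μ Z) (i : Fin n) (j : Fin d) :
    ContDiffOn ℝ ∞ (fun z => jacobian μ z i j) Z :=
  (eucProj i).contDiff.comp_contDiffOn
    ((hμ.fderiv_of_isOpen hZ (m := ∞) (by simp)).clm_apply contDiffOn_const)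

theorem isMetricOn_pullbackMetric (hZ : IsOpen Z) (hμ : ContDiffOn ℝ ∞ μ Z)
    (hσ : ContDiffOn ℝ ∞ σ Z) (hpos : ∀ z ∈ Z, (pullbackMetric μ σ z).PosDef) :
    IsMetricOn (pullbackMetric μ σ) Z := by
  refine ⟨fun i j => ?_, hpos⟩
  simp only [pullbackMetric, Matrix.add_apply, Matrix.mul_apply, Matrix.transpose_apply]
  exact (ContDiffOn.sum fun k _ => (contDiffOn_jacobian hZ hμ k i).mul
    (contDiffOn_jacobian hZ hμ k j)).add (ContDiffOn.sum fun k _ =>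
    (contDiffOn_jacobian hZ hσ k i).mul (contDiffOn_jacobian hZ hσ k j))

end PullbackMetric

theorem mainTheorem2 (d : ℕ) (hd : 0 < d) (ε : ℝ) (hε : 0 < ε) (r : ℝ) (hr : 0 < r) :
    ∃ κ₀ : ℝ, 0 < κ₀ ∧ ∀ m₁ : ℝ, 0 < m₁ → ∃ δ₀ : ℝ, 0 < δ₀ ∧
      ∀ (n : ℕ) (Z : Set (Euc d)) (μ σ : Euc d → Euc n),
        IsOpen Z → ContDiffOn ℝ ∞ μ Z → ContDiffOn ℝ ∞ σ Z →
        (∀ z ∈ Z, (pullbackMetric μ σ z).PosDef) →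
        ∀ κ m₂ : ℝ, κ ≤ κ₀ → CurvatureBoundedOn (pullbackMetric μ σ) Z κ →
        |m₂ - m₁| ≤ δ₀ →
        (∀ z ∈ Z, m₁ ≤ volElt (pullbackMetric μ σ) z ∧ volElt (pullbackMetric μ σ) z ≤ m₂) →
        ∀ p ∈ Z,
          (∃ s χ, s ≤ r ∧ IsNormalCoords (pullbackMetric μ σ) Z p s χ) ∧
          ∀ s χ, s ≤ r → IsNormalCoords (pullbackMetric μ σ) Z p s χ →
            ∃ (a : ℝ) (φ : OpenPartialHomeomorph (Euc d) (Euc d)),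
              0 < a ∧ IsDiffeo φ ∧ φ.source = χ.source ∧ (∀ z ∈ χ.source, φ z = a • χ z) ∧
              ShortestPathsNearlyStraight (changeCoords (pullbackMetric μ σ) φ.symm) φ.target ε ∧
              GeodesicsNearlyStraight (changeCoords (pullbackMetric μ σ) φ.symm) φ.target ε ∧
              (∃ m : Euc d → ℝ,
                (∀ z ∈ φ.source,
                  volElt (conformalMetric m) (φ z) = volElt (pullbackMetric μ σ) z) ∧
                IsConformalModel (pullbackMetric μ σ) Z s χ φ ε m) ∧
              (∃ m : Euc d → ℝ,
                (∀ z ∈ φ.source,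
                  volElt (conformalMetric m) (φ z) * |(jacobian φ z).det| =
                    volElt (pullbackMetric μ σ) z) ∧
                (∀ z ∈ χ.source, ∀ ρ : ℝ, 0 < ρ → ‖χ z‖ + 2 * ρ ≤ s →
                  riemVolume (conformalMetric m)
                      (φ '' geodesicBall (pullbackMetric μ σ) Z z ρ) =
                    riemVolume (pullbackMetric μ σ)
                      (geodesicBall (pullbackMetric μ σ) Z z ρ)) ∧
                IsConformalModel (pullbackMetric μ σ) Z s χ φ ε m) := by
  obtain ⟨κ₀, hκ₀, h⟩ := exists_conformal_reparametrization hd hε hr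
  refine ⟨κ₀, hκ₀, fun m₁ hm₁ => ?_⟩
  obtain ⟨δ₀, hδ₀, h⟩ := h m₁ hm₁
  refine ⟨δ₀, hδ₀, fun n Z μ σ hZ hμ hσ hpos κ m₂ hκ hR hm₂ hvol p hp => ?_⟩
  have hM := isMetricOn_pullbackMetric hZ hμ hσ hpos
  exact ⟨hM.exists_isNormalCoords hZ hp hr, h _ Z hZ hM κ m₂ hκ hR hm₂ hvol p⟩
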